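/- All graphs are finite and simple. A *framework matroid* on the edges of a complete graph $K_W$ ($W$ finite) is given by a map $D$: an edge set is independent if, for some (equivalently, for generic) points $p_w$, the rows having $D(p_i,p_j)\in\mathbb R^3$ in the three columns of $i$, $-D(p_i,p_j)$ in those of $j$ and $0$ elsewhere are linearly independent. For $p_w\in\mathbb R^3$ and $D(x,y)=x-y$ this is the generic 3-dimensional rigidity matroid $\mathcal R_3$; for $p_w\in\mathbb R^2$ and $D(x,y)=((x_1-y_1)^2,(x_1-y_1)(x_2-y_2),(x_2-y_2)^2)$ it is Whiteley's cofactor matroid, which equals $\mathcal M_{K_5}$, the unique maximal matroid in which all $K_5$'s are circuits. A *3-dimensional abstract rigidity matroid* is a matroid on the edges of $K_W$ such that, writing $V(E)$ for the set of endpoints of $E$ and $K(U)$ for the set of all pairs of distinct elements of $U$: (a) if $|V(E)\cap V(F)|<3$ then $\mathrm{cl}(E\cup F)\subseteq K(V(E))\cup K(V(F))$; (b) if $\mathrm{cl}(E)=K(V(E))$, $\mathrm{cl}(F)=K(V(F))$ and $|V(E)\cap V(F)|\ge 3$ then $\mathrm{cl}(E\cup F)=K(V(E)\cup V(F))$. Fix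 a matroid $\mathcal M$ on the edges of $K_W$; graphs have vertices in $W$, and independence and rank refer to $\mathcal M$. **Covers.** A *2-thin cover* of $G$ is a set $\mathcal X$ of subsets (*clusters*) of $V(G)$ with at least two elements each, none contained in another, any two sharing at most two vertices, such that both endpoints of each edge lie in a common cluster. Its *shared set* $S(\mathcal X)$ consists of all pairs $\{x,y\}=X\cap Y$, $X\ne Y$ in $\mathcal X$; $\mathcal X$ is *independent* if $S(\mathcal X)$ is. Let $d(\mathcal X,e)$ be the number of clusters containing $e$. For a set $P$ of pairs put $$IE_P(G,\mathcal X)=\sum_{X\in\mathcal X}\mathrm{rank}\big((G\cup P)[X]\big)-\sum_{e\in P}(d(\mathcal X,e)-1),\qquad IE(G,\mathcal X)=IE_{S(\mathcal X)}(G,\mathcal X).$$ **Safe nonedge-splits.** A *nonedge-split* of $G$ at a nonedge $(a,b)$ deletes $a,b$ and adds new vertices $a_1,a_2,b_1,b_2$, the neighborhoods of $a_1,a_2$ (of $b_1,b_2$) forming an arbitrary partition, with possibly empty parts, of that of $a$ (of $b$); the result is $G^s$. For a cluster $X$ of a 2-thin cover $\mathcal X$ of $G$ let $X'$ arise from $X\setminus\{a,b\}$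 by adding, if $a\in X$, those of $a_1,a_2$ that are adjacent in $G^s$ to a vertex of $X$, and, if $b\in X$, those of $b_1,b_2$ that are. The split is *safe* on $(G,\mathcal X)$ if $(a,b)\in S(\mathcal X)$ and (i) whenever $X$ contains a nonedge of $G$ belonging to $S(\mathcal X)$, $X'$ contains exactly one of $a_1,a_2$ if $a\in X$ and exactly one of $b_1,b_2$ if $b\in X$; (ii) $X'\cap\{a_1,a_2\}=Y'\cap\{a_1,a_2\}$ whenever $X,Y\in\mathcal X$, $X\cap Y=\{a,u\}$, $u\neq b$ and $(a,u)$ is a nonedge of $G$ in $S(\mathcal X)$, and the same with $a$ and $b$ interchanged. The *safe split cover* $\mathcal X^s$ consists of those sets $X'$ with at least three elements that contain neither $\{a_1,a_2\}$ nor $\{b_1,b_2\}$, and of the endpoint pairs of the edges of $G^s$ contained in none of these sets. A *safe base graph* is an independent graph $G$ that has an independent 2-thin cover $\mathcal X$ with $\mathrm{rank}(G)=IE(G,\mathcal X)$ and a nonedge $(a,b)\in S(\mathcal X)$ that can be split by a safe nonedge-split on $(G,\mathcal X)$. **Safe split-and-glue.** For a set $\Gamma$ of *gluing vertices* and a cover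 $\mathcal Y$, a *key gluing pair* is a pair of distinct elements of $\Gamma$ contained in some cluster of $\mathcal Y$. A *safe ear* is a graph $H$ with gluing vertices $\Gamma\subseteq V(H)$ and an independent 2-thin cover $\mathcal Y$ (a *safe ear cover*) such that each cluster contains at most two gluing vertices, $S(\mathcal Y)$ together with all pairs of distinct gluing vertices is independent, and $\mathrm{rank}(H)=IE_{S(\mathcal Y)\cup F}(H,\mathcal Y)-1$, where $F$ is the set of key gluing pairs. A *safe split-and-glue* on a safe base graph $G$ and a safe ear $H$ takes $\mathcal X$ and a safe nonedge-split as in the definition of a safe base graph, and identifies the gluing vertices of $H$ with distinct vertices among $a_1,a_2,b_1,b_2$ of the otherwise disjoint graph $G^s$, in such a way that the key gluing pairs of $H$ with respect to $\mathcal Y$ become exactly the pairs of distinct vertices in $\{a_1,a_2,b_1,b_2\}$ contained in a cluster of $\mathcal X^s$; it yields the union of the two graphs. It is a safe *double-butterfly* split-and-glue if $H$ is the union of a $K_5$ on $\{p_1,q_1,u,v,c_1\}$ minus the edges $p_1q_1,uv$ and a $K_5$ on $\{p_2,q_2,u,v,c_2\}$ minus $p_2q_2,uv$ (eight distinct vertices)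 and its gluing vertices are $p_1,q_1,p_2,q_2$. A *$k$-sum* of $G$ and $H$ glues them along complete subgraphs on $k$ vertices, without deleting edges. A *Henneberg-I extension* adds a new vertex joined to three distinct vertices of $G$. **Theorem (Constructing safe base graphs).** The following yield a safe base graph: (i) a safe double-butterfly split-and-glue, if $\mathcal M$ is $\mathcal R_3$ or the cofactor matroid; (ii) for every $k\ge 0$, a $k$-sum of a safe base graph and an independent graph; (iii) a Henneberg-I extension of a safe base graph; where in (ii) and (iii) $\mathcal M$ is $\mathcal R_3$, the cofactor matroid or any 3-dimensional abstract rigidity matroid. -/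

import Mathlib

/-!
# Generic 3-dimensional rigidity, 2-thin covers, split-and-glue operations

All graphs are finite graphs whose vertices are taken from one finite type `W`; a graph is a pair
(vertex set, edge set), i.e. a subgraph of the complete graph on `W`.
-/

/-- A graph with vertices in `W`. -/
abbrev VGraph (W : Type*) := (⊤ : SimpleGraph W).Subgraph

namespace RigidityMatroids

/-! ### Generic framework matroids -/

/-- The row of the edge `{i, j}` in the matrix of the framework `p`: it is `D (p i) (p j)` in the
three columns of `i`, `- D (p i) (p j)` in the three columns of `j`, and `0` elsewhere (for some
orientation of the edge; the choice only affects the sign of the row). -/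
noncomputable def edgeRow {W : Type*} [DecidableEq W] {m : ℕ}
    (D : (Fin m → ℝ) → (Fin m → ℝ) → Fin 3 → ℝ) (p : W → Fin m → ℝ) (e : Sym2 W) :
    W × Fin 3 → ℝ := fun wk =>
  if wk.1 = (Quot.out e).1 then D (p (Quot.out e).1) (p (Quot.out e).2) wk.2
  else if wk.1 = (Quot.out e).2 then - D (p (Quot.out e).1) (p (Quot.out e).2) wk.2
  else 0

/-- The coordinates of `D x y` are polynomials in the coordinates of `x` and `y`. -/
def IsPolynomialMap {m : ℕ} (D : (Fin m → ℝ) → (Fin m → ℝ) → Fin 3 → ℝ) : Prop :=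
  ∀ k, ∃ P : MvPolynomial (Bool × Fin m) ℝ, ∀ x y,
    D x y k = MvPolynomial.eval (fun bi => if bi.1 then x bi.2 else y bi.2) P

/-- A set of edges of the complete graph on `W` is generically independent if its rows are linearly
independent in some (equivalently, in every generic) framework. -/
def GenericIndep {W : Type*} [DecidableEq W] {m : ℕ}
    (D : (Fin m → ℝ) → (Fin m → ℝ) → Fin 3 → ℝ) (I : Set (Sym2 W)) : Prop :=
  (∀ e ∈ I, ¬ e.IsDiag) ∧ ∃ p : W → Fin m → ℝ, LinearIndepOn ℝ (edgeRow D p) I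

theorem edgeRow_polynomial {W : Type*} [DecidableEq W] {m : ℕ}
    {D : (Fin m → ℝ) → (Fin m → ℝ) → Fin 3 → ℝ} (hD : IsPolynomialMap D) :
    ∃ Q : Sym2 W → W × Fin 3 → MvPolynomial (W × Fin m) ℝ, ∀ p e wk,
      edgeRow D p e wk = MvPolynomial.eval (fun vi => p vi.1 vi.2) (Q e wk) := by
  choose P hP using hD
  let R : Sym2 W → Fin 3 → MvPolynomial (W × Fin m) ℝ := fun e k =>
    MvPolynomial.rename (fun bi : Bool × Fin m =>
      (if bi.1 then (Quot.out e).1 else (Quot.out e).2, bi.2)) (P k)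
  have hR : ∀ (p : W → Fin m → ℝ) e k, D (p (Quot.out e).1) (p (Quot.out e).2) k =
      MvPolynomial.eval (fun vi => p vi.1 vi.2) (R e k) := by
    intro p e k
    rw [hP, MvPolynomial.eval_rename]
    congr 1
    congr 1
    funext ⟨b, i⟩
    cases b <;> simp
  refine ⟨fun e wk => if wk.1 = (Quot.out e).1 then R e wk.2
    else if wk.1 = (Quot.out e).2 then - R e wk.2 else 0, ?_⟩
  intro p e wk
  unfold edgeRow
  dsimp only
  split_ifs <;> simp [hR]

/-- Some framework realizes all generically independent sets simultaneously. -/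
theorem exists_generic {W : Type*} [Fintype W] [DecidableEq W] {m : ℕ}
    {D : (Fin m → ℝ) → (Fin m → ℝ) → Fin 3 → ℝ} (hD : IsPolynomialMap D) :
    ∃ p : W → Fin m → ℝ, ∀ I : Set (Sym2 W), GenericIndep D I →
      LinearIndepOn ℝ (edgeRow D p) I := by
  classical
  obtain ⟨Q, hQ⟩ := edgeRow_polynomial (W := W) hD
  let A : (I : Finset (Sym2 W)) → Matrix I (W × Fin 3) (MvPolynomial (W × Fin m) ℝ) :=
    fun I => Matrix.of fun e wk => Q e wk
  let g : Finset (Sym2 W) → MvPolynomial (W × Fin m) ℝ := fun I => (A I * (A I).transpose).det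
  have key : ∀ (I : Finset (Sym2 W)) (p : W → Fin m → ℝ),
      LinearIndepOn ℝ (edgeRow D p) (I : Set (Sym2 W)) ↔
        MvPolynomial.eval (fun vi => p vi.1 vi.2) (g I) ≠ 0 := by
    intro I p
    let B : Matrix I (W × Fin 3) ℝ := Matrix.of fun e wk => edgeRow D p e wk
    have hB : MvPolynomial.eval (fun vi => p vi.1 vi.2) (g I) = (B * B.transpose).det := by
      change (MvPolynomial.eval (fun vi => p vi.1 vi.2)) ((A I * (A I).transpose).det) = _
      rw [RingHom.map_det]
      congr 1
      ext i j
      simp [A, B, Matrix.mul_apply, hQ]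
    rw [hB]
    have h1 : LinearIndepOn ℝ (edgeRow D p) (I : Set (Sym2 W)) ↔ LinearIndependent ℝ B.row :=
      Iff.rfl
    rw [h1, ← isUnit_iff_ne_zero, ← Matrix.isUnit_iff_isUnit_det,
      ← Matrix.linearIndependent_rows_iff_isUnit]
    rw [linearIndependent_iff_card_eq_finrank_span, linearIndependent_iff_card_eq_finrank_span]
    rw [Set.finrank, Set.finrank, ← Matrix.rank_eq_finrank_span_row,
      ← Matrix.rank_eq_finrank_span_row, Matrix.rank_self_mul_transpose]
  have hne : (∏ I ∈ Finset.univ.filter (fun I => g I ≠ 0), g I) ≠ 0 :=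
    Finset.prod_ne_zero_iff.2 fun I hI => (Finset.mem_filter.1 hI).2
  obtain ⟨x, hx⟩ : ∃ x, MvPolynomial.eval x
      (∏ I ∈ Finset.univ.filter (fun I => g I ≠ 0), g I) ≠ 0 := by
    by_contra hcon
    push Not at hcon
    exact hne (MvPolynomial.funext fun x => by simpa using hcon x)
  refine ⟨fun w i => x (w, i), fun I hI => ?_⟩
  obtain ⟨-, q, hq⟩ := hI
  have hIf : ((I.toFinite.toFinset : Finset (Sym2 W)) : Set (Sym2 W)) = I := by simp
  rw [← hIf] at hq ⊢
  rw [key] at hq ⊢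
  have hgI : g I.toFinite.toFinset ≠ 0 := fun h => hq (by rw [h, map_zero])
  rw [map_prod] at hx
  exact Finset.prod_ne_zero_iff.1 hx _ (by simpa using hgI)

/-- The generic framework matroid of `D` on the edges of the complete graph on `W`. -/
noncomputable def frameworkMatroid (W : Type*) [Fintype W] [DecidableEq W] {m : ℕ}
    (D : (Fin m → ℝ) → (Fin m → ℝ) → Fin 3 → ℝ) (hD : IsPolynomialMap D) : Matroid (Sym2 W) :=
  (IndepMatroid.ofFinite (E := {e : Sym2 W | ¬ e.IsDiag}) (Set.toFinite _) (GenericIndep D)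
    ⟨by simp, 0, linearIndepOn_empty _ _⟩
    (fun _ _ hJ hIJ => ⟨fun e he => hJ.1 e (hIJ he), hJ.2.imp fun _ h => h.mono hIJ⟩)
    (by
      intro I J hI hJ hIJ
      obtain ⟨p, hp⟩ := exists_generic (W := W) hD
      have hI' := hp I hI
      have hJ' := hp J hJ
      by_contra hcon
      push Not at hcon
      have hsub : edgeRow D p '' J ⊆ Submodule.span ℝ (edgeRow D p '' I) := by
        rintro _ ⟨e, he, rfl⟩
        by_contra hspan
        have heI : e ∉ I := fun h => hspan (Submodule.subset_span ⟨e, h, rfl⟩)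
        refine hcon e he heI ⟨?_, p, hI'.insert hspan⟩
        rintro f (rfl | hf)
        · exact hJ.1 _ he
        · exact hI.1 f hf
      have hle := Submodule.finrank_mono (Submodule.span_le.2 hsub)
      have card : ∀ K : Set (Sym2 W), LinearIndepOn ℝ (edgeRow D p) K →
          Module.finrank ℝ (Submodule.span ℝ (edgeRow D p '' K)) = K.ncard := by
        intro K hK
        have : Fintype K := Fintype.ofFinite K
        rw [Set.image_eq_range, finrank_span_eq_card hK, ← Nat.card_eq_fintype_card,
          Nat.card_coe_set_eq]
      rw [card I hI', card J hJ'] at hle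
      omega)
    (fun _ hI e he => hI.1 e he)).matroid

theorem frameworkMatroid_indep_iff (W : Type*) [Fintype W] [DecidableEq W] {m : ℕ}
    (D : (Fin m → ℝ) → (Fin m → ℝ) → Fin 3 → ℝ) (hD : IsPolynomialMap D) (I : Set (Sym2 W)) :
    (frameworkMatroid W D hD).Indep I ↔ GenericIndep D I := Iff.rfl

/-- The direction vector `x - y` of a bar in 3-space. -/
def barDirection (x y : Fin 3 → ℝ) : Fin 3 → ℝ := fun k => x k - y k

theorem barDirection_polynomial : IsPolynomialMap barDirection := fun k =>
  ⟨MvPolynomial.X (true, k) - MvPolynomial.X (false, k), fun x y => by simp [barDirection]⟩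

/-- The vector `((x₀ - y₀)², (x₀ - y₀)(x₁ - y₁), (x₁ - y₁)²)` of two points of the plane. -/
def cofactorDirection (x y : Fin 2 → ℝ) : Fin 3 → ℝ :=
  ![(x 0 - y 0) ^ 2, (x 0 - y 0) * (x 1 - y 1), (x 1 - y 1) ^ 2]

theorem cofactorDirection_polynomial : IsPolynomialMap cofactorDirection := by
  let d : Fin 2 → MvPolynomial (Bool × Fin 2) ℝ := fun i =>
    MvPolynomial.X (true, i) - MvPolynomial.X (false, i)
  intro k
  refine ⟨(![d 0 ^ 2, d 0 * d 1, d 1 ^ 2] : Fin 3 → MvPolynomial (Bool × Fin 2) ℝ) k, ?_⟩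
  intro x y
  fin_cases k <;> simp [cofactorDirection, d]

/-- The generic 3-dimensional rigidity matroid `R₃` of the complete graph on `W`. -/
noncomputable def genericRigidityMatroid (W : Type*) [Fintype W] [DecidableEq W] :
    Matroid (Sym2 W) :=
  frameworkMatroid W barDirection barDirection_polynomial

/-- Whiteley's cofactor matroid `C₂¹` of the complete graph on `W`; it is the unique maximal matroid
in which every `K₅` is a circuit (a theorem of Clinch, Jackson and Tanigawa). -/
noncomputable def cofactorMatroid (W : Type*) [Fintype W] [DecidableEq W] : Matroid (Sym2 W) :=
  frameworkMatroid W cofactorDirection cofactorDirection_polynomial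

/-- The set of endpoints of a set of edges. -/
def endpoints {W : Type*} (E : Set (Sym2 W)) : Set W := {x | ∃ e ∈ E, x ∈ e}

/-- The edge set of the complete graph on the vertex set `U`. -/
def completeOn {W : Type*} (U : Set W) : Set (Sym2 W) := {e | ¬ e.IsDiag ∧ ∀ x ∈ e, x ∈ U}

/-- 3-dimensional abstract rigidity matroids on the edge set of the complete graph on `W`, by
Graver's two closure axioms. -/
structure IsAbstractRigidityMatroid {W : Type*} (M : Matroid (Sym2 W)) : Prop where
  ground_eq : M.E = completeOn Set.univ
  closure_subset : ∀ E F : Set (Sym2 W), E ⊆ M.E → F ⊆ M.E →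
    (endpoints E ∩ endpoints F).encard < 3 →
    M.closure (E ∪ F) ⊆ completeOn (endpoints E) ∪ completeOn (endpoints F)
  closure_eq : ∀ E F : Set (Sym2 W), E ⊆ M.E → F ⊆ M.E →
    M.closure E = completeOn (endpoints E) → M.closure F = completeOn (endpoints F) →
    3 ≤ (endpoints E ∩ endpoints F).encard →
    M.closure (E ∪ F) = completeOn (endpoints E ∪ endpoints F)

end RigidityMatroids

namespace SplitAndGlue

open RigidityMatroids

/-! ### 2-thin covers and inclusion-exclusion rank counts -/

/-- The rank of an edge set, as an integer. -/
noncomputable def rk {W : Type*} (M : Matroid (Sym2 W)) (E : Set (Sym2 W)) : ℤ :=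
  ((M.eRk E).toNat : ℤ)

/-- A graph is independent if its edge set is. -/
def IsIndependent {W : Type*} (M : Matroid (Sym2 W)) (G : VGraph W) : Prop := M.Indep G.edgeSet

/-- `X` is a 2-thin cover of `G`. -/
structure IsTwoThinCover {W : Type*} [DecidableEq W] (G : VGraph W) (X : Finset (Finset W)) :
    Prop where
  subset_verts : ∀ A ∈ X, (A : Set W) ⊆ G.verts
  two_le_card : ∀ A ∈ X, 2 ≤ A.card
  card_inter_le : ∀ A ∈ X, ∀ B ∈ X, A ≠ B → (A ∩ B).card ≤ 2
  not_subset : ∀ A ∈ X, ∀ B ∈ X, A ≠ B → ¬ A ⊆ B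
  covers : ∀ x y, G.Adj x y → ∃ A ∈ X, x ∈ A ∧ y ∈ A

open Classical in
/-- The shared set `S(X)`: the pairs `{x, y} = A ∩ B` with `A ≠ B` in `X`. -/
noncomputable def sharedSet {W : Type*} [Fintype W] [DecidableEq W] (X : Finset (Finset W)) :
    Finset (Sym2 W) :=
  Finset.univ.filter fun e => ∃ A ∈ X, ∃ B ∈ X, A ≠ B ∧ ∃ x y, x ≠ y ∧ A ∩ B = {x, y} ∧ e = s(x, y)

open Classical in
/-- `d(X, e)`: the number of members of `X` that contain both endpoints of `e`. -/
noncomputable def coverDegree {W : Type*} (X : Finset (Finset W)) (e : Sym2 W) : ℕ :=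
  (X.filter fun A => ∀ x ∈ e, x ∈ A).card

/-- The members of `E` with both endpoints in `A`. -/
def inducedEdges {W : Type*} (E : Set (Sym2 W)) (A : Finset W) : Set (Sym2 W) :=
  {e ∈ E | ∀ x ∈ e, x ∈ A}

/-- The sum of `rank((G ∪ P)[A])` over `A ∈ X` minus the sum of `d(X, e) - 1` over `e ∈ P`. -/
noncomputable def ieCountWith {W : Type*} (M : Matroid (Sym2 W)) (G : VGraph W)
    (X : Finset (Finset W)) (P : Finset (Sym2 W)) : ℤ :=
  ∑ A ∈ X, rk M (inducedEdges (G.edgeSet ∪ P) A) - ∑ e ∈ P, ((coverDegree X e : ℤ) - 1)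

/-- The inclusion-exclusion rank count `IE(G, X)`. -/
noncomputable def ieCount {W : Type*} [Fintype W] [DecidableEq W] (M : Matroid (Sym2 W))
    (G : VGraph W) (X : Finset (Finset W)) : ℤ :=
  ieCountWith M G X (sharedSet X)

/-- The 2-thin cover `X` (or its shared set) is independent. -/
def IsIndependentCover {W : Type*} [Fintype W] [DecidableEq W] (M : Matroid (Sym2 W))
    (X : Finset (Finset W)) : Prop :=
  M.Indep (sharedSet X : Set (Sym2 W))

/-! ### Nonedge-splits

A nonedge-split of `G` at a nonedge `(a, b)` replaces `a` by `a' 0, a' 1` and `b` by `b' 0, b' 1`.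
The partition of the neighborhood of `a` is recorded by a function `α : W → Fin 2`: the neighbor `w`
of `a` becomes a neighbor of `a' (α w)`; likewise `β` for `b`. Only the values of `α` and `β` on the
neighborhoods matter. -/

/-- The indices `i` such that the copy `i` of `a` belongs to the set that replaces the cluster `A`:
`a` lies in `A`, and its copy `i` is adjacent in the split graph to a vertex of `A`. -/
def copies {W : Type*} (G : VGraph W) (a : W) (α : W → Fin 2) (A : Finset W) : Set (Fin 2) :=
  {i | a ∈ A ∧ ∃ w ∈ A, G.Adj a w ∧ α w = i}

/-- `A` contains both endpoints of some nonedge of `G` in `S(X)`. -/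
def HasSharedNonedge {W : Type*} [Fintype W] [DecidableEq W] (G : VGraph W)
    (X : Finset (Finset W)) (A : Finset W) : Prop :=
  ∃ x ∈ A, ∃ y ∈ A, s(x, y) ∈ sharedSet X ∧ ¬ G.Adj x y

/-- The conditions at the endpoint `a` for splitting `(a, b)` to be safe. The clusters containing a
shared nonedge keep exactly one copy of `a` if they contain `a`; clusters meeting in a nonedge
`(a, u)` with `u ≠ b` keep the same copies of `a`. -/
structure IsSafeAt {W : Type*} [Fintype W] [DecidableEq W] (G : VGraph W) (X : Finset (Finset W))
    (a b : W) (α : W → Fin 2) : Prop where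
  not_both : ∀ A ∈ X, HasSharedNonedge G X A → ¬ (0 ∈ copies G a α A ∧ 1 ∈ copies G a α A)
  nonempty : ∀ A ∈ X, HasSharedNonedge G X A → a ∈ A → (copies G a α A).Nonempty
  eq_of_inter : ∀ A ∈ X, ∀ B ∈ X, ∀ u, u ≠ a → u ≠ b → A ∩ B = {a, u} → s(a, u) ∈ sharedSet X →
    ¬ G.Adj a u → copies G a α A = copies G a α B

/-- The split of the nonedge `(a, b)` in the shared set of `X` along `α`, `β` is safe. -/
structure IsSafeNonedgeSplit {W : Type*} [Fintype W] [DecidableEq W] (G : VGraph W)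
    (X : Finset (Finset W)) (a b : W) (α β : W → Fin 2) : Prop where
  mem_shared : s(a, b) ∈ sharedSet X
  nonedge : ¬ G.Adj a b
  safe_left : IsSafeAt G X a b α
  safe_right : IsSafeAt G X b a β

/-- `X` is a cover, and `(a, b), α, β` a safe nonedge-split, witnessing that `G` is a safe base
graph. -/
structure IsSafeBaseWitness {W : Type*} [Fintype W] [DecidableEq W] (M : Matroid (Sym2 W))
    (G : VGraph W) (X : Finset (Finset W)) (a b : W) (α β : W → Fin 2) : Prop where
  independent : IsIndependent M G
  twoThin : IsTwoThinCover G X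
  independentCover : IsIndependentCover M X
  rank_eq : rk M G.edgeSet = ieCount M G X
  safeSplit : IsSafeNonedgeSplit G X a b α β

/-- Safe base graphs. -/
def IsSafeBaseGraph {W : Type*} [Fintype W] [DecidableEq W] (M : Matroid (Sym2 W))
    (G : VGraph W) : Prop :=
  ∃ X a b α β, IsSafeBaseWitness M G X a b α β

/-- The four new vertices `a' 0, a' 1, b' 0, b' 1` are distinct and are not vertices of `G`. -/
structure AreNewVertices {W : Type*} (G : VGraph W) (a' b' : Fin 2 → W) : Prop where
  left_ne : a' 0 ≠ a' 1
  right_ne : b' 0 ≠ b' 1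
  left_ne_right : ∀ i j, a' i ≠ b' j
  left_notMem : ∀ i, a' i ∉ G.verts
  right_notMem : ∀ i, b' i ∉ G.verts

/-- `y` is a remaining vertex of `G` and `x` is the copy of `a` or `b` that is adjacent to `y` in
the split graph. -/
def IsCopyEdge {W : Type*} (G : VGraph W) (a b : W) (α β : W → Fin 2) (a' b' : Fin 2 → W)
    (x y : W) : Prop :=
  y ≠ a ∧ y ≠ b ∧ ((G.Adj a y ∧ x = a' (α y)) ∨ (G.Adj b y ∧ x = b' (β y)))

/-- The split graph. -/
def splitGraph {W : Type*} (G : VGraph W) (a b : W) (α β : W → Fin 2) (a' b' : Fin 2 → W) :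
    VGraph W where
  verts := (G.verts \ {a, b}) ∪ Set.range a' ∪ Set.range b'
  Adj x y := x ≠ y ∧ ((G.Adj x y ∧ x ≠ a ∧ x ≠ b ∧ y ≠ a ∧ y ≠ b) ∨
    IsCopyEdge G a b α β a' b' x y ∨ IsCopyEdge G a b α β a' b' y x)
  adj_sub h := h.1
  edge_vert := by
    rintro x y ⟨-, ⟨h, hxa, hxb, -, -⟩ | ⟨-, -, ⟨-, rfl⟩ | ⟨-, rfl⟩⟩ | ⟨hxa, hxb, ⟨h, -⟩ | ⟨h, -⟩⟩⟩
    · exact Or.inl (Or.inl ⟨G.edge_vert h, by simp [hxa, hxb]⟩)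
    · exact Or.inl (Or.inr ⟨_, rfl⟩)
    · exact Or.inr ⟨_, rfl⟩
    · exact Or.inl (Or.inl ⟨G.edge_vert h.symm, by simp [hxa, hxb]⟩)
    · exact Or.inl (Or.inl ⟨G.edge_vert h.symm, by simp [hxa, hxb]⟩)
  symm := ⟨by
    rintro x y ⟨hne, ⟨h, h1, h2, h3, h4⟩ | h | h⟩
    · exact ⟨hne.symm, Or.inl ⟨h.symm, h3, h4, h1, h2⟩⟩
    · exact ⟨hne.symm, Or.inr (Or.inr h)⟩
    · exact ⟨hne.symm, Or.inr (Or.inl h)⟩⟩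

open Classical in
/-- The set that replaces the cluster `A`: the vertices `a, b` are removed and the copies of them
that are adjacent in the split graph to a vertex of `A` are added (for those of `a, b` in `A`). -/
noncomputable def splitCluster {W : Type*} (G : VGraph W) (a b : W) (α β : W → Fin 2)
    (a' b' : Fin 2 → W) (A : Finset W) : Finset W :=
  (A \ {a, b}) ∪ (Finset.univ.filter fun i => i ∈ copies G a α A).image a' ∪
    (Finset.univ.filter fun i => i ∈ copies G b β A).image b'

open Classical in
/-- The members of size at least three of the safe split cover. -/
noncomputable def safeSplitBig {W : Type*} (G : VGraph W) (X : Finset (Finset W)) (a b : W)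
    (α β : W → Fin 2) (a' b' : Fin 2 → W) : Finset (Finset W) :=
  (X.image (splitCluster G a b α β a' b')).filter fun A =>
    2 < A.card ∧ ¬ ({a' 0, a' 1} ⊆ A) ∧ ¬ ({b' 0, b' 1} ⊆ A)

open Classical in
/-- The safe split cover; its members of size two are the endpoint sets of the edges of the split
graph that are not contained in a larger member. -/
noncomputable def safeSplitCover {W : Type*} [Fintype W] (G : VGraph W) (X : Finset (Finset W))
    (a b : W) (α β : W → Fin 2) (a' b' : Fin 2 → W) : Finset (Finset W) :=
  safeSplitBig G X a b α β a' b' ∪ Finset.univ.filter fun A =>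
    (∃ x y, (splitGraph G a b α β a' b').Adj x y ∧ A = {x, y}) ∧
      ∀ B ∈ safeSplitBig G X a b α β a' b', ¬ A ⊆ B

/-! ### Gluing -/

/-- All pairs of distinct elements of `Γ`. -/
def allPairs {W : Type*} (Γ : Finset W) : Set (Sym2 W) := {e | ¬ e.IsDiag ∧ ∀ x ∈ e, x ∈ Γ}

open Classical in
/-- The pairs of distinct elements of `Γ` that are contained in some member of `X`. -/
noncomputable def keyPairs {W : Type*} [Fintype W] (Γ : Finset W) (X : Finset (Finset W)) :
    Finset (Sym2 W) :=
  Finset.univ.filter fun e => e ∈ allPairs Γ ∧ ∃ A ∈ X, ∀ x ∈ e, x ∈ A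

/-- `Y` is a safe ear cover of `H` with set of gluing vertices `Γ`. -/
structure IsSafeEarCover {W : Type*} [Fintype W] [DecidableEq W] (M : Matroid (Sym2 W))
    (H : VGraph W) (Γ : Finset W) (Y : Finset (Finset W)) : Prop where
  gluing_subset : (Γ : Set W) ⊆ H.verts
  twoThin : IsTwoThinCover H Y
  independentCover : IsIndependentCover M Y
  card_inter_le : ∀ A ∈ Y, (A ∩ Γ).card ≤ 2
  indep_union : M.Indep ((sharedSet Y : Set (Sym2 W)) ∪ allPairs Γ)
  rank_eq : rk M H.edgeSet = ieCountWith M H Y (sharedSet Y ∪ keyPairs Γ Y) - 1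

/-- `G'` results from a safe split-and-glue on the safe base graph `G` and the safe ear `H` with set
of gluing vertices `Γ`: a safe nonedge-split, giving the split graph, and then a glue of the split
graph and `H` along `Γ` that matches their key gluing pairs. -/
def IsSafeSplitAndGlue {W : Type*} [Fintype W] [DecidableEq W] (M : Matroid (Sym2 W))
    (G H : VGraph W) (Γ : Finset W) (G' : VGraph W) : Prop :=
  ∃ X a b α β, IsSafeBaseWitness M G X a b α β ∧
  ∃ a' b', AreNewVertices G a' b' ∧
  ∃ Y, IsSafeEarCover M H Γ Y ∧
    Γ ⊆ {a' 0, a' 1, b' 0, b' 1} ∧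
    (splitGraph G a b α β a' b').verts ∩ H.verts = Γ ∧
    keyPairs {a' 0, a' 1, b' 0, b' 1} (safeSplitCover G X a b α β a' b') = keyPairs Γ Y ∧
    G' = splitGraph G a b α β a' b' ⊔ H

/-- The butterfly on `p, q, u, v, c`: the complete graph minus the edges `pq` and `uv`. -/
def butterfly {W : Type*} (p q u v c : W) : VGraph W where
  verts := {p, q, u, v, c}
  Adj x y := x ≠ y ∧ x ∈ ({p, q, u, v, c} : Set W) ∧ y ∈ ({p, q, u, v, c} : Set W) ∧
    s(x, y) ≠ s(p, q) ∧ s(x, y) ≠ s(u, v)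
  adj_sub h := h.1
  edge_vert h := h.2.1
  symm := ⟨fun x y h =>
    ⟨h.1.symm, h.2.2.1, h.2.1, Sym2.eq_swap (a := x) (b := y) ▸ h.2.2.2⟩⟩

/-- `H` is a double-butterfly with set of gluing vertices `Γ`: two butterflies glued together on the
nonedge `(u, v)`; the gluing vertices are the endpoints of the other nonedge of each butterfly. -/
def IsDoubleButterfly {W : Type*} [DecidableEq W] (H : VGraph W) (Γ : Finset W) : Prop :=
  ∃ p₁ q₁ p₂ q₂ u v c₁ c₂ : W, [p₁, q₁, p₂, q₂, u, v, c₁, c₂].Nodup ∧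
    H = butterfly p₁ q₁ u v c₁ ⊔ butterfly p₂ q₂ u v c₂ ∧ Γ = {p₁, q₁, p₂, q₂}

/-! ### `k`-sums and Henneberg-I extensions -/

/-- `U` is a set of vertices of `G` that are pairwise adjacent. -/
def IsCliqueOf {W : Type*} (G : VGraph W) (U : Finset W) : Prop :=
  (U : Set W) ⊆ G.verts ∧ ∀ x ∈ U, ∀ y ∈ U, x ≠ y → G.Adj x y

/-- `G'` is a `k`-sum (without edge deletion) of `G` and `H`: the graphs are glued along complete
subgraphs on `k` vertices. -/
def IsKSum {W : Type*} (k : ℕ) (G H G' : VGraph W) : Prop :=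
  ∃ U : Finset W, U.card = k ∧ IsCliqueOf G U ∧ IsCliqueOf H U ∧ G.verts ∩ H.verts = U ∧
    G' = G ⊔ H

/-- `G'` is a Henneberg-I extension of `G`: a new vertex `z` is joined to three vertices of `G`. -/
def IsHennebergI {W : Type*} (G G' : VGraph W) : Prop :=
  ∃ (z : W) (T : Finset W), z ∉ G.verts ∧ T.card = 3 ∧ (T : Set W) ⊆ G.verts ∧
    G'.verts = insert z G.verts ∧ G'.edgeSet = G.edgeSet ∪ {e | ∃ t ∈ T, e = s(z, t)}

end SplitAndGlue

namespace SplitAndGlue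

open RigidityMatroids

/-! ### Ranks as integers -/

section Rank

variable {W : Type*} [Fintype W] {M : Matroid (Sym2 W)} {E F I : Set (Sym2 W)}

/-! Everything rests on one reformulation. For an independent graph, rank equals the
inclusion-exclusion count exactly when the nullities of the graphs (G ∪ S)[X], summed over the
clusters X, equal the number of shared nonedges (`IsTwoThinCover.rk_eq_ieCount_iff`). Clusters
without shared nonedges contribute nothing, and edges in no cluster can be covered by two-element
clusters without changing the shared set. So a safe base graph is certified by a family of relevant
clusters with the right nullity count (`isSafeBaseGraph_of_clusterFamily`).

For k-sums and Henneberg-I extensions the old clusters and the old split survive, since no edge is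
added between old vertices; only independence of the new graph is at stake. It follows from two
properties common to all the matroids concerned (`IsRigidityLike`): 0-extensions preserve
independence, and K₅ is dependent. They determine the ranks of complete graphs and hence allow
gluing along cliques (`IsRigidityLike.indep_union`).

For the double-butterfly operation, independence comes from folding: the copies of a and b return to
a and b, and both butterflies are laid onto a single butterfly attached to G at the nonedge ab. By
`linearIndepOn_of_collapse` it suffices that the folded graph is independent and that the double
butterfly alone is independent in the folded position.

For the cover, a safe split turns each cluster with a shared nonedge into a relabeled copy of
itself. The pair ab turns into pairs of copies, all of which are key gluing pairs. Two distinct key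
gluing pairs can only be the two missing edges p₁q₁, p₂q₂: adding any other two pairs to the double
butterfly raises its rank by two, whereas the equation in the definition of a safe ear allows only
one (`keyPairs_doubleButterfly`). Two cases remain.

If ab turns into a single pair, all counts are unchanged and this pair can be split again. If it
turns into both p₁q₁ and p₂q₂, the vertex sets of the butterflies become clusters. Then ab is
replaced by p₁q₁, p₂q₂ and uv, two more shared nonedges than before, balanced by two new K₅'s of
nullity one; now uv can be split. In both cases the new split sends all neighbors to one copy, which
is safe because the split vertices have a neighbor in each relevant cluster containing them. -/

theorem coe_rk (M : Matroid (Sym2 W)) (E : Set (Sym2 W)) :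
    (((M.eRk E).toNat : ℕ) : ℕ∞) = M.eRk E :=
  ENat.natCast_toNat (ne_top_of_le_ne_top (Set.encard_ne_top_iff.2 E.toFinite) (M.eRk_le_encard E))

theorem rk_mono (h : E ⊆ F) : rk M E ≤ rk M F := by
  have := M.eRk_mono h
  rw [← coe_rk M E, ← coe_rk M F] at this
  unfold rk
  exact_mod_cast this

theorem rk_le_ncard (M : Matroid (Sym2 W)) (E : Set (Sym2 W)) : rk M E ≤ E.ncard := by
  have := M.eRk_le_encard E
  rw [← coe_rk, ← E.toFinite.cast_ncard_eq] at this
  unfold rk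
  exact_mod_cast this

theorem rk_union_le (M : Matroid (Sym2 W)) (E F : Set (Sym2 W)) :
    rk M (E ∪ F) ≤ rk M E + rk M F := by
  have := M.eRk_union_le_eRk_add_eRk E F
  rw [← coe_rk M E, ← coe_rk M F, ← coe_rk M (E ∪ F)] at this
  unfold rk
  exact_mod_cast this

theorem rk_closure (M : Matroid (Sym2 W)) (E : Set (Sym2 W)) : rk M (M.closure E) = rk M E := by
  unfold rk
  rw [M.eRk_closure_eq]

theorem rk_le_of_subset_closure (h : E ⊆ M.closure F) : rk M E ≤ rk M F :=
  (rk_mono h).trans (rk_closure M F).le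

theorem indep_iff_rk : M.Indep I ↔ rk M I = I.ncard := by
  rw [M.indep_iff_eRk_eq_encard_of_finite I.toFinite, ← coe_rk, ← I.toFinite.cast_ncard_eq]
  unfold rk
  norm_cast

theorem indep_of_ncard_le_rk (h : (I.ncard : ℤ) ≤ rk M I) : M.Indep I :=
  indep_iff_rk.2 (le_antisymm (rk_le_ncard M I) h)

theorem rk_eq_ncard_of_isBasis' (h : M.IsBasis' I E) : rk M E = I.ncard := by
  have := h.encard_eq_eRk
  rw [← coe_rk, ← I.toFinite.cast_ncard_eq] at this
  unfold rk
  exact_mod_cast this.symm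

theorem ncard_le_rk (h : M.Indep I) (hIE : I ⊆ E) : (I.ncard : ℤ) ≤ rk M E :=
  (indep_iff_rk.1 h).symm.le.trans (rk_mono hIE)

theorem exists_basis_superset (h : M.Indep I) (hIE : I ⊆ E) :
    ∃ J, M.Indep J ∧ I ⊆ J ∧ J ⊆ E ∧ rk M E = J.ncard := by
  obtain ⟨J, hJ, hIJ⟩ := h.subset_isBasis'_of_subset hIE
  exact ⟨J, hJ.indep, hIJ, hJ.subset, rk_eq_ncard_of_isBasis' hJ⟩

end Rank

/-! ### Matroids with the basic properties of three-dimensional rigidity -/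

/-- The edges joining `z` to the vertices in `T`. -/
def starOn {W : Type*} (z : W) (T : Finset W) : Set (Sym2 W) := {e | ∃ t ∈ T, e = s(z, t)}

/-- Matroids on the edges of a complete graph that allow 0-extensions and in which no `K₅` is
independent. -/
structure IsRigidityLike {W : Type*} (M : Matroid (Sym2 W)) : Prop where
  ground_eq : M.E = completeOn Set.univ
  indep_star : ∀ (E : Set (Sym2 W)) (z : W) (T : Finset W), M.Indep E → z ∉ endpoints E → z ∉ T →
    T.card ≤ 3 → M.Indep (E ∪ starOn z T)
  not_indep_five : ∀ U : Finset W, U.card = 5 → ¬ M.Indep (completeOn (U : Set W))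

section Basic

variable {W : Type*}

theorem mem_completeOn {U : Set W} {x y : W} : s(x, y) ∈ completeOn U ↔ x ≠ y ∧ x ∈ U ∧ y ∈ U := by
  simp [completeOn]

theorem completeOn_mono {U V : Set W} (h : U ⊆ V) : completeOn U ⊆ completeOn V :=
  fun _ he => ⟨he.1, fun x hx => h (he.2 x hx)⟩

theorem notMem_endpoints_of_subset {E : Set (Sym2 W)} {U : Set W} {z : W} (h : E ⊆ completeOn U)
    (hz : z ∉ U) : z ∉ endpoints E := by
  rintro ⟨e, he, hze⟩
  exact hz ((h he).2 z hze)

theorem endpoints_subset_of_subset {E : Set (Sym2 W)} {U : Set W} (h : E ⊆ completeOn U) :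
    endpoints E ⊆ U := by
  rintro z ⟨e, he, hze⟩
  exact (h he).2 z hze

theorem completeOn_inter (U V : Set W) :
    completeOn (U ∩ V) = completeOn U ∩ completeOn V := by
  ext e
  simp only [completeOn, Set.mem_ofPred_eq, Set.mem_inter_iff]
  exact ⟨fun h => ⟨⟨h.1, fun x hx => (h.2 x hx).1⟩, h.1, fun x hx => (h.2 x hx).2⟩,
    fun h => ⟨h.1.1, fun x hx => ⟨h.1.2 x hx, h.2.2 x hx⟩⟩⟩

theorem mem_starOn {z : W} {T : Finset W} {e : Sym2 W} : e ∈ starOn z T ↔ ∃ t ∈ T, e = s(z, t) :=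
  Iff.rfl

theorem completeOn_insert [DecidableEq W] (z : W) (U : Finset W) (hz : z ∉ U) :
    completeOn ((insert z U : Finset W) : Set W) = completeOn (U : Set W) ∪ starOn z U := by
  ext e
  induction e with | _ x y
  simp only [mem_completeOn, Finset.coe_insert, Set.mem_insert_iff, Finset.mem_coe, Set.mem_union,
    mem_starOn, Sym2.eq_iff]
  constructor
  · rintro ⟨hne, rfl | hx, rfl | hy⟩
    · exact absurd rfl hne
    · exact Or.inr ⟨y, hy, Or.inl ⟨rfl, rfl⟩⟩
    · exact Or.inr ⟨x, hx, Or.inr ⟨rfl, rfl⟩⟩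
    · exact Or.inl ⟨hne, hx, hy⟩
  · rintro (⟨hne, hx, hy⟩ | ⟨t, ht, ⟨rfl, rfl⟩ | ⟨rfl, rfl⟩⟩)
    · exact ⟨hne, Or.inr hx, Or.inr hy⟩
    · exact ⟨fun h => hz (h ▸ ht), Or.inl rfl, Or.inr ht⟩
    · exact ⟨fun h => hz (h ▸ ht), Or.inr ht, Or.inl rfl⟩

theorem ncard_starOn (z : W) (T : Finset W) : (starOn z T).ncard = T.card := by
  classical
  have : starOn z T = (fun t => s(z, t)) '' (T : Set W) := by
    ext e
    simp [mem_starOn, eq_comm]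
  rw [this, Set.ncard_image_of_injective _ (fun x y h => Sym2.congr_right.1 h),
    Set.ncard_coe_finset]

theorem starOn_subset_completeOn {z : W} {T : Finset W} {U : Set W} (hz : z ∈ U)
    (hT : (T : Set W) ⊆ U) (hzT : z ∉ T) : starOn z T ⊆ completeOn U := by
  rintro _ ⟨t, ht, rfl⟩
  exact mem_completeOn.2 ⟨fun h => hzT (h ▸ ht), hz, hT ht⟩

theorem disjoint_starOn {E : Set (Sym2 W)} {z : W} {T : Finset W} (h : z ∉ endpoints E) :
    Disjoint E (starOn z T) := by
  rw [Set.disjoint_left]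
  rintro _ he ⟨t, -, rfl⟩
  exact h ⟨_, he, by simp⟩

end Basic

/-! ### Ranks of complete graphs and gluing of independent graphs -/

namespace IsRigidityLike

variable {W : Type*} [Fintype W] [DecidableEq W] {M : Matroid (Sym2 W)}

theorem indep_completeOn (hM : IsRigidityLike M) (U : Finset W) (hU : U.card ≤ 4) :
    M.Indep (completeOn (U : Set W)) := by
  induction U using Finset.induction_on with
  | empty =>
    have : completeOn ((∅ : Finset W) : Set W) = ∅ := by
      ext e
      induction e with | _ x y
      simp [mem_completeOn]
    rw [this]
    exact M.empty_indep
  | insert z U hz ih =>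
    rw [Finset.card_insert_of_notMem hz] at hU
    rw [completeOn_insert z U hz]
    exact hM.indep_star _ z U (ih (by omega)) (notMem_endpoints_of_subset subset_rfl (by simpa))
      hz (by omega)

theorem completeOn_subset_ground (hM : IsRigidityLike M) (U : Set W) : completeOn U ⊆ M.E := by
  rw [hM.ground_eq]
  exact completeOn_mono (Set.subset_univ U)

/-- For x in V outside T, the set T with x and z spans a K₅. Without zx it is a K₄ with a
0-extension, hence independent; since K₅ is dependent, zx lies in the closure. -/
theorem completeOn_insert_subset_closure (hM : IsRigidityLike M) {V T : Finset W} {z : W}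
    (hz : z ∉ V) (hT : T ⊆ V) (hTc : T.card = 3) :
    completeOn ((insert z V : Finset W) : Set W) ⊆
      M.closure (completeOn (V : Set W) ∪ starOn z T) := by
  have hg : completeOn (V : Set W) ∪ starOn z T ⊆ M.E :=
    Set.union_subset (hM.completeOn_subset_ground _)
      ((starOn_subset_completeOn (Set.mem_univ z) (Set.subset_univ _)
        fun h => hz (hT h)).trans (hM.completeOn_subset_ground _))
  rw [completeOn_insert z V hz]
  refine Set.union_subset (Set.subset_union_left.trans (M.subset_closure _ hg)) ?_
  rintro _ ⟨x, hx, rfl⟩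
  by_cases hxT : x ∈ T
  · exact M.subset_closure _ hg (Or.inr ⟨x, hxT, rfl⟩)
  have hzT : z ∉ T := fun h => hz (hT h)
  have hzx : z ≠ x := fun h => hz (h ▸ hx)
  have hind : M.Indep (completeOn ((insert x T : Finset W) : Set W) ∪ starOn z T) := by
    refine hM.indep_star _ z T (hM.indep_completeOn _ ?_)
      (notMem_endpoints_of_subset subset_rfl ?_) hzT hTc.le
    · rw [Finset.card_insert_of_notMem hxT]
      omega
    · simp [hzx, hzT]
  have hdep : ¬ M.Indep (insert s(z, x)
      (completeOn ((insert x T : Finset W) : Set W) ∪ starOn z T)) := by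
    have h5 := hM.not_indep_five (insert z (insert x T)) (by
      rw [Finset.card_insert_of_notMem (by simp [hzx, hzT]), Finset.card_insert_of_notMem hxT]
      omega)
    rw [completeOn_insert z _ (by simp [hzx, hzT])] at h5
    refine fun h => h5 (h.subset ?_)
    rintro e (he | ⟨t, ht, rfl⟩)
    · exact Or.inr (Or.inl he)
    · rcases Finset.mem_insert.1 ht with rfl | ht
      · exact Or.inl rfl
      · exact Or.inr (Or.inr ⟨t, ht, rfl⟩)
  have hmem : s(z, x) ∈ M.closure (completeOn ((insert x T : Finset W) : Set W) ∪ starOn z T) := by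
    by_contra hcon
    refine hdep (hind.insert_indep_iff.2 (Or.inl ⟨?_, hcon⟩))
    rw [hM.ground_eq]
    exact mem_completeOn.2 ⟨hzx, trivial, trivial⟩
  refine M.closure_subset_closure (Set.union_subset_union_left _ (completeOn_mono ?_)) hmem
  exact_mod_cast Finset.insert_subset hx hT

/-- Each vertex beyond the third raises the rank by at most three, because three of its edges
already span the others. -/
theorem rk_completeOn_le (hM : IsRigidityLike M) (V : Finset W) (hV : 3 ≤ V.card) :
    rk M (completeOn (V : Set W)) ≤ 3 * V.card - 6 := by
  induction V using Finset.induction_on with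
  | empty => simp at hV
  | insert z V hz ih =>
    rw [Finset.card_insert_of_notMem hz] at hV ⊢
    by_cases h3 : 3 ≤ V.card
    · obtain ⟨T, hTV, hT⟩ := Finset.exists_subset_card_eq h3
      have h1 := rk_le_of_subset_closure (hM.completeOn_insert_subset_closure hz hTV hT)
      have h2 := rk_union_le M (completeOn (V : Set W)) (starOn z T)
      have h4 := rk_le_ncard M (starOn z T)
      rw [ncard_starOn, hT] at h4
      have := ih h3
      omega
    -- The base case is a triangle: three edges, and 3 · 3 - 6 = 3.
    · have hc : V.card = 2 := by omega
      obtain ⟨x, y, hxy, rfl⟩ := Finset.card_eq_two.1 hc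
      have h1 : completeOn ((insert z {x, y} : Finset W) : Set W) ⊆ {s(z, x), s(z, y), s(x, y)} := by
        intro e he
        induction e with | _ p q
        simp only [mem_completeOn, Finset.coe_insert, Set.mem_insert_iff, Finset.coe_singleton,
          Set.mem_singleton_iff] at he
        simp only [Set.mem_insert_iff, Set.mem_singleton_iff, Sym2.eq_iff]
        grind
      have h2 := (rk_mono (M := M) h1).trans (rk_le_ncard M _)
      have h3 : ({s(z, x), s(z, y), s(x, y)} : Set (Sym2 W)).ncard ≤ 3 := by
        refine (Set.ncard_insert_le _ _).trans ?_
        have := Set.ncard_insert_le s(z, y) {s(x, y)}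
        rw [Set.ncard_singleton] at this
        omega
      rw [hc]
      omega

/-- Joining each vertex of `Z` to the three vertices in `T`. -/
theorem exists_indep_extension (hM : IsRigidityLike M) {V T : Finset W} {E : Set (Sym2 W)}
    (hE : M.Indep E) (hEV : E ⊆ completeOn (V : Set W)) (hT : T ⊆ V) (hTc : T.card = 3)
    (Z : Finset W) (hZ : Disjoint V Z) :
    ∃ F, M.Indep (E ∪ F) ∧ F ⊆ completeOn ((T ∪ Z : Finset W) : Set W) ∧
      ((E ∪ F).ncard : ℤ) = E.ncard + 3 * Z.card := by
  induction Z using Finset.induction_on with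
  | empty => exact ⟨∅, by simpa using hE, by simp, by simp⟩
  | insert z Z hz ih =>
    rw [Finset.disjoint_insert_right] at hZ
    obtain ⟨F, h1, h2, h3⟩ := ih hZ.2
    have hzT : z ∉ T := fun h => hZ.1 (hT h)
    have hze : z ∉ endpoints (E ∪ F) := by
      rintro ⟨e, he | he, hze⟩
      · exact hZ.1 (by simpa using (hEV he).2 z hze)
      · have := (h2 he).2 z hze
        simp [hzT, hz] at this
    refine ⟨F ∪ starOn z T, ?_, Set.union_subset (h2.trans (completeOn_mono ?_)) ?_, ?_⟩
    · rw [← Set.union_assoc]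
      exact hM.indep_star _ z T h1 hze hzT hTc.le
    · exact_mod_cast Finset.union_subset_union_right (Finset.subset_insert z Z)
    · exact starOn_subset_completeOn (by simp)
        (by exact_mod_cast Finset.subset_union_left) hzT
    · rw [← Set.union_assoc, Set.ncard_union_eq (disjoint_starOn hze), ncard_starOn, hTc,
        Finset.card_insert_of_notMem hz]
      push_cast
      linarith

/-- A triangle followed by one 0-extension per remaining vertex is independent and has 3 + 3(|V| -
3) edges. -/
theorem le_rk_completeOn (hM : IsRigidityLike M) (V : Finset W) (hV : 3 ≤ V.card) :
    (3 * V.card - 6 : ℤ) ≤ rk M (completeOn (V : Set W)) := by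
  obtain ⟨T, hTV, hT⟩ := Finset.exists_subset_card_eq hV
  obtain ⟨B, hB, -, hBT, hBc⟩ := exists_basis_superset M.empty_indep
    (Set.empty_subset (completeOn (T : Set W)))
  obtain ⟨F, h1, h2, h3⟩ := hM.exists_indep_extension (hM.indep_completeOn T (by omega)) subset_rfl
    subset_rfl hT (V \ T) (Finset.disjoint_sdiff)
  have h4 := ncard_le_rk h1 (E := completeOn (V : Set W)) (Set.union_subset
    (completeOn_mono (by exact_mod_cast hTV)) (h2.trans (completeOn_mono
      (by simp [hTV]))))
  have h5 : (3 : ℤ) ≤ (completeOn (T : Set W)).ncard := by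
    obtain ⟨x, y, z, hxy, hxz, hyz, rfl⟩ := Finset.card_eq_three.1 hT
    have hs : ((({s(x, y), s(x, z), s(y, z)} : Finset (Sym2 W))) : Set (Sym2 W)) ⊆
        completeOn ((({x, y, z} : Finset W)) : Set W) := by
      intro e he
      simp only [Finset.coe_insert, Finset.coe_singleton, Set.mem_insert_iff,
        Set.mem_singleton_iff] at he
      rcases he with rfl | rfl | rfl <;> simp [mem_completeOn, hxy, hxz, hyz]
    have := Set.ncard_le_ncard hs (Set.toFinite _)
    rw [Set.ncard_coe_finset, Finset.card_insert_of_notMem, Finset.card_pair] at this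
    · exact_mod_cast this
    · simp only [ne_eq, Sym2.eq_iff]
      grind
    · simp only [Finset.mem_insert, Finset.mem_singleton, Sym2.eq_iff]
      grind
  have h6 : (V \ T).card = V.card - 3 := by rw [Finset.card_sdiff_of_subset hTV, hT]
  rw [h6, Nat.cast_sub hV] at h3
  push_cast at h3
  linarith

theorem rk_completeOn (hM : IsRigidityLike M) (V : Finset W) (hV : 3 ≤ V.card) :
    rk M (completeOn (V : Set W)) = 3 * V.card - 6 :=
  le_antisymm (hM.rk_completeOn_le V hV) (hM.le_rk_completeOn V hV)

/-- Independent graphs glued along a complete graph form an independent graph. -/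
theorem indep_union (hM : IsRigidityLike M) {V₁ V₂ : Finset W} {E F : Set (Sym2 W)}
    (hE : M.Indep E) (hF : M.Indep F) (hEV : E ⊆ completeOn (V₁ : Set W))
    (hFV : F ⊆ completeOn (V₂ : Set W))
    (hUE : completeOn ((V₁ ∩ V₂ : Finset W) : Set W) ⊆ E)
    (hUF : completeOn ((V₁ ∩ V₂ : Finset W) : Set W) ⊆ F) : M.Indep (E ∪ F) := by
  -- The induction runs on the number of vertices that the intersection lacks from three. Truncated
  -- subtraction puts all intersections with at least three vertices into the base case, where ranks
  -- can be counted directly.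
  induction hn : 3 - (V₁ ∩ V₂).card generalizing V₁ V₂ E F with
  | zero =>
    have h3 : 3 ≤ (V₁ ∩ V₂).card := by omega
    obtain ⟨T, hTU, hT⟩ := Finset.exists_subset_card_eq h3
    have hc1 : (V₁ ∩ V₂).card ≤ V₁.card := Finset.card_le_card Finset.inter_subset_left
    have hc2 : (V₁ ∩ V₂).card ≤ V₂.card := Finset.card_le_card Finset.inter_subset_right
    obtain ⟨E', hE', hEE', hE'V, hE'c⟩ := exists_basis_superset hE hEV
    obtain ⟨F', hF', hFF', hF'V, hF'c⟩ := exists_basis_superset hF hFV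
    -- E' with three edges from each vertex of V₂ \ V₁ to T is an independent set in K(V₁) ∪ K(V₂),
    -- which is spanned by E' ∪ F'. This bounds the rank of E' ∪ F' from below by |E'| + 3|V₂ \ V₁|,
    -- and the overlap K(V₁ ∩ V₂) of E' and F' shows that E' ∪ F' has no more elements than that.
    obtain ⟨N, hN, hNV, hNc⟩ := hM.exists_indep_extension hE' hE'V
      (hTU.trans Finset.inter_subset_left) hT (V₂ \ V₁) Finset.disjoint_sdiff
    have hN2 : (completeOn (V₁ : Set W) ∪ completeOn (V₂ : Set W)) ⊆ M.closure (E' ∪ F') := by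
      have key : ∀ (V : Finset W) (B : Set (Sym2 W)), M.Indep B → B ⊆ completeOn (V : Set W) →
          rk M (completeOn (V : Set W)) = B.ncard → completeOn (V : Set W) ⊆ M.closure B := by
        intro V B hB hBV hBc e he
        by_contra hcon
        have hi : M.Indep (insert e B) :=
          hB.insert_indep_iff.2 (Or.inl ⟨hM.completeOn_subset_ground _ he, hcon⟩)
        have heB : e ∉ B := fun h => hcon (M.subset_closure B hB.subset_ground h)
        have := ncard_le_rk hi (Set.insert_subset he hBV)
        rw [Set.ncard_insert_of_notMem heB, hBc] at this
        push_cast at this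
        omega
      exact Set.union_subset
        ((key V₁ E' hE' hE'V hE'c).trans (M.closure_subset_closure Set.subset_union_left))
        ((key V₂ F' hF' hF'V hF'c).trans (M.closure_subset_closure Set.subset_union_right))
    have hle : ((E' ∪ N).ncard : ℤ) ≤ rk M (E' ∪ F') := by
      refine (ncard_le_rk hN ?_).trans (rk_le_of_subset_closure hN2)
      refine Set.union_subset_union hE'V (hNV.trans (completeOn_mono ?_))
      exact_mod_cast Finset.union_subset (hTU.trans Finset.inter_subset_right)
        Finset.sdiff_subset
    have hcard : ((E' ∪ F').ncard : ℤ) + (completeOn ((V₁ ∩ V₂ : Finset W) : Set W)).ncard ≤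
        E'.ncard + F'.ncard := by
      rw [← Nat.cast_add, ← Nat.cast_add, ← Set.ncard_union_add_ncard_inter E' F']
      have := Set.ncard_le_ncard (Set.subset_inter (hUE.trans hEE') (hUF.trans hFF'))
        (Set.toFinite _)
      exact_mod_cast Nat.add_le_add_left this _
    have hU := rk_le_ncard M (completeOn ((V₁ ∩ V₂ : Finset W) : Set W))
    rw [hM.rk_completeOn _ h3] at hU
    rw [hM.rk_completeOn _ (by omega)] at hF'c
    have h5 : ((V₂ \ V₁).card : ℤ) = V₂.card - (V₁ ∩ V₂).card := by
      have := Finset.card_sdiff_add_card_inter V₂ V₁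
      rw [Finset.inter_comm] at this
      omega
    rw [h5] at hNc
    exact (indep_of_ncard_le_rk (by linarith)).subset (Set.union_subset_union hEE' hFF')
  | succ n ih =>
    by_cases hsub : V₂ ⊆ V₁
    · rw [Finset.inter_eq_right.2 hsub] at hUE
      rwa [Set.union_eq_self_of_subset_right (hFV.trans hUE)]
    obtain ⟨y, hy2, hy1⟩ := Finset.not_subset.1 hsub
    have hyU : y ∉ V₁ ∩ V₂ := fun h => hy1 (Finset.mem_inter.1 h).1
    have hcU : (insert y (V₁ ∩ V₂)).card = (V₁ ∩ V₂).card + 1 := Finset.card_insert_of_notMem hyU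
    have hins : insert y V₁ ∩ V₂ = insert y (V₁ ∩ V₂) := Finset.insert_inter_of_mem hy2
    obtain ⟨E', hE', hEE', hE'V, hE'c⟩ := exists_basis_superset hE hEV
    obtain ⟨F', hF', hFF', hF'V, hF'c⟩ := exists_basis_superset hF hFV
    -- F₀ is another basis of K(V₂), chosen to contain the complete graph on the intersection
    -- together with y. The induction hypothesis applies to F₀ and to E' with y joined to the
    -- intersection. Independence returns to E' ∪ F' because F' spans F₀, both bases have the same
    -- size, and E' meets F₀ only in K(V₁ ∩ V₂), which lies in F' as well.
    obtain ⟨F₀, hF₀, hKF₀, hF₀V, hF₀c⟩ := exists_basis_superset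
      (hM.indep_completeOn (insert y (V₁ ∩ V₂)) (by omega)) (E := completeOn (V₂ : Set W))
      (completeOn_mono (by exact_mod_cast Finset.insert_subset hy2 Finset.inter_subset_right))
    have hyE' : y ∉ endpoints E' := notMem_endpoints_of_subset hE'V (by simpa using hy1)
    have hi1 : M.Indep (E' ∪ starOn y (V₁ ∩ V₂)) :=
      hM.indep_star _ y _ hE' hyE' hyU (by omega)
    have hi2 : M.Indep ((E' ∪ starOn y (V₁ ∩ V₂)) ∪ F₀) := by
      refine ih (V₁ := insert y V₁) (V₂ := V₂) hi1 hF₀ ?_ hF₀V ?_ ?_ (by rw [hins]; omega)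
      · refine Set.union_subset (hE'V.trans (completeOn_mono (by simp))) ?_
        refine starOn_subset_completeOn (by simp) ?_ hyU
        exact_mod_cast Finset.inter_subset_left.trans (Finset.subset_insert y V₁)
      · rw [hins, completeOn_insert y _ hyU]
        exact Set.union_subset_union_left _ (hUE.trans hEE')
      · rwa [hins]
    have hi3 : M.Indep (E' ∪ F₀) := hi2.subset (Set.union_subset_union_left _ Set.subset_union_left)
    have hUF₀ : completeOn ((V₁ ∩ V₂ : Finset W) : Set W) ⊆ F₀ :=
      (completeOn_mono (by simp)).trans hKF₀
    have hint : E' ∩ F₀ = completeOn ((V₁ ∩ V₂ : Finset W) : Set W) := by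
      refine Set.Subset.antisymm ?_ (Set.subset_inter (hUE.trans hEE') hUF₀)
      rw [Finset.coe_inter, completeOn_inter]
      exact Set.inter_subset_inter hE'V hF₀V
    have hF'cl : F₀ ⊆ M.closure (E' ∪ F') := by
      intro e he
      refine M.closure_subset_closure Set.subset_union_right ?_
      by_contra hcon
      have hi : M.Indep (insert e F') :=
        hF'.insert_indep_iff.2 (Or.inl ⟨hF₀.subset_ground he, hcon⟩)
      have heB : e ∉ F' := fun h => hcon (M.subset_closure F' hF'.subset_ground h)
      have := ncard_le_rk hi (Set.insert_subset (hF₀V he) hF'V)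
      rw [Set.ncard_insert_of_notMem heB, hF'c] at this
      push_cast at this
      omega
    have h1 : ((E' ∪ F₀).ncard : ℤ) ≤ rk M (E' ∪ F') := by
      rw [← indep_iff_rk.1 hi3]
      refine rk_le_of_subset_closure (Set.union_subset ?_ hF'cl)
      exact Set.subset_union_left.trans (M.subset_closure _
        (Set.union_subset hE'.subset_ground hF'.subset_ground))
    have h2 : ((E' ∪ F').ncard : ℤ) ≤ (E' ∪ F₀).ncard := by
      have a1 := Set.ncard_union_add_ncard_inter E' F'
      have a2 := Set.ncard_union_add_ncard_inter E' F₀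
      have a3 := Set.ncard_le_ncard (Set.subset_inter (hUE.trans hEE') (hUF.trans hFF'))
        (Set.toFinite _)
      rw [hint] at a2
      omega
    exact (indep_of_ncard_le_rk (h2.trans h1)).subset (Set.union_subset_union hEE' hFF')

/-- Independent graphs sharing the endpoints of an edge that can be added to one of them. -/
theorem indep_union_of_edge (hM : IsRigidityLike M) {V₁ V₂ : Finset W} {E F : Set (Sym2 W)}
    {a b : W} (hab : a ≠ b) (hV : V₁ ∩ V₂ = {a, b}) (hE : M.Indep E)
    (hF : M.Indep (insert s(a, b) F)) (hEV : E ⊆ completeOn (V₁ : Set W))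
    (hFV : F ⊆ completeOn (V₂ : Set W)) (habF : s(a, b) ∉ F) :
    M.Indep (E ∪ F) := by
  have haV : a ∈ V₁ ∩ V₂ := by rw [hV]; simp
  have hbV : b ∈ V₁ ∩ V₂ := by rw [hV]; simp
  rw [Finset.mem_inter] at haV hbV
  have hKab : completeOn ((V₁ ∩ V₂ : Finset W) : Set W) = {s(a, b)} := by
    rw [hV]
    ext e
    induction e with | _ x y
    simp only [mem_completeOn, Finset.coe_insert, Finset.coe_singleton, Set.mem_insert_iff,
      Set.mem_singleton_iff, Sym2.eq_iff]
    grind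
  -- A basis of E + ab through ab: now both graphs contain the edge on their common vertices, so
  -- they can be glued along a K₂.
  obtain ⟨I, hI, habI, hIE, hIc⟩ := exists_basis_superset
    (hF.subset (Set.singleton_subset_iff.2 (Set.mem_insert _ F)))
    (E := insert s(a, b) E) (by simp)
  have hins : ∀ {V : Finset W}, a ∈ V → b ∈ V → ∀ {S : Set (Sym2 W)}, S ⊆ completeOn (V : Set W) →
      insert s(a, b) S ⊆ completeOn (V : Set W) := by
    intro V ha hb S hS
    exact Set.insert_subset (mem_completeOn.2 ⟨hab, ha, hb⟩) hS
  have hi : M.Indep (I ∪ insert s(a, b) F) := by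
    refine hM.indep_union (V₁ := V₁) (V₂ := V₂) hI hF
      (hIE.trans (hins haV.1 hbV.1 hEV)) (hins haV.2 hbV.2 hFV) ?_ ?_
    · rwa [hKab]
    · rw [hKab]
      simp
  -- If E spans ab, then I is spanned by E, is at least as large and is disjoint from F, so the rank
  -- of E ∪ F is at least |E| + |F|. Otherwise E + ab is independent and equals I.
  by_cases hcl : s(a, b) ∈ M.closure E
  · have hdisj : Disjoint I F := by
      rw [Set.disjoint_left]
      intro e heI heF
      have h1 : e ∈ completeOn ((V₁ ∩ V₂ : Finset W) : Set W) := by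
        rw [Finset.coe_inter, completeOn_inter]
        exact ⟨hins haV.1 hbV.1 hEV (hIE heI), hFV heF⟩
      rw [hKab, Set.mem_singleton_iff] at h1
      exact habF (h1 ▸ heF)
    refine indep_of_ncard_le_rk ?_
    have h1 : (E.ncard : ℤ) ≤ I.ncard := by
      rw [← hIc]
      exact ncard_le_rk hE (Set.subset_insert _ _)
    have h2 : ((E ∪ F).ncard : ℤ) ≤ E.ncard + F.ncard := by
      exact_mod_cast Set.ncard_union_le E F
    have h3 : ((I ∪ F).ncard : ℤ) = I.ncard + F.ncard := by
      exact_mod_cast Set.ncard_union_eq hdisj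
    have h4 : ((I ∪ F).ncard : ℤ) ≤ rk M (E ∪ F) := by
      rw [← indep_iff_rk.1 (hi.subset (Set.union_subset_union_right _ (Set.subset_insert _ _)))]
      have hg : E ∪ F ⊆ M.E := Set.union_subset hE.subset_ground
        ((Set.subset_insert _ _).trans hF.subset_ground)
      refine rk_le_of_subset_closure (Set.union_subset (hIE.trans (Set.insert_subset ?_ ?_)) ?_)
      · exact M.closure_subset_closure Set.subset_union_left hcl
      · exact Set.subset_union_left.trans (M.subset_closure _ hg)
      · exact Set.subset_union_right.trans (M.subset_closure _ hg)
    linarith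
  · have hiE : M.Indep (insert s(a, b) E) :=
      hE.insert_indep_iff.2 (Or.inl ⟨hF.subset_ground (Set.mem_insert _ F), hcl⟩)
    rw [indep_iff_rk] at hiE
    have hIeq : I = insert s(a, b) E := by
      refine Set.eq_of_subset_of_ncard_le hIE ?_ (Set.toFinite _)
      exact_mod_cast (hiE.symm.trans hIc).le
    refine hi.subset (Set.union_subset_union ?_ (Set.subset_insert _ _))
    rw [hIeq]
    exact Set.subset_insert _ _

end IsRigidityLike

/-! ### Abstract rigidity matroids -/

theorem endpoints_completeOn {W : Type*} {U : Finset W} (hU : 2 ≤ U.card) :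
    endpoints (completeOn (U : Set W)) = U := by
  refine Set.Subset.antisymm (endpoints_subset_of_subset subset_rfl) fun x hx => ?_
  obtain ⟨y, hy, hyx⟩ := Finset.exists_mem_ne (by omega : 1 < U.card) x
  exact ⟨s(x, y), mem_completeOn.2 ⟨hyx.symm, hx, hy⟩, by simp⟩

/-- For the 0-extension, a further edge zt cannot lie in the closure of E and a star at z with at
most two edges: the two sets share at most two endpoints, so the closure axiom confines the closure
to two complete graphs, neither containing zt. K₅ is dependent because two of its K₄'s share three
vertices and so span the one remaining edge. -/
theorem isRigidityLike_of_isAbstractRigidityMatroid {W : Type*} [Fintype W] [DecidableEq W]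
    {M : Matroid (Sym2 W)} (hM : IsAbstractRigidityMatroid M) : IsRigidityLike M where
  ground_eq := hM.ground_eq
  indep_star := by
    intro E z T hE hzE hzT hT
    have hground : ∀ U : Set W, completeOn U ⊆ M.E := fun U => by
      rw [hM.ground_eq]
      exact completeOn_mono (Set.subset_univ U)
    induction T using Finset.induction_on with
    | empty =>
      have : starOn z ∅ = ∅ := by
        ext e
        simp [mem_starOn]
      simpa [this] using hE
    | insert t T ht ih =>
      rw [Finset.card_insert_of_notMem ht] at hT
      rw [Finset.mem_insert, not_or] at hzT
      have ih' := ih hzT.2 (by omega)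
      have hs : starOn z (insert t T) = insert s(z, t) (starOn z T) := by
        ext e
        simp [mem_starOn]
      have hsub : starOn z T ⊆ completeOn ((insert z T : Finset W) : Set W) :=
        starOn_subset_completeOn (by simp) (by simp) hzT.2
      rw [hs, Set.union_insert, ih'.insert_indep_iff]
      refine Or.inl ⟨hground Set.univ (mem_completeOn.2 ⟨hzT.1, trivial, trivial⟩), fun hcl => ?_⟩
      have hcap : (endpoints E ∩ endpoints (starOn z T)).encard < 3 := by
        have : endpoints E ∩ endpoints (starOn z T) ⊆ (T : Set W) := by
          rintro x ⟨hxE, hxT⟩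
          have := endpoints_subset_of_subset hsub hxT
          rw [Finset.coe_insert, Set.mem_insert_iff] at this
          exact this.resolve_left (fun h => hzE (h ▸ hxE))
        refine (Set.encard_le_encard this).trans_lt ?_
        rw [Set.encard_coe_eq_coe_finsetCard]
        exact_mod_cast (by omega : T.card < 3)
      rcases hM.closure_subset E (starOn z T) hE.subset_ground (hsub.trans (hground _)) hcap hcl
        with h | h
      · exact hzE (mem_completeOn.1 h).2.1
      · have := endpoints_subset_of_subset hsub (mem_completeOn.1 h).2.2
        rw [Finset.coe_insert, Set.mem_insert_iff] at this
        rcases this with h | h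
        · exact hzT.1 h.symm
        · exact ht h
  not_indep_five := by
    intro U hU hind
    have hground : ∀ U : Set W, completeOn U ⊆ M.E := fun U => by
      rw [hM.ground_eq]
      exact completeOn_mono (Set.subset_univ U)
    have hcl : ∀ V : Finset W, 2 ≤ V.card →
        M.closure (completeOn (V : Set W)) = completeOn (endpoints (completeOn (V : Set W))) := by
      intro V hV
      refine Set.Subset.antisymm ?_ ?_
      · have := hM.closure_subset (completeOn (V : Set W)) ∅ (hground _) (Set.empty_subset _)
          (by simp [endpoints])
        rw [Set.union_empty] at this
        refine this.trans (Set.union_subset subset_rfl ?_)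
        exact completeOn_mono (by simp [endpoints])
      · rw [endpoints_completeOn hV]
        exact M.subset_closure _ (hground _)
    obtain ⟨x, hx, y, hy, hxy⟩ := Finset.one_lt_card.1 (by omega : 1 < U.card)
    have hcx : (U.erase x).card = 4 := by rw [Finset.card_erase_of_mem hx, hU]
    have hcy : (U.erase y).card = 4 := by rw [Finset.card_erase_of_mem hy, hU]
    have h1 := hM.closure_eq (completeOn (U.erase x : Finset W)) (completeOn (U.erase y : Finset W))
      (hground _) (hground _) (hcl _ (by omega)) (hcl _ (by omega)) (by
        rw [endpoints_completeOn (by omega), endpoints_completeOn (by omega), ← Finset.coe_inter,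
          Set.encard_coe_eq_coe_finsetCard]
        have : U.erase x ∩ U.erase y = (U.erase x).erase y := by
          ext w
          simp only [Finset.mem_inter, Finset.mem_erase]
          tauto
        rw [this, Finset.card_erase_of_mem (by simp [hy, hxy.symm]), hcx]
        norm_num)
    rw [endpoints_completeOn (by omega), endpoints_completeOn (by omega), ← Finset.coe_union] at h1
    have hmem : s(x, y) ∈ M.closure
        (completeOn (U.erase x : Finset W) ∪ completeOn (U.erase y : Finset W)) := by
      rw [h1]
      exact mem_completeOn.2 ⟨hxy, by simp [hx, hxy], by simp [hy, hxy.symm]⟩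
    have hmemU : s(x, y) ∈ completeOn (U : Set W) := mem_completeOn.2 ⟨hxy, hx, hy⟩
    refine hind.notMem_closure_sdiff_of_mem hmemU (M.closure_subset_closure ?_ hmem)
    refine Set.union_subset (fun e he => ⟨completeOn_mono (by simp) he, ?_⟩)
      (fun e he => ⟨completeOn_mono (by simp) he, ?_⟩)
    · rintro rfl
      simpa using (mem_completeOn.1 he).2.1
    · rintro rfl
      simpa using (mem_completeOn.1 he).2.2

/-! ### Inclusion-exclusion counts in terms of nullities -/

/-- The nullity of an edge set. -/
noncomputable def nul {W : Type*} (M : Matroid (Sym2 W)) (E : Set (Sym2 W)) : ℤ :=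
  E.ncard - rk M E

section Covers

variable {W : Type*} [Fintype W] {M : Matroid (Sym2 W)}

theorem nul_eq_zero {E : Set (Sym2 W)} (h : M.Indep E) : nul M E = 0 := by
  rw [nul, indep_iff_rk.1 h, sub_self]

open Classical in
theorem sum_coverDegree (X : Finset (Finset W)) (P : Finset (Sym2 W)) :
    ∑ e ∈ P, (coverDegree X e : ℤ) = ∑ A ∈ X, ((inducedEdges (P : Set (Sym2 W)) A).ncard : ℤ) := by
  have h := Finset.sum_card_bipartiteAbove_eq_sum_card_bipartiteBelow (s := P) (t := X)
    (fun e A => ∀ x ∈ e, x ∈ A)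
  have h2 : ∀ A : Finset W, (inducedEdges (P : Set (Sym2 W)) A).ncard =
      (P.filter fun e => ∀ x ∈ e, x ∈ A).card := by
    intro A
    rw [← Set.ncard_coe_finset]
    congr 1
    ext e
    simp [inducedEdges]
  simp only [h2, coverDegree]
  simp only [Finset.bipartiteAbove, Finset.bipartiteBelow] at h
  rw [← Nat.cast_sum, ← Nat.cast_sum]
  congr 1
  convert h

theorem inducedEdges_mono {E F : Set (Sym2 W)} (h : E ⊆ F) (A : Finset W) :
    inducedEdges E A ⊆ inducedEdges F A := fun _ he => ⟨h he.1, he.2⟩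

theorem inducedEdges_subset (E : Set (Sym2 W)) (A : Finset W) : inducedEdges E A ⊆ E :=
  fun _ he => he.1

/-- Count incident pairs of an edge and a cluster. The cardinalities of the induced sets add up to
the sum of the degrees; edges outside P have degree one, so subtracting the correction leaves every
edge counted once. -/
theorem ieCountWith_eq (G : VGraph W) (X : Finset (Finset W)) (P : Finset (Sym2 W))
    (h : ∀ e ∈ G.edgeSet, e ∉ P → coverDegree X e = 1) :
    ieCountWith M G X P = (G.edgeSet ∪ P : Set (Sym2 W)).ncard -
      ∑ A ∈ X, nul M (inducedEdges (G.edgeSet ∪ P) A) := by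
  classical
  let E : Finset (Sym2 W) := (G.edgeSet ∪ (P : Set (Sym2 W))).toFinite.toFinset
  have hE : (E : Set (Sym2 W)) = G.edgeSet ∪ P := by simp [E]
  have hPE : P ⊆ E := by
    intro e he
    simp [E, he]
  have h1 := sum_coverDegree X E
  have h2 : ∑ e ∈ E, ((coverDegree X e : ℤ) - 1) = ∑ e ∈ P, ((coverDegree X e : ℤ) - 1) := by
    refine (Finset.sum_subset hPE fun e he heP => ?_).symm
    have : e ∈ G.edgeSet ∪ (P : Set (Sym2 W)) := by
      rw [← hE]
      exact he
    rw [h e (this.resolve_right heP) heP]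
    simp
  rw [ieCountWith, ← h2, ← hE, Set.ncard_coe_finset]
  simp only [nul, Finset.sum_sub_distrib, h1]
  simp only [Finset.sum_const, nsmul_eq_mul, mul_one]
  ring

/-- The inclusion-exclusion count bounds the rank. -/
theorem rk_le_ieCountWith (G : VGraph W) (X : Finset (Finset W)) (P : Finset (Sym2 W))
    (hP : M.Indep (P : Set (Sym2 W)))
    (hcov : ∀ e ∈ G.edgeSet ∪ (P : Set (Sym2 W)), ∃ A ∈ X, ∀ x ∈ e, x ∈ A)
    (hground : G.edgeSet ⊆ M.E) :
    rk M (G.edgeSet ∪ P) ≤ ieCountWith M G X P := by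
  classical
  have hB : ∀ A : Finset W, ∃ B, M.IsBasis' B (inducedEdges (G.edgeSet ∪ (P : Set (Sym2 W))) A) ∧
      inducedEdges (P : Set (Sym2 W)) A ⊆ B := fun A =>
    (hP.subset (inducedEdges_subset _ A)).subset_isBasis'_of_subset
      (inducedEdges_mono Set.subset_union_right A)
  choose B hB hPB using hB
  -- Each basis extends the part of P in its cluster, so P needs to be taken only once. The
  -- resulting spanning set has at most as many elements as the inclusion-exclusion count.
  let J : Set (Sym2 W) := P ∪ ⋃ A ∈ X, (B A \ inducedEdges (P : Set (Sym2 W)) A)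
  have hspan : G.edgeSet ∪ (P : Set (Sym2 W)) ⊆ M.closure J := by
    intro e he
    obtain ⟨A, hA, heA⟩ := hcov e he
    have h1 : e ∈ M.closure (B A) := by
      rw [(hB A).closure_eq_closure]
      refine M.mem_closure_of_mem' ⟨he, heA⟩ ?_
      exact (Set.union_subset hground hP.subset_ground) he
    refine M.closure_subset_closure ?_ h1
    intro f hf
    by_cases hfP : f ∈ inducedEdges (P : Set (Sym2 W)) A
    · exact Or.inl hfP.1
    · exact Or.inr (Set.mem_biUnion hA ⟨hf, hfP⟩)
  have hcard : (J.ncard : ℤ) ≤ P.card +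
      ∑ A ∈ X, ((B A).ncard - (inducedEdges (P : Set (Sym2 W)) A).ncard : ℤ) := by
    have h1 : (⋃ A ∈ X, (B A \ inducedEdges (P : Set (Sym2 W)) A)).ncard ≤
        ∑ A ∈ X, (B A \ inducedEdges (P : Set (Sym2 W)) A).ncard := Finset.set_ncard_biUnion_le _ _
    have h2 : ∀ A, ((B A \ inducedEdges (P : Set (Sym2 W)) A).ncard : ℤ) =
        (B A).ncard - (inducedEdges (P : Set (Sym2 W)) A).ncard := fun A => by
      rw [← Set.ncard_sdiff_add_ncard_of_subset (hPB A) (Set.toFinite _)]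
      push_cast
      ring
    have h3 := Set.ncard_union_le (P : Set (Sym2 W))
      (⋃ A ∈ X, (B A \ inducedEdges (P : Set (Sym2 W)) A))
    rw [Set.ncard_coe_finset] at h3
    simp only [← h2]
    exact_mod_cast h3.trans (Nat.add_le_add_left h1 _)
  have h4 : ∀ A, rk M (inducedEdges (G.edgeSet ∪ (P : Set (Sym2 W))) A) = (B A).ncard :=
    fun A => rk_eq_ncard_of_isBasis' (hB A)
  refine (rk_le_of_subset_closure hspan).trans ((rk_le_ncard M J).trans (hcard.trans (le_of_eq ?_)))
  rw [ieCountWith]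
  simp only [h4, Finset.sum_sub_distrib, sum_coverDegree]
  simp
  ring

end Covers

/-! ### Completing a family of clusters to a cover -/

/-- The closure conditions on the members of a 2-thin cover, without the covering condition. -/
structure IsClusterFamily {W : Type*} [DecidableEq W] (G : VGraph W) (C : Finset (Finset W)) :
    Prop where
  subset_verts : ∀ A ∈ C, (A : Set W) ⊆ G.verts
  two_le_card : ∀ A ∈ C, 2 ≤ A.card
  card_inter_le : ∀ A ∈ C, ∀ B ∈ C, A ≠ B → (A ∩ B).card ≤ 2
  not_subset : ∀ A ∈ C, ∀ B ∈ C, A ≠ B → ¬ A ⊆ B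

open Classical in
/-- The endpoint pairs of the edges that lie in no member of `C`. -/
noncomputable def edgeClusters {W : Type*} [Fintype W] (G : VGraph W) (C : Finset (Finset W)) :
    Finset (Finset W) :=
  Finset.univ.filter fun A => (∃ x y, G.Adj x y ∧ A = {x, y}) ∧ ∀ B ∈ C, ¬ A ⊆ B

section Completion

variable {W : Type*} [Fintype W] [DecidableEq W] {M : Matroid (Sym2 W)} {G : VGraph W}
  {C X : Finset (Finset W)}

theorem mem_edgeClusters {A : Finset W} :
    A ∈ edgeClusters G C ↔ (∃ x y, G.Adj x y ∧ A = {x, y}) ∧ ∀ B ∈ C, ¬ A ⊆ B := by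
  classical
  simp only [edgeClusters, Finset.mem_filter, Finset.mem_univ, true_and]
  constructor <;> rintro ⟨⟨x, y, h, h'⟩, h2⟩ <;> refine ⟨⟨x, y, h, ?_⟩, h2⟩ <;> convert h'

theorem mem_sharedSet {e : Sym2 W} : e ∈ sharedSet X ↔
    ∃ A ∈ X, ∃ B ∈ X, A ≠ B ∧ ∃ x y, x ≠ y ∧ A ∩ B = {x, y} ∧ e = s(x, y) := by
  simp [sharedSet]

theorem pair_mem_sharedSet {x y : W} (hxy : x ≠ y) : s(x, y) ∈ sharedSet X ↔
    ∃ A ∈ X, ∃ B ∈ X, A ≠ B ∧ A ∩ B = {x, y} := by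
  rw [mem_sharedSet]
  constructor
  · rintro ⟨A, hA, B, hB, hne, z, w, -, hAB, he⟩
    refine ⟨A, hA, B, hB, hne, hAB.trans ?_⟩
    rcases Sym2.eq_iff.1 he with ⟨rfl, rfl⟩ | ⟨rfl, rfl⟩
    · rfl
    · exact Finset.pair_comm _ _
  · rintro ⟨A, hA, B, hB, hne, hAB⟩
    exact ⟨A, hA, B, hB, hne, x, y, hxy, hAB, rfl⟩

theorem not_isDiag_of_mem_sharedSet {e : Sym2 W} (he : e ∈ sharedSet X) : ¬ e.IsDiag := by
  obtain ⟨A, hA, B, hB, hne, x, y, hxy, hAB, rfl⟩ := mem_sharedSet.1 he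
  simpa using hxy

theorem ne_of_mem_sharedSet {x y : W} (he : s(x, y) ∈ sharedSet X) : x ≠ y := by
  simpa using not_isDiag_of_mem_sharedSet he

namespace IsClusterFamily

theorem inter_eq (hC : IsClusterFamily G C) {A B : Finset W} (hA : A ∈ C) (hB : B ∈ C)
    (hne : A ≠ B) {x y : W} (hxy : x ≠ y) (hxA : x ∈ A) (hyA : y ∈ A) (hxB : x ∈ B) (hyB : y ∈ B) :
    A ∩ B = {x, y} := by
  symm
  refine Finset.eq_of_subset_of_card_le ?_ ?_
  · intro w hw
    simp only [Finset.mem_insert, Finset.mem_singleton] at hw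
    rcases hw with rfl | rfl <;> simp [*]
  · rw [Finset.card_pair hxy]
    exact hC.card_inter_le A hA B hB hne

theorem mem_sharedSet_of_mem (hC : IsClusterFamily G C) {A B : Finset W} (hA : A ∈ C) (hB : B ∈ C)
    (hne : A ≠ B) {x y : W} (hxy : x ≠ y) (hxA : x ∈ A) (hyA : y ∈ A) (hxB : x ∈ B) (hyB : y ∈ B) :
    s(x, y) ∈ sharedSet C :=
  (pair_mem_sharedSet hxy).2 ⟨A, hA, B, hB, hne, hC.inter_eq hA hB hne hxy hxA hyA hxB hyB⟩

/-- The added clusters have two elements and lie in no member of `C`; a member of `C` inside one of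
them would equal it by cardinality, which is excluded too. -/
theorem twoThin (hC : IsClusterFamily G C) : IsTwoThinCover G (C ∪ edgeClusters G C) where
  subset_verts A hA := by
    rcases Finset.mem_union.1 hA with hA | hA
    · exact hC.subset_verts A hA
    · obtain ⟨⟨x, y, hxy, rfl⟩, -⟩ := mem_edgeClusters.1 hA
      intro w hw
      simp only [Finset.coe_insert, Finset.coe_singleton, Set.mem_insert_iff,
        Set.mem_singleton_iff] at hw
      rcases hw with rfl | rfl
      · exact G.edge_vert hxy
      · exact G.edge_vert hxy.symm
  two_le_card A hA := by
    rcases Finset.mem_union.1 hA with hA | hA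
    · exact hC.two_le_card A hA
    · obtain ⟨⟨x, y, hxy, rfl⟩, -⟩ := mem_edgeClusters.1 hA
      rw [Finset.card_pair hxy.ne]
  card_inter_le A hA B hB hne := by
    have key : ∀ A ∈ edgeClusters G C, ∀ B, (A ∩ B).card ≤ 2 := by
      intro A hA B
      obtain ⟨⟨x, y, hxy, rfl⟩, -⟩ := mem_edgeClusters.1 hA
      exact (Finset.card_le_card Finset.inter_subset_left).trans (Finset.card_pair hxy.ne).le
    rcases Finset.mem_union.1 hA with hA | hA
    · rcases Finset.mem_union.1 hB with hB | hB
      · exact hC.card_inter_le A hA B hB hne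
      · rw [Finset.inter_comm]
        exact key B hB A
    · exact key A hA B
  not_subset A hA B hB hne hAB := by
    have card2 : ∀ A ∈ edgeClusters G C, A.card = 2 := by
      intro A hA
      obtain ⟨⟨x, y, hxy, rfl⟩, -⟩ := mem_edgeClusters.1 hA
      exact Finset.card_pair hxy.ne
    rcases Finset.mem_union.1 hA with hA | hA <;> rcases Finset.mem_union.1 hB with hB | hB
    · exact hC.not_subset A hA B hB hne hAB
    · have h2 := Finset.eq_of_subset_of_card_le hAB
        ((card2 B hB).le.trans (hC.two_le_card A hA))
      exact (mem_edgeClusters.1 hB).2 A hA h2.symm.subset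
    · exact (mem_edgeClusters.1 hA).2 B hB hAB
    · exact hne (Finset.eq_of_subset_of_card_le hAB (by rw [card2 A hA, card2 B hB]))
  covers x y hxy := by
    by_cases h : ∃ B ∈ C, {x, y} ⊆ B
    · obtain ⟨B, hB, hs⟩ := h
      exact ⟨B, Finset.mem_union_left _ hB, hs (by simp), hs (by simp)⟩
    · push Not at h
      exact ⟨{x, y}, Finset.mem_union_right _ (mem_edgeClusters.2 ⟨⟨x, y, hxy, rfl⟩, h⟩),
        by simp, by simp⟩

/-- A two-element cluster that shares two vertices with another cluster would be contained in it. -/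
theorem sharedSet_completion (hC : IsClusterFamily G C) :
    sharedSet (C ∪ edgeClusters G C) = sharedSet C := by
  ext e
  constructor
  · intro he
    obtain ⟨A, hA, B, hB, hne, x, y, hxy, hAB, rfl⟩ := mem_sharedSet.1 he
    have h2 : ∀ A ∈ edgeClusters G C, ∀ B ∈ C ∪ edgeClusters G C, A ≠ B → A ∩ B ≠ {x, y} := by
      intro A hA B hB hne hAB
      obtain ⟨⟨z, w, hzw, rfl⟩, -⟩ := mem_edgeClusters.1 hA
      have hcard : (({z, w} : Finset W) ∩ B).card = ({z, w} : Finset W).card := by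
        rw [hAB, Finset.card_pair hxy, Finset.card_pair hzw.ne]
      have := Finset.eq_of_subset_of_card_le Finset.inter_subset_left hcard.ge
      exact hC.twoThin.not_subset _ (Finset.mem_union_right _ hA) B hB hne
        (Finset.inter_eq_left.1 this)
    rcases Finset.mem_union.1 hA with hA' | hA'
    · rcases Finset.mem_union.1 hB with hB' | hB'
      · exact (pair_mem_sharedSet hxy).2 ⟨A, hA', B, hB', hne, hAB⟩
      · rw [Finset.inter_comm] at hAB
        exact absurd hAB (h2 B hB' A hA hne.symm)
    · exact absurd hAB (h2 A hA' B hB hne)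
  · intro he
    obtain ⟨A, hA, B, hB, hne, x, y, hxy, hAB, rfl⟩ := mem_sharedSet.1 he
    exact (pair_mem_sharedSet hxy).2
      ⟨A, Finset.mem_union_left _ hA, B, Finset.mem_union_left _ hB, hne, hAB⟩

end IsClusterFamily

theorem IsTwoThinCover.isClusterFamily (hX : IsTwoThinCover G X) : IsClusterFamily G X :=
  ⟨hX.subset_verts, hX.two_le_card, hX.card_inter_le, hX.not_subset⟩

theorem IsTwoThinCover.coverDegree_eq_one (hX : IsTwoThinCover G X) {e : Sym2 W}
    (he : e ∈ G.edgeSet) (heS : e ∉ sharedSet X) : coverDegree X e = 1 := by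
  classical
  induction e with | _ x y
  have hxy : G.Adj x y := he
  obtain ⟨A, hA, hxA, hyA⟩ := hX.covers x y hxy
  rw [coverDegree, Finset.card_eq_one]
  refine ⟨A, Finset.ext fun B => ?_⟩
  simp only [Finset.mem_filter, Finset.mem_singleton, Sym2.mem_iff, forall_eq_or_imp, forall_eq]
  constructor
  · rintro ⟨hB, hxB, hyB⟩
    by_contra hne
    exact heS (hX.isClusterFamily.mem_sharedSet_of_mem hB hA hne hxy.ne hxB hyB hxA hyA)
  · rintro rfl
    exact ⟨hA, hxA, hyA⟩

/-- For an independent graph, the rank equals the inclusion-exclusion count if and only if the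
nullities of the clusters sum up to the number of shared nonedges. -/
theorem IsTwoThinCover.rk_eq_ieCount_iff (hX : IsTwoThinCover G X) (hG : IsIndependent M G) :
    rk M G.edgeSet = ieCount M G X ↔
      ∑ A ∈ X, nul M (inducedEdges (G.edgeSet ∪ sharedSet X) A) =
        ((sharedSet X : Set (Sym2 W)) \ G.edgeSet).ncard := by
  rw [ieCount, ieCountWith_eq G X _ (fun e he heS => hX.coverDegree_eq_one he heS),
    indep_iff_rk.1 hG]
  have h : ((G.edgeSet ∪ (sharedSet X : Set (Sym2 W))).ncard : ℤ) =
      G.edgeSet.ncard + ((sharedSet X : Set (Sym2 W)) \ G.edgeSet).ncard := by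
    rw [← Set.union_sdiff_self, Set.ncard_union_eq Set.disjoint_sdiff_right]
    push_cast
    rfl
  rw [h]
  constructor <;> intro h <;> linarith

/-- A family of clusters with the right nullities, together with the remaining edges, shows that an
independent graph is a safe base graph. -/
theorem isSafeBaseGraph_of_clusterFamily (hG : IsIndependent M G) (hC : IsClusterFamily G C)
    (hS : IsIndependentCover M C)
    (hnul : ∑ A ∈ C, nul M (inducedEdges (G.edgeSet ∪ sharedSet C) A) =
        ((sharedSet C : Set (Sym2 W)) \ G.edgeSet).ncard)
    {a b : W} {α β : W → Fin 2} (hsplit : IsSafeNonedgeSplit G C a b α β) :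
    IsSafeBaseGraph M G := by
  have hSS := hC.sharedSet_completion
  have hadj : ∀ A ∈ edgeClusters G C, ∀ x ∈ A, ∀ y ∈ A, x ≠ y → G.Adj x y := by
    intro A hA x hx y hy hxy
    obtain ⟨⟨z, w, hzw, rfl⟩, -⟩ := mem_edgeClusters.1 hA
    simp only [Finset.mem_insert, Finset.mem_singleton] at hx hy
    rcases hx with rfl | rfl <;> rcases hy with rfl | rfl
    · exact absurd rfl hxy
    · exact hzw
    · exact hzw.symm
    · exact absurd rfl hxy
  -- The added clusters span edges of G and thus contain no nonedge. All safety conditions, and all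
  -- nullities that may be positive, concern members of `C`.
  have hnon : ∀ A ∈ C ∪ edgeClusters G C, HasSharedNonedge G (C ∪ edgeClusters G C) A →
      A ∈ C ∧ HasSharedNonedge G C A := by
    rintro A hA ⟨x, hx, y, hy, hxy, hn⟩
    rcases Finset.mem_union.1 hA with hA | hA
    · exact ⟨hA, x, hx, y, hy, hSS ▸ hxy, hn⟩
    · exact absurd (hadj A hA x hx y hy (ne_of_mem_sharedSet hxy)) hn
  have hsafe : ∀ {a b : W} {α : W → Fin 2}, IsSafeAt G C a b α →
      IsSafeAt G (C ∪ edgeClusters G C) a b α := by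
    intro a b α h
    refine ⟨fun A hA hA' => ?_, fun A hA hA' => ?_, fun A hA B hB u hua hub hAB hau hn => ?_⟩
    · obtain ⟨h1, h2⟩ := hnon A hA hA'
      exact h.not_both A h1 h2
    · obtain ⟨h1, h2⟩ := hnon A hA hA'
      exact h.nonempty A h1 h2
    · have hmem : a ∈ A ∩ B ∧ u ∈ A ∩ B := by
        rw [hAB]
        simp
      simp only [Finset.mem_inter] at hmem
      have hA' := hnon A hA ⟨a, hmem.1.1, u, hmem.2.1, hau, hn⟩
      have hB' := hnon B hB ⟨a, hmem.1.2, u, hmem.2.2, hau, hn⟩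
      exact h.eq_of_inter A hA'.1 B hB'.1 u hua hub hAB (hSS ▸ hau) hn
  refine ⟨C ∪ edgeClusters G C, a, b, α, β, hG, hC.twoThin, ?_, ?_, ?_, hsplit.nonedge,
    hsafe hsplit.safe_left, hsafe hsplit.safe_right⟩
  · rw [IsIndependentCover, hSS]
    exact hS
  · rw [hC.twoThin.rk_eq_ieCount_iff hG, hSS, ← hnul]
    refine (Finset.sum_subset Finset.subset_union_left fun A hA hAC => ?_).symm
    have hA' := (Finset.mem_union.1 hA).resolve_left hAC
    refine nul_eq_zero (hG.subset ?_)
    rintro e ⟨he, heA⟩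
    refine he.elim id fun he => ?_
    induction e with | _ x y
    exact hadj A hA' x (heA x (by simp)) y (heA y (by simp)) (ne_of_mem_sharedSet he)
  · rw [hSS]
    exact hsplit.mem_shared

/-- Enlarging a safe base graph without adding edges between its vertices. -/
theorem isSafeBaseGraph_of_induced {G' : VGraph W} (hG : IsSafeBaseGraph M G)
    (hG' : IsIndependent M G') (hle : G ≤ G')
    (hind : ∀ x ∈ G.verts, ∀ y ∈ G.verts, G'.Adj x y → G.Adj x y) : IsSafeBaseGraph M G' := by
  obtain ⟨X, a, b, α, β, h⟩ := hG
  -- Copies, shared nonedges and induced edge sets depend only on adjacencies inside V(G), and these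
  -- do not change. So the old cover, viewed as a cluster family of the larger graph, keeps its
  -- nullities and its safe split.
  have hadj : ∀ x ∈ G.verts, ∀ y ∈ G.verts, (G'.Adj x y ↔ G.Adj x y) := fun x hx y hy =>
    ⟨hind x hx y hy, fun h => hle.2 h⟩
  have hXv := h.twoThin.subset_verts
  have hSv : ∀ x y, s(x, y) ∈ sharedSet X → x ∈ G.verts ∧ y ∈ G.verts := by
    intro x y hxy
    obtain ⟨A, hA, B, hB, -, hAB⟩ := (pair_mem_sharedSet (ne_of_mem_sharedSet hxy)).1 hxy
    have h1 : x ∈ A ∩ B ∧ y ∈ A ∩ B := by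
      rw [hAB]
      simp
    simp only [Finset.mem_inter] at h1
    exact ⟨hXv A hA h1.1.1, hXv A hA h1.2.1⟩
  have hcop : ∀ c α, ∀ A ∈ X, copies G' c α A = copies G c α A := by
    intro c α A hA
    ext i
    simp only [copies, Set.mem_ofPred_eq]
    refine and_congr_right fun hc => exists_congr fun w => and_congr_right fun hw => ?_
    rw [hadj c (hXv A hA hc) w (hXv A hA hw)]
  have hsn : ∀ A, HasSharedNonedge G' X A ↔ HasSharedNonedge G X A := by
    intro A
    refine exists_congr fun x => and_congr_right fun _ => exists_congr fun y =>
      and_congr_right fun _ => and_congr_right fun hxy => ?_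
    rw [hadj x (hSv x y hxy).1 y (hSv x y hxy).2]
  have hsafe : ∀ {c d : W} {α : W → Fin 2}, IsSafeAt G X c d α → IsSafeAt G' X c d α := by
    intro c d α hs
    refine ⟨fun A hA hA' => ?_, fun A hA hA' => ?_, fun A hA B hB u hu hu' hAB hcu hn => ?_⟩
    · rw [hcop c α A hA]
      exact hs.not_both A hA ((hsn A).1 hA')
    · rw [hcop c α A hA]
      exact hs.nonempty A hA ((hsn A).1 hA')
    · rw [hcop c α A hA, hcop c α B hB]
      refine hs.eq_of_inter A hA B hB u hu hu' hAB hcu ?_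
      rwa [← hadj c (hSv c u hcu).1 u (hSv c u hcu).2]
  refine isSafeBaseGraph_of_clusterFamily (C := X) hG' ?_ h.independentCover ?_
    (a := a) (b := b) (α := α) (β := β) ⟨h.safeSplit.mem_shared, ?_, hsafe h.safeSplit.safe_left,
      hsafe h.safeSplit.safe_right⟩
  · exact ⟨fun A hA => (hXv A hA).trans hle.1, h.twoThin.two_le_card, h.twoThin.card_inter_le,
      h.twoThin.not_subset⟩
  · have hkey : ∀ A ∈ X, inducedEdges (G'.edgeSet ∪ sharedSet X) A =
        inducedEdges (G.edgeSet ∪ sharedSet X) A := by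
      intro A hA
      ext e
      induction e with | _ x y
      simp only [inducedEdges, Set.mem_ofPred_eq, Set.mem_union]
      refine and_congr_left fun hx => or_congr_left ?_
      exact hadj x (hXv A hA (hx x (by simp))) y (hXv A hA (hx y (by simp)))
    have hkey2 : (sharedSet X : Set (Sym2 W)) \ G'.edgeSet = (sharedSet X : Set (Sym2 W)) \ G.edgeSet := by
      ext e
      induction e with | _ x y
      refine and_congr_right fun hxy => not_congr ?_
      exact hadj x (hSv x y hxy).1 y (hSv x y hxy).2
    rw [Finset.sum_congr rfl fun A hA => by rw [hkey A hA], hkey2]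
    exact (h.twoThin.rk_eq_ieCount_iff h.independent).1 h.rank_eq
  · rw [hadj a (hSv a b h.safeSplit.mem_shared).1 b (hSv a b h.safeSplit.mem_shared).2]
    exact h.safeSplit.nonedge

/-! ### `k`-sums and Henneberg-I extensions -/

theorem edgeSet_subset_completeOn (G : VGraph W) : G.edgeSet ⊆ completeOn G.verts := by
  intro e he
  induction e with | _ x y
  have h : G.Adj x y := he
  exact mem_completeOn.2 ⟨h.ne, G.edge_vert h, G.edge_vert h.symm⟩

/-- The common vertices already form a clique of G, so H adds no edge between vertices of G;
independence is preserved by gluing along a complete graph. -/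
theorem isSafeBaseGraph_of_isKSum (hM : IsRigidityLike M) {k : ℕ} {H G' : VGraph W}
    (hG : IsSafeBaseGraph M G) (hH : IsIndependent M H) (hk : IsKSum k G H G') :
    IsSafeBaseGraph M G' := by
  classical
  obtain ⟨U, -, hUG, hUH, hV, rfl⟩ := hk
  have hGi : M.Indep G.edgeSet := by
    obtain ⟨X, a, b, α, β, h⟩ := hG
    exact h.independent
  refine isSafeBaseGraph_of_induced hG ?_ le_sup_left ?_
  · have hU : (G.verts.toFinite.toFinset ∩ H.verts.toFinite.toFinset : Finset W) = U := by
      rw [← Finset.coe_inj, ← hV]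
      simp
    have hK : ∀ {K : VGraph W}, IsCliqueOf K U → completeOn (U : Set W) ⊆ K.edgeSet := by
      intro K hK e he
      induction e with | _ x y
      obtain ⟨hne, hx, hy⟩ := mem_completeOn.1 he
      exact hK.2 x hx y hy hne
    rw [IsIndependent, SimpleGraph.Subgraph.edgeSet_sup]
    refine hM.indep_union (V₁ := G.verts.toFinite.toFinset) (V₂ := H.verts.toFinite.toFinset)
      hGi hH ?_ ?_ ?_ ?_
    · simpa using edgeSet_subset_completeOn G
    · simpa using edgeSet_subset_completeOn H
    · rw [hU]
      exact hK hUG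
    · rw [hU]
      exact hK hUH
  · rintro x hx y hy (h | h)
    · exact h
    · have hx' : x ∈ (U : Set W) := hV ▸ ⟨hx, H.edge_vert h⟩
      have hy' : y ∈ (U : Set W) := hV ▸ ⟨hy, H.edge_vert h.symm⟩
      exact hUG.2 x hx' y hy' h.ne

theorem isSafeBaseGraph_of_isHennebergI (hM : IsRigidityLike M) {G' : VGraph W}
    (hG : IsSafeBaseGraph M G) (h : IsHennebergI G G') : IsSafeBaseGraph M G' := by
  obtain ⟨z, T, hz, hT, hTG, hv, he⟩ := h
  have hGi : M.Indep G.edgeSet := by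
    obtain ⟨X, a, b, α, β, h⟩ := hG
    exact h.independent
  refine isSafeBaseGraph_of_induced hG ?_ ⟨?_, ?_⟩ ?_
  · rw [IsIndependent, he]
    exact hM.indep_star _ z T hGi (notMem_endpoints_of_subset (edgeSet_subset_completeOn G) hz)
      (fun h => hz (hTG h)) hT.le
  · rw [hv]
    exact Set.subset_insert _ _
  · intro x y hxy
    have : s(x, y) ∈ G'.edgeSet := by
      rw [he]
      exact Or.inl hxy
    exact this
  · intro x hx y hy hxy
    have h1 : s(x, y) ∈ G'.edgeSet := hxy
    rw [he] at h1
    rcases h1 with h1 | ⟨t, -, h1⟩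
    · exact h1
    · rcases Sym2.eq_iff.1 h1 with ⟨rfl, -⟩ | ⟨-, rfl⟩
      · exact absurd hx hz
      · exact absurd hy hz

end Completion

/-! ### Generic polynomial conditions on frameworks -/

section Polynomial

variable {W : Type*} {m : ℕ}

/-- A real function on frameworks that is polynomial in the coordinates. -/
def IsPolynomialFun (f : (W → Fin m → ℝ) → ℝ) : Prop :=
  ∃ Q : MvPolynomial (W × Fin m) ℝ, ∀ p, f p = MvPolynomial.eval (fun vi => p vi.1 vi.2) Q

/-- A condition on frameworks that is satisfiable and says that some polynomial does not vanish. -/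
def IsGenericCondition (P : (W → Fin m → ℝ) → Prop) : Prop :=
  (∃ Q : MvPolynomial (W × Fin m) ℝ, ∀ p,
    P p ↔ MvPolynomial.eval (fun vi => p vi.1 vi.2) Q ≠ 0) ∧ ∃ p, P p

namespace IsGenericCondition

/-- A satisfiable condition has a nonzero polynomial. A finite product of such polynomials is
nonzero, hence does not vanish everywhere on the infinite field ℝ. -/
theorem forall_finite {ι : Type*} [Finite ι] {P : ι → (W → Fin m → ℝ) → Prop}
    (h : ∀ i, IsGenericCondition (P i)) : IsGenericCondition fun p => ∀ i, P i p := by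
  have := Fintype.ofFinite ι
  choose Q hQ using fun i => (h i).1
  have hne : ∀ i, Q i ≠ 0 := by
    intro i h0
    obtain ⟨p, hp⟩ := (h i).2
    rw [hQ, h0, map_zero] at hp
    exact hp rfl
  have hprod : ∀ p : W → Fin m → ℝ, (∀ i, P i p) ↔
      MvPolynomial.eval (fun vi => p vi.1 vi.2) (∏ i, Q i) ≠ 0 := by
    intro p
    rw [map_prod, Finset.prod_ne_zero_iff]
    simp [hQ]
  refine ⟨⟨_, hprod⟩, ?_⟩
  by_contra hcon
  push Not at hcon
  refine Finset.prod_ne_zero_iff.2 (fun i _ => hne i) (MvPolynomial.funext (R := ℝ)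
    (p := ∏ i, Q i) (q := 0) fun x => ?_)
  by_contra hx
  rw [map_zero] at hx
  obtain ⟨i, hi⟩ := hcon fun w k => x (w, k)
  exact hi ((hprod _).2 hx i)

theorem of_imp {c : Prop} {P : (W → Fin m → ℝ) → Prop} (h : c → IsGenericCondition P) :
    IsGenericCondition fun p => c → P p := by
  by_cases hc : c
  · simpa [hc] using h hc
  · exact ⟨⟨1, fun p => by simp [hc]⟩, 0, fun h => absurd h hc⟩

theorem and {P P' : (W → Fin m → ℝ) → Prop} (h : IsGenericCondition P)
    (h' : IsGenericCondition P') : IsGenericCondition fun p => P p ∧ P' p := by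
  have := forall_finite (ι := Bool) (P := fun b => if b then P else P')
    (by rintro (_ | _) <;> simpa)
  simpa [and_comm] using this

end IsGenericCondition

/-- Over ℝ a matrix B and its Gram matrix B Bᵀ have equal rank, so independence of the rows is the
nonvanishing of a single polynomial, the Gram determinant. -/
theorem isGenericCondition_linearIndependent {ι κ : Type*} [Finite ι] [Finite κ]
    {v : (W → Fin m → ℝ) → ι → κ → ℝ} (hv : ∀ i k, IsPolynomialFun fun p => v p i k)
    (hex : ∃ p, LinearIndependent ℝ (v p)) :
    IsGenericCondition fun p => LinearIndependent ℝ (v p) := by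
  classical
  have := Fintype.ofFinite ι
  have := Fintype.ofFinite κ
  choose Q hQ using hv
  let A : Matrix ι κ (MvPolynomial (W × Fin m) ℝ) := Matrix.of Q
  refine ⟨⟨(A * A.transpose).det, fun p => ?_⟩, hex⟩
  let B : Matrix ι κ ℝ := Matrix.of (v p)
  have hB : MvPolynomial.eval (fun vi => p vi.1 vi.2) (A * A.transpose).det =
      (B * B.transpose).det := by
    rw [RingHom.map_det]
    congr 1
    ext i j
    simp [A, B, Matrix.mul_apply, hQ]
  rw [hB]
  change LinearIndependent ℝ B.row ↔ _
  rw [← isUnit_iff_ne_zero, ← Matrix.isUnit_iff_isUnit_det,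
    ← Matrix.linearIndependent_rows_iff_isUnit]
  rw [linearIndependent_iff_card_eq_finrank_span, linearIndependent_iff_card_eq_finrank_span]
  rw [Set.finrank, Set.finrank, ← Matrix.rank_eq_finrank_span_row,
    ← Matrix.rank_eq_finrank_span_row, Matrix.rank_self_mul_transpose]

end Polynomial

/-! ### Direction maps -/

/-- The midpoint of two points. -/
noncomputable def mid {m : ℕ} (x y : Fin m → ℝ) : Fin m → ℝ := fun k => (x k + y k) / 2

/-- The properties shared by the bar directions in 3-space and the cofactor directions in the
plane. -/
structure IsRigidityDirection {m : ℕ} (D : (Fin m → ℝ) → (Fin m → ℝ) → Fin 3 → ℝ) : Prop where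
  polynomial : IsPolynomialMap D
  symm : ∃ ε : ℝˣ, ∀ x y, D y x = -(ε : ℝ) • D x y
  midpoint : ∃ c d : ℝ, c ≠ 0 ∧ d ≠ 0 ∧ ∀ x y,
    D (mid x y) x = c • D x y ∧ D (mid x y) y = d • D x y
  exists_star : ∃ (z : Fin m → ℝ) (t : Fin 3 → Fin m → ℝ), LinearIndependent ℝ fun i => D z (t i)
  exists_mid : ∃ x y w₁ w₂, LinearIndependent ℝ
    ![D (mid x y) x, D (mid x y) w₁, D (mid x y) w₂]
  exists_motions : ∃ T : Fin 6 → (Fin m → ℝ) → Fin 3 → ℝ,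
    (∀ i k, ∃ P : MvPolynomial (Fin m) ℝ, ∀ x, T i x k = MvPolynomial.eval x P) ∧
    (∀ i x y, ∑ k, D x y k * T i x k = ∑ k, D x y k * T i y k) ∧
    ∃ x : Fin 3 → Fin m → ℝ, LinearIndependent ℝ fun i (jk : Fin 3 × Fin 3) => T i (x jk.1) jk.2

theorem isRigidityDirection_bar : IsRigidityDirection barDirection where
  polynomial := barDirection_polynomial
  symm := ⟨1, fun x y => by
    ext k
    simp [barDirection]⟩
  midpoint := ⟨-(1 / 2), 1 / 2, by norm_num, by norm_num, fun x y => by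
    constructor <;> ext k <;> simp only [barDirection, mid, Pi.smul_apply, smul_eq_mul] <;> ring⟩
  exists_star := ⟨0, ![![1, 0, 0], ![0, 1, 0], ![0, 0, 1]], by
    rw [Fintype.linearIndependent_iff]
    intro g hg i
    have h0 := congrFun hg 0
    have h1 := congrFun hg 1
    have h2 := congrFun hg 2
    simp [Fin.sum_univ_succ, barDirection] at h0 h1 h2
    fin_cases i <;> simp_all⟩
  exists_mid := ⟨![1, 0, 0], ![-1, 0, 0], ![0, 1, 0], ![0, 0, 1], by
    rw [Fintype.linearIndependent_iff]
    intro g hg i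
    have h0 := congrFun hg 0
    have h1 := congrFun hg 1
    have h2 := congrFun hg 2
    simp [Fin.sum_univ_succ, barDirection, mid] at h0 h1 h2
    fin_cases i <;> simp_all⟩
  exists_motions := by
    -- Three translations and three infinitesimal rotations.
    refine ⟨![fun _ => ![1, 0, 0], fun _ => ![0, 1, 0], fun _ => ![0, 0, 1],
      fun x => ![0, -x 2, x 1], fun x => ![x 2, 0, -x 0], fun x => ![-x 1, x 0, 0]], ?_, ?_,
      ![![0, 0, 0], ![1, 0, 0], ![0, 1, 0]], ?_⟩
    · let X : Fin 3 → MvPolynomial (Fin 3) ℝ := MvPolynomial.X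
      intro i k
      refine ⟨(![![1, 0, 0], ![0, 1, 0], ![0, 0, 1], ![0, -X 2, X 1], ![X 2, 0, -X 0],
        ![-X 1, X 0, 0]] : Fin 6 → Fin 3 → MvPolynomial (Fin 3) ℝ) i k, fun x => ?_⟩
      fin_cases i <;> fin_cases k <;> simp [X]
    · intro i x y
      fin_cases i <;> simp [Fin.sum_univ_succ, barDirection] <;> ring
    · rw [Fintype.linearIndependent_iff]
      intro g hg
      have h := fun j k => congrFun hg (j, k)
      have h00 := h 0 0
      have h01 := h 0 1
      have h02 := h 0 2
      have h11 := h 1 1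
      have h12 := h 1 2
      have h22 := h 2 2
      simp [Fin.sum_univ_succ] at h00 h01 h02 h11 h12 h22
      intro i
      fin_cases i <;> simp_all

theorem isRigidityDirection_cofactor : IsRigidityDirection cofactorDirection where
  polynomial := cofactorDirection_polynomial
  symm := ⟨-1, fun x y => by
    ext k
    fin_cases k <;> simp [cofactorDirection] <;> ring⟩
  midpoint := ⟨1 / 4, 1 / 4, by norm_num, by norm_num, fun x y => by
    constructor <;> ext k <;> fin_cases k <;> simp [cofactorDirection, mid] <;> ring⟩
  exists_star := ⟨0, ![![1, 0], ![0, 1], ![1, 1]], by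
    rw [Fintype.linearIndependent_iff]
    intro g hg i
    have h0 := congrFun hg 0
    have h1 := congrFun hg 1
    have h2 := congrFun hg 2
    simp [Fin.sum_univ_succ, cofactorDirection] at h0 h1 h2
    fin_cases i <;> simp_all⟩
  exists_mid := ⟨![1, 0], ![-1, 0], ![0, 1], ![1, 1], by
    rw [Fintype.linearIndependent_iff]
    intro g hg i
    have h0 := congrFun hg 0
    have h1 := congrFun hg 1
    have h2 := congrFun hg 2
    simp [Fin.sum_univ_succ, cofactorDirection, mid] at h0 h1 h2
    fin_cases i <;> simp_all⟩
  exists_motions := by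
    -- The cofactor analogue of rigid motions: three constant, two linear and one quadratic vector
    -- field whose differences are orthogonal to the directions.
    refine ⟨![fun _ => ![1, 0, 0], fun _ => ![0, 1, 0], fun _ => ![0, 0, 1],
      fun x => ![x 1, -x 0, 0], fun x => ![0, x 1, -x 0],
      fun x => ![x 1 * x 1, -2 * (x 0 * x 1), x 0 * x 0]], ?_, ?_,
      ![![0, 0], ![1, 0], ![0, 1]], ?_⟩
    · let X : Fin 2 → MvPolynomial (Fin 2) ℝ := MvPolynomial.X
      intro i k
      refine ⟨(![![1, 0, 0], ![0, 1, 0], ![0, 0, 1], ![X 1, -X 0, 0], ![0, X 1, -X 0],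
        ![X 1 * X 1, -2 * (X 0 * X 1), X 0 * X 0]] : Fin 6 → Fin 3 → MvPolynomial (Fin 2) ℝ) i k,
        fun x => ?_⟩
      fin_cases i <;> fin_cases k <;> simp [X]
    · intro i x y
      fin_cases i <;> simp [Fin.sum_univ_succ, cofactorDirection] <;> ring
    · rw [Fintype.linearIndependent_iff]
      intro g hg
      have h := fun j k => congrFun hg (j, k)
      have h00 := h 0 0
      have h01 := h 0 1
      have h02 := h 0 2
      have h11 := h 1 1
      have h12 := h 1 2
      have h20 := h 2 0
      have h21 := h 2 1
      simp [Fin.sum_univ_succ] at h00 h01 h02 h11 h12 h20 h21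
      intro i
      fin_cases i <;> simp_all

/-! ### Generic frameworks -/

/-- The framework `p` satisfies all the genericity conditions that are needed. -/
structure IsGenericFramework {W : Type*} [DecidableEq W] {m : ℕ}
    (D : (Fin m → ℝ) → (Fin m → ℝ) → Fin 3 → ℝ) (T : Fin 6 → (Fin m → ℝ) → Fin 3 → ℝ)
    (p : W → Fin m → ℝ) : Prop where
  linearIndepOn : ∀ I : Set (Sym2 W), GenericIndep D I → LinearIndepOn ℝ (edgeRow D p) I
  star : ∀ (z : W) (S : Finset W), z ∉ S → S.card ≤ 3 →
    LinearIndepOn ℝ (fun t => D (p z) (p t)) (S : Set W)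
  mid : ∀ x y w₁ w₂ : W, [x, y, w₁, w₂].Nodup → LinearIndependent ℝ
    ![D (mid (p x) (p y)) (p x), D (mid (p x) (p y)) (p w₁), D (mid (p x) (p y)) (p w₂)]
  motions : ∀ x : Fin 3 → W, Function.Injective x →
    LinearIndependent ℝ fun i (jk : Fin 3 × Fin 3) => T i (p (x jk.1)) jk.2

theorem isPolynomialFun_comp {W : Type*} {m : ℕ} {σ : Type*} (P : MvPolynomial σ ℝ)
    {f : σ → (W → Fin m → ℝ) → ℝ} (hf : ∀ i, IsPolynomialFun (f i)) :
    IsPolynomialFun fun p => MvPolynomial.eval (fun i => f i p) P := by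
  choose Q hQ using hf
  refine ⟨MvPolynomial.bind₁ Q P, fun p => ?_⟩
  simp only [hQ]
  exact (MvPolynomial.eval₂Hom_bind₁ _ _ _ _).symm

theorem isPolynomialFun_direction {W : Type*} {m : ℕ}
    {D : (Fin m → ℝ) → (Fin m → ℝ) → Fin 3 → ℝ} (hD : IsPolynomialMap D)
    {x y : (W → Fin m → ℝ) → Fin m → ℝ} (hx : ∀ i, IsPolynomialFun fun p => x p i)
    (hy : ∀ i, IsPolynomialFun fun p => y p i) (k : Fin 3) :
    IsPolynomialFun fun p => D (x p) (y p) k := by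
  obtain ⟨P, hP⟩ := hD k
  simp only [hP]
  refine isPolynomialFun_comp P (f := fun bi p => if bi.1 then x p bi.2 else y p bi.2) ?_
  rintro ⟨_ | _, i⟩
  · simpa using hy i
  · simpa using hx i

theorem isPolynomialFun_coord {W : Type*} {m : ℕ} (w : W) (i : Fin m) :
    IsPolynomialFun fun p : W → Fin m → ℝ => p w i :=
  ⟨MvPolynomial.X (w, i), fun p => by simp⟩

theorem isPolynomialFun_mid {W : Type*} {m : ℕ} (x y : W) (i : Fin m) :
    IsPolynomialFun fun p : W → Fin m → ℝ => mid (p x) (p y) i :=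
  ⟨MvPolynomial.C (1 / 2) * (MvPolynomial.X (x, i) + MvPolynomial.X (y, i)), fun p => by
    simp [mid]
    ring⟩

/-- Each requirement is a finite conjunction of polynomial nonvanishing conditions, and each of
these is satisfiable by the sample configurations in `IsRigidityDirection`; hence all hold
simultaneously somewhere. -/
theorem IsRigidityDirection.exists_isGenericFramework {m : ℕ}
    {D : (Fin m → ℝ) → (Fin m → ℝ) → Fin 3 → ℝ} (hD : IsRigidityDirection D) (W : Type*)
    [Fintype W] [DecidableEq W] :
    ∃ T : Fin 6 → (Fin m → ℝ) → Fin 3 → ℝ,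
      (∀ i x y, ∑ k, D x y k * T i x k = ∑ k, D x y k * T i y k) ∧
      ∃ p : W → Fin m → ℝ, IsGenericFramework D T p := by
  obtain ⟨T, hTp, hT, x₀, hx₀⟩ := hD.exists_motions
  refine ⟨T, hT, ?_⟩
  have h1 : IsGenericCondition fun p : W → Fin m → ℝ => ∀ I : Set (Sym2 W), GenericIndep D I →
      LinearIndepOn ℝ (edgeRow D p) I := by
    refine IsGenericCondition.forall_finite fun I => IsGenericCondition.of_imp fun hI => ?_
    obtain ⟨Q, hQ⟩ := edgeRow_polynomial (W := W) hD.polynomial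
    have hpoly : ∀ (e : I) (wk : W × Fin 3),
        IsPolynomialFun fun p : W → Fin m → ℝ => edgeRow D p e wk :=
      fun e wk => ⟨Q e wk, fun p => hQ p e wk⟩
    exact isGenericCondition_linearIndependent hpoly hI.2
  have h2 : IsGenericCondition fun p : W → Fin m → ℝ => ∀ (z : W) (S : Finset W), z ∉ S →
      S.card ≤ 3 → LinearIndepOn ℝ (fun t => D (p z) (p t)) (S : Set W) := by
    refine IsGenericCondition.forall_finite fun z => IsGenericCondition.forall_finite fun S =>
      IsGenericCondition.of_imp fun hz => IsGenericCondition.of_imp fun hS => ?_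
    refine isGenericCondition_linearIndependent (v := fun p (t : (S : Set W)) => D (p z) (p t))
      (fun t k => isPolynomialFun_direction hD.polynomial (isPolynomialFun_coord z)
        (isPolynomialFun_coord (t : W)) k) ?_
    obtain ⟨z₀, t₀, h₀⟩ := hD.exists_star
    obtain ⟨f⟩ : Nonempty (S ↪ Fin 3) :=
      Function.Embedding.nonempty_of_card_le (by simpa using hS)
    -- Since z is not in S, the default value z₀ is the position of z.
    refine ⟨fun w => if h : w ∈ S then t₀ (f ⟨w, h⟩) else z₀, ?_⟩
    have h3 := h₀.comp f f.injective
    simp only [hz, dite_false]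
    refine (linearIndependent_equiv' (Equiv.refl _) ?_).1 h3
    funext t
    have ht : (t : W) ∈ S := t.2
    exact congrArg (D z₀) (dif_pos ht)
  have h3 : IsGenericCondition fun p : W → Fin m → ℝ => ∀ x y w₁ w₂ : W, [x, y, w₁, w₂].Nodup →
      LinearIndependent ℝ ![D (mid (p x) (p y)) (p x), D (mid (p x) (p y)) (p w₁),
        D (mid (p x) (p y)) (p w₂)] := by
    refine IsGenericCondition.forall_finite fun x => IsGenericCondition.forall_finite fun y =>
      IsGenericCondition.forall_finite fun w₁ => IsGenericCondition.forall_finite fun w₂ =>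
      IsGenericCondition.of_imp fun hnd => ?_
    refine isGenericCondition_linearIndependent ?_ ?_
    · have hm := fun w k => isPolynomialFun_direction (W := W) (x := fun p => mid (p x) (p y))
        (y := fun p => p w) hD.polynomial (isPolynomialFun_mid x y) (isPolynomialFun_coord w) k
      intro i k
      fin_cases i
      · exact hm x k
      · exact hm w₁ k
      · exact hm w₂ k
    · obtain ⟨x₁, y₁, u₁, u₂, h⟩ := hD.exists_mid
      refine ⟨fun w => if w = x then x₁ else if w = y then y₁ else if w = w₁ then u₁ else u₂, ?_⟩
      simp only [List.nodup_cons, List.mem_cons, List.not_mem_nil, or_false, not_or,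
        List.nodup_nil, not_false_eq_true, and_true] at hnd
      obtain ⟨⟨h1, h2, h3⟩, ⟨h4, h5⟩, h6⟩ := hnd
      simpa [Ne.symm h1, Ne.symm h2, Ne.symm h3, Ne.symm h4, Ne.symm h5, Ne.symm h6] using h
  have h4 : IsGenericCondition fun p : W → Fin m → ℝ => ∀ x : Fin 3 → W, Function.Injective x →
      LinearIndependent ℝ fun i (jk : Fin 3 × Fin 3) => T i (p (x jk.1)) jk.2 := by
    refine IsGenericCondition.forall_finite fun x => IsGenericCondition.of_imp fun hx => ?_
    refine isGenericCondition_linearIndependent ?_ ?_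
    · intro i jk
      obtain ⟨P, hP⟩ := hTp i jk.2
      simp only [hP]
      exact isPolynomialFun_comp P fun k => isPolynomialFun_coord _ k
    · refine ⟨Function.extend x x₀ 0, ?_⟩
      simpa [hx.extend_apply] using hx₀
  obtain ⟨p, hp1, hp2, hp3, hp4⟩ := (h1.and (h2.and (h3.and h4))).2
  exact ⟨p, hp1, hp2, hp3, hp4⟩

/-! ### Linear algebra of rows -/

section Rows

variable {W : Type*} [DecidableEq W] {m : ℕ} {D : (Fin m → ℝ) → (Fin m → ℝ) → Fin 3 → ℝ}

/-- The row of the edge `xy`, oriented from `x` to `y`. -/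
def barRow (D : (Fin m → ℝ) → (Fin m → ℝ) → Fin 3 → ℝ) (p : W → Fin m → ℝ) (x y : W) :
    W × Fin 3 → ℝ := fun wk =>
  (if wk.1 = x then D (p x) (p y) wk.2 else 0) - if wk.1 = y then D (p x) (p y) wk.2 else 0

theorem barRow_swap (hD : IsRigidityDirection D) (p : W → Fin m → ℝ) (x y : W) :
    ∃ u : ℝˣ, barRow D p y x = u • barRow D p x y := by
  obtain ⟨ε, hε⟩ := hD.symm
  refine ⟨ε, ?_⟩
  ext wk
  simp only [barRow, hε (p x) (p y), Pi.smul_apply, Units.smul_def, smul_eq_mul]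
  split_ifs <;> ring

theorem edgeRow_eq (hD : IsRigidityDirection D) (p : W → Fin m → ℝ) {x y : W} (hxy : x ≠ y) :
    ∃ u : ℝˣ, edgeRow D p s(x, y) = u • barRow D p x y := by
  have h : ∀ e : Sym2 W, ¬ e.IsDiag → edgeRow D p e = barRow D p (Quot.out e).1 (Quot.out e).2 := by
    intro e he
    have hne : (Quot.out e).1 ≠ (Quot.out e).2 := by
      intro hcon
      apply he
      have : Sym2.mk (Quot.out e).1 (Quot.out e).2 = e := Quot.out_eq e
      rw [← this, hcon]
      simp
    ext wk
    simp only [edgeRow, barRow]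
    split_ifs with h1 h2
    · exact absurd (h1.symm.trans h2) hne
    · simp
    · simp
    · simp
  have hout : s((Quot.out s(x, y)).1, (Quot.out s(x, y)).2) = s(x, y) := Quot.out_eq _
  rw [h _ (by simpa using hxy)]
  rcases Sym2.eq_iff.1 hout with ⟨h1, h2⟩ | ⟨h1, h2⟩
  · exact ⟨1, by rw [h1, h2, one_smul]⟩
  · rw [h1, h2]
    exact barRow_swap hD p x y

theorem linearIndepOn_of_units_smul {ι V : Type*} [AddCommGroup V] [Module ℝ V] {v w : ι → V}
    {s : Set ι} (h : LinearIndepOn ℝ w s) (hvw : ∀ i ∈ s, ∃ u : ℝˣ, v i = u • w i) :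
    LinearIndepOn ℝ v s := by
  choose u hu using fun i : s => hvw i i.2
  have := h.units_smul u
  refine (linearIndependent_equiv' (Equiv.refl _) ?_).1 this
  funext i
  simp [hu]

/-- Adding a vertex `z` joined to `T` with independent directions. -/
theorem linearIndepOn_union_star (hD : IsRigidityDirection D) {p : W → Fin m → ℝ}
    {E : Set (Sym2 W)} {z : W} {T : Finset W} (hE : LinearIndepOn ℝ (edgeRow D p) E)
    (hdiag : ∀ e ∈ E, ¬ e.IsDiag) (hz : z ∉ endpoints E) (hzT : z ∉ T)
    (hT : LinearIndepOn ℝ (fun t => D (p z) (p t)) (T : Set W)) :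
    LinearIndepOn ℝ (edgeRow D p) (E ∪ starOn z T) := by
  refine hE.union_of_quotient ?_
  -- P reads off the columns of z. The rows of E vanish there, and the rows of the star become the
  -- independent directions at z up to units, so the star is independent modulo E.
  let P : (W × Fin 3 → ℝ) →ₗ[ℝ] (Fin 3 → ℝ) := LinearMap.funLeft ℝ ℝ fun k => (z, k)
  have hker : Submodule.span ℝ (edgeRow D p '' E) ≤ LinearMap.ker P := by
    rw [Submodule.span_le]
    rintro _ ⟨e, he, rfl⟩
    induction e with | _ x y
    obtain ⟨u, hu⟩ := edgeRow_eq hD p (x := x) (y := y) (by simpa using hdiag _ he)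
    have hx : z ≠ x := fun h => hz ⟨_, he, by simp [h]⟩
    have hy : z ≠ y := fun h => hz ⟨_, he, by simp [h]⟩
    rw [SetLike.mem_coe, LinearMap.mem_ker, hu]
    ext k
    simp [P, barRow, hx, hy, Units.smul_def]
  refine LinearIndepOn.of_comp ((Submodule.span ℝ (edgeRow D p '' E)).liftQ P hker) ?_
  have hstar : starOn z T = (fun t => s(z, t)) '' (T : Set W) := by
    ext e
    simp [mem_starOn, eq_comm]
  rw [hstar]
  refine LinearIndepOn.image_of_comp _ _ (linearIndepOn_of_units_smul hT fun t ht => ?_)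
  have hzt : z ≠ t := fun h => hzT (h ▸ ht)
  obtain ⟨u, hu⟩ := edgeRow_eq hD p hzt
  refine ⟨u, ?_⟩
  simp only [Function.comp, hu, Submodule.mkQ_apply, Submodule.liftQ_apply]
  ext k
  simp [P, barRow, hzt, Units.smul_def]

/-- Adding up the columns of the vertices with the same image. -/
noncomputable def pushColumns [Fintype W] (π : W → W) : (W × Fin 3 → ℝ) →ₗ[ℝ] (W × Fin 3 → ℝ) where
  toFun r wk := ∑ x, if π x = wk.1 then r (x, wk.2) else 0
  map_add' r s := by
    ext wk
    simp only [Pi.add_apply, ← Finset.sum_add_distrib]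
    refine Finset.sum_congr rfl fun x _ => ?_
    split_ifs <;> simp
  map_smul' c r := by
    ext wk
    simp only [Pi.smul_apply, smul_eq_mul, RingHom.id_apply, Finset.mul_sum]
    refine Finset.sum_congr rfl fun x _ => ?_
    split_ifs <;> simp

/-- In the framework p ∘ π identified vertices share their position, so adding up their columns
loses nothing but the labels. -/
theorem pushColumns_barRow [Fintype W] (π : W → W) (p : W → Fin m → ℝ) (x y : W) :
    pushColumns π (barRow D (p ∘ π) x y) = barRow D p (π x) (π y) := by
  ext ⟨w, k⟩
  have h : ∀ (c : ℝ) (x : W), (∑ v, if π v = w then (if v = x then c else 0) else 0) =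
      if w = π x then c else 0 := by
    intro c x
    rw [Finset.sum_eq_single x (fun v _ hv => by simp [hv]) (by simp)]
    simp [eq_comm]
  simp only [pushColumns, barRow, LinearMap.coe_mk, AddHom.coe_mk, Function.comp]
  rw [← h, ← h, ← Finset.sum_sub_distrib]
  refine Finset.sum_congr rfl fun v _ => ?_
  split_ifs <;> simp

/-- Independence can be checked after moving vertices together, up to the edges that are
identified with another edge. -/
theorem linearIndepOn_of_collapse [Fintype W] (hD : IsRigidityDirection D) {p : W → Fin m → ℝ}
    {π : W → W} {E E₀ : Set (Sym2 W)} (hE₀ : E₀ ⊆ E) (hdiag : ∀ e ∈ E, ¬ (e.map π).IsDiag)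
    (hp : LinearIndepOn ℝ (edgeRow D p) (Sym2.map π '' E))
    (hinj : ∀ e ∈ E, ∀ f ∈ E, e.map π = f.map π → e ≠ f → e ∈ E₀)
    (h₀ : LinearIndepOn ℝ (edgeRow D (p ∘ π)) E₀) : LinearIndepOn ℝ (edgeRow D (p ∘ π)) E := by
  rw [← Set.union_sdiff_cancel hE₀]
  refine h₀.union_of_quotient ?_
  have hpush : ∀ e ∈ E, ∃ u : ℝˣ,
      pushColumns π (edgeRow D (p ∘ π) e) = u • edgeRow D p (e.map π) := by
    intro e he
    induction e with | _ x y
    have hne : π x ≠ π y := by simpa using hdiag _ he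
    obtain ⟨u, hu⟩ := edgeRow_eq hD (p ∘ π) (x := x) (y := y) fun h => hne (by rw [h])
    obtain ⟨v, hv⟩ := edgeRow_eq hD p hne
    refine ⟨u * v⁻¹, ?_⟩
    rw [Sym2.map_mk, hv, hu, Units.smul_def, map_smul, pushColumns_barRow, smul_smul,
      inv_mul_cancel_right, Units.smul_def]
  -- Pushing columns sends the rows of E₀ into N. The remaining edges have distinct images,
  -- different from those of E₀, so their pushed rows are independent modulo N; hence the original
  -- rows are independent modulo those of E₀.
  let N := Submodule.span ℝ (edgeRow D p '' (Sym2.map π '' E₀))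
  have hker : Submodule.span ℝ (edgeRow D (p ∘ π) '' E₀) ≤
      LinearMap.ker (N.mkQ ∘ₗ pushColumns π) := by
    rw [Submodule.span_le]
    rintro _ ⟨e, he, rfl⟩
    obtain ⟨u, hu⟩ := hpush e (hE₀ he)
    rw [SetLike.mem_coe, LinearMap.mem_ker, LinearMap.comp_apply, hu, Submodule.mkQ_apply,
      Submodule.Quotient.mk_eq_zero, Units.smul_def]
    exact N.smul_mem _ (Submodule.subset_span ⟨_, ⟨e, he, rfl⟩, rfl⟩)
  refine LinearIndepOn.of_comp (Submodule.liftQ _ (N.mkQ ∘ₗ pushColumns π) hker) ?_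
  have hdisj : Disjoint (Sym2.map π '' E₀) (Sym2.map π '' (E \ E₀)) := by
    rw [Set.disjoint_left]
    rintro _ ⟨e, he, rfl⟩ ⟨f, hf, hef⟩
    exact hf.2 (hinj f hf.1 e (hE₀ he) hef fun h => hf.2 (h ▸ he))
  have himg : Sym2.map π '' E₀ ∪ Sym2.map π '' (E \ E₀) = Sym2.map π '' E := by
    rw [← Set.image_union, Set.union_sdiff_cancel hE₀]
  rw [← himg, linearIndepOn_union_iff_quotient hdisj] at hp
  have hinjOn : Set.InjOn (Sym2.map π) (E \ E₀) := by
    intro e he f hf hef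
    by_contra hne
    exact he.2 (hinj e he.1 f hf.1 hef hne)
  refine linearIndepOn_of_units_smul (hp.2.comp_of_image hinjOn) fun e he => ?_
  obtain ⟨u, hu⟩ := hpush e he.1
  refine ⟨u, ?_⟩
  simp only [Function.comp, Submodule.mkQ_apply, Submodule.liftQ_apply, LinearMap.comp_apply, hu,
    Units.smul_def, map_smul]

end Rows

theorem ncard_completeOn {W : Type*} [Fintype W] [DecidableEq W] (U : Finset W) :
    (completeOn (U : Set W)).ncard = U.card.choose 2 := by
  induction U using Finset.induction_on with
  | empty =>
    have : completeOn ((∅ : Finset W) : Set W) = ∅ := by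
      ext e
      induction e with | _ x y
      simp [mem_completeOn]
    rw [this]
    simp
  | insert z U hz ih =>
    rw [completeOn_insert z U hz, Set.ncard_union_eq (disjoint_starOn
      (notMem_endpoints_of_subset subset_rfl (by simpa using hz))), ih, ncard_starOn,
      Finset.card_insert_of_notMem hz, Nat.choose_succ_succ' U.card 1, Nat.choose_one_right,
      add_comm]

/-! ### Framework matroids -/

section Framework

variable {W : Type*} [Fintype W] [DecidableEq W] {m : ℕ}
  {D : (Fin m → ℝ) → (Fin m → ℝ) → Fin 3 → ℝ}

theorem not_genericIndep_five (hD : IsRigidityDirection D) {U : Finset W} (hU : U.card = 5) :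
    ¬ GenericIndep D (completeOn (U : Set W)) := by
  intro hind
  obtain ⟨T, hT, p, hp⟩ := hD.exists_isGenericFramework W
  -- Only the fifteen columns of U matter: extension by zero recovers the rows, so they stay
  -- independent after restriction.
  let res : (W × Fin 3 → ℝ) →ₗ[ℝ] (U × Fin 3 → ℝ) :=
    LinearMap.funLeft ℝ ℝ fun uk => (uk.1, uk.2)
  let ext : (U × Fin 3 → ℝ) →ₗ[ℝ] (W × Fin 3 → ℝ) :=
    { toFun := fun r wk => if h : wk.1 ∈ U then r (⟨wk.1, h⟩, wk.2) else 0
      map_add' := fun r s => by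
        ext wk
        by_cases h : wk.1 ∈ U <;> simp [h]
      map_smul' := fun c r => by
        ext wk
        by_cases h : wk.1 ∈ U <;> simp [h] }
  have hrow : ∀ x ∈ U, ∀ y ∈ U, ext (res (barRow D p x y)) = barRow D p x y := by
    intro x hx y hy
    ext ⟨w, k⟩
    by_cases h : w ∈ U
    · simp [ext, res, h]
    · have h1 : w ≠ x := fun h' => h (h' ▸ hx)
      have h2 : w ≠ y := fun h' => h (h' ▸ hy)
      simp [ext, h, barRow, h1, h2]
  have hrow' : ∀ e ∈ completeOn (U : Set W), ext (res (edgeRow D p e)) = edgeRow D p e := by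
    intro e he
    induction e with | _ x y
    obtain ⟨hne, hx, hy⟩ := mem_completeOn.1 he
    obtain ⟨u, hu⟩ := edgeRow_eq hD p hne
    rw [hu, Units.smul_def, map_smul, map_smul, hrow x hx y hy]
  have hR : LinearIndepOn ℝ (fun e => res (edgeRow D p e)) (completeOn (U : Set W)) := by
    refine LinearIndepOn.of_comp ext ?_
    refine (linearIndependent_equiv' (Equiv.refl _) ?_).1 (hp.linearIndepOn _ hind)
    funext e
    exact hrow' e e.2
  obtain ⟨x⟩ : Nonempty (Fin 3 ↪ U) := Function.Embedding.nonempty_of_card_le (by simp [hU])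
  have hMo : LinearIndependent ℝ fun (i : Fin 6) (uk : U × Fin 3) => T i (p uk.1) uk.2 := by
    refine LinearIndependent.of_comp (LinearMap.funLeft ℝ ℝ fun jk : Fin 3 × Fin 3 =>
      (x jk.1, jk.2)) ?_
    exact hp.motions (fun j => x j) (Subtype.val_injective.comp x.injective)
  have horth : ∀ e ∈ completeOn (U : Set W), ∀ i : Fin 6,
      res (edgeRow D p e) ⬝ᵥ (fun uk : U × Fin 3 => T i (p uk.1) uk.2) = 0 := by
    intro e he i
    induction e with | _ x y
    obtain ⟨hne, hx, hy⟩ := mem_completeOn.1 he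
    obtain ⟨u, hu⟩ := edgeRow_eq hD p hne
    rw [hu, Units.smul_def, map_smul, smul_dotProduct]
    have h1 : ∀ x (hx : x ∈ U) (d : Fin 3 → ℝ), (∑ w : U, ∑ k,
        (if (w : W) = x then d k else 0) * T i (p w) k) = ∑ k, d k * T i (p x) k := by
      intro x hx d
      rw [Finset.sum_eq_single ⟨x, hx⟩ (fun w _ hw => ?_) (by simp)]
      · simp
      · have : (w : W) ≠ x := fun h => hw (Subtype.ext h)
        simp [this]
    have h2 : res (barRow D p x y) ⬝ᵥ (fun uk : U × Fin 3 => T i (p uk.1) uk.2) = 0 := by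
      simp only [dotProduct, res, barRow, LinearMap.funLeft_apply, Fintype.sum_prod_type, sub_mul,
        Finset.sum_sub_distrib]
      rw [h1 x hx, h1 y hy, hT, sub_self]
    rw [h2, smul_zero]
  let R := Submodule.span ℝ ((fun e => res (edgeRow D p e)) '' completeOn (U : Set W))
  let S := Submodule.span ℝ (Set.range fun (i : Fin 6) (uk : U × Fin 3) => T i (p uk.1) uk.2)
  have hdisj : Disjoint R S := by
    rw [Submodule.disjoint_def]
    intro v hvR hvS
    have h1 : ∀ w ∈ S, ∀ r ∈ R, r ⬝ᵥ w = 0 := by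
      intro w hw r hr
      induction hw using Submodule.span_induction with
      | mem w hw =>
        obtain ⟨i, rfl⟩ := hw
        induction hr using Submodule.span_induction with
        | mem r hr =>
          obtain ⟨e, he, rfl⟩ := hr
          exact horth e he i
        | zero => simp
        | add r s _ _ h h' => rw [add_dotProduct, h, h', add_zero]
        | smul c r _ h => rw [smul_dotProduct, h, smul_zero]
      | zero => simp
      | add r s _ _ h h' => rw [dotProduct_add, h, h', add_zero]
      | smul c r _ h => rw [dotProduct_smul, h, smul_zero]
    exact dotProduct_self_eq_zero.1 (h1 v hvS v hvR)
  -- Ten independent rows and six independent motions orthogonal to them would need sixteen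
  -- dimensions out of fifteen.
  have hle := Submodule.finrank_add_finrank_le_of_disjoint hdisj
  have hR' : Module.finrank ℝ R = 10 := by
    have : Fintype (completeOn (U : Set W)) := Fintype.ofFinite _
    have hReq : R = Submodule.span ℝ (Set.range fun e : completeOn (U : Set W) =>
        res (edgeRow D p e)) :=
      congrArg (Submodule.span ℝ) (Set.image_eq_range _ _)
    rw [hReq, finrank_span_eq_card hR, ← Nat.card_eq_fintype_card,
      Nat.card_coe_set_eq, ncard_completeOn, hU]
    rfl
  have hS' : Module.finrank ℝ S = 6 := by
    simp only [S]
    rw [finrank_span_eq_card hMo, Fintype.card_fin]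
  rw [hR', hS', Module.finrank_fintype_fun_eq_card, Fintype.card_prod, Fintype.card_coe, hU,
    Fintype.card_fin] at hle
  omega

theorem isRigidityLike_frameworkMatroid (hD : IsRigidityDirection D) (hD' : IsPolynomialMap D) :
    IsRigidityLike (frameworkMatroid W D hD') where
  ground_eq := by
    have : (frameworkMatroid W D hD').E = {e : Sym2 W | ¬ e.IsDiag} := rfl
    rw [this]
    ext e
    simp [completeOn]
  indep_star E z T hE hzE hzT hT := by
    rw [frameworkMatroid_indep_iff] at hE ⊢
    obtain ⟨T', -, p, hp⟩ := hD.exists_isGenericFramework W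
    refine ⟨?_, p, linearIndepOn_union_star hD (hp.linearIndepOn _ hE) hE.1 hzE hzT
      (hp.star z T hzT hT)⟩
    rintro e (he | ⟨t, ht, rfl⟩)
    · exact hE.1 e he
    · have : z ≠ t := fun h => hzT (h ▸ ht)
      simpa using this
  not_indep_five U hU := by
    rw [frameworkMatroid_indep_iff]
    exact not_genericIndep_five hD hU

/-- The special case of `linearIndepOn_of_collapse` in which no two edges are identified. It carries
independence along relabelings and from the shared set of X to that of a split family. -/
theorem indep_of_collapse (hD : IsRigidityDirection D) {hD' : IsPolynomialMap D}
    {π : W → W} {E : Set (Sym2 W)} (hinj : Set.InjOn (Sym2.map π) E)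
    (h : (frameworkMatroid W D hD').Indep (Sym2.map π '' E)) :
    (frameworkMatroid W D hD').Indep E := by
  rw [frameworkMatroid_indep_iff] at h ⊢
  obtain ⟨hd, p, hp⟩ := h
  have hd' : ∀ e ∈ E, ¬ (e.map π).IsDiag := fun e he => hd _ ⟨e, he, rfl⟩
  refine ⟨fun e he hcon => ?_, p ∘ π, ?_⟩
  · induction e with | _ x y
    refine hd' _ he ?_
    rw [Sym2.map_mk]
    simp only [Sym2.mk_isDiag_iff] at hcon ⊢
    rw [hcon]
  · exact linearIndepOn_of_collapse hD (Set.empty_subset E) hd' hp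
      (fun e he f hf hef hne => absurd (hinj he hf hef) hne) (linearIndepOn_empty _ _)

/-- The rank does not change under relabeling. -/
theorem rk_image (hD : IsRigidityDirection D) {hD' : IsPolynomialMap D} {σ τ : W → W}
    {E : Set (Sym2 W)} (h : ∀ e ∈ E, ∀ x ∈ e, τ (σ x) = x) :
    rk (frameworkMatroid W D hD') (Sym2.map σ '' E) = rk (frameworkMatroid W D hD') E := by
  -- Collapsing along τ turns the relabeled basis back into the original one, so it is independent.
  -- The reverse inequality is the same statement with the roles of σ and τ exchanged.
  have key : ∀ {σ τ : W → W} {E : Set (Sym2 W)}, (∀ e ∈ E, ∀ x ∈ e, τ (σ x) = x) →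
      rk (frameworkMatroid W D hD') E ≤ rk (frameworkMatroid W D hD') (Sym2.map σ '' E) := by
    intro σ τ E h
    have hτσ : ∀ e ∈ E, (e.map σ).map τ = e := by
      intro e he
      have := h e he
      induction e with | _ x y
      rw [Sym2.map_mk, Sym2.map_mk, this x (by simp), this y (by simp)]
    obtain ⟨I, hI, -, hIE, hIc⟩ :=
      exists_basis_superset (frameworkMatroid W D hD').empty_indep (Set.empty_subset E)
    have hI' : (frameworkMatroid W D hD').Indep (Sym2.map σ '' I) := by
      refine indep_of_collapse (π := τ) hD ?_ ?_
      · rintro _ ⟨e, he, rfl⟩ _ ⟨f, hf, rfl⟩ hef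
        rw [hτσ e (hIE he), hτσ f (hIE hf)] at hef
        rw [hef]
      · rw [Set.image_image]
        convert hI
        ext e
        constructor
        · rintro ⟨f, hf, rfl⟩
          simpa only [hτσ f (hIE hf)] using hf
        · exact fun he => ⟨e, he, hτσ e (hIE he)⟩
    have hinj : Set.InjOn (Sym2.map σ) I := by
      intro e he f hf hef
      rw [← hτσ e (hIE he), ← hτσ f (hIE hf), hef]
    rw [hIc, ← hinj.ncard_image]
    exact ncard_le_rk hI' (Set.image_mono hIE)
  refine le_antisymm ?_ (key h)
  have h2 := key (σ := τ) (τ := σ) (E := Sym2.map σ '' E) (by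
    rintro _ ⟨e, he, rfl⟩ x hx
    obtain ⟨y, hy, rfl⟩ := Sym2.mem_map.1 hx
    rw [h e he y hy])
  have himg : Sym2.map τ '' (Sym2.map σ '' E) = E := by
    have hτσ : ∀ e ∈ E, (e.map σ).map τ = e := by
      intro e he
      have := h e he
      induction e with | _ x y
      rw [Sym2.map_mk, Sym2.map_mk, this x (by simp), this y (by simp)]
    ext e
    constructor
    · rintro ⟨_, ⟨f, hf, rfl⟩, rfl⟩
      rwa [hτσ f hf]
    · exact fun he => ⟨_, ⟨e, he, rfl⟩, hτσ e he⟩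
  rwa [himg] at h2

/-- Replacing the edge `xy` by a new vertex joined to `x`, `y` and two further vertices. -/
theorem indep_one_extension (hD : IsRigidityDirection D) {hD' : IsPolynomialMap D}
    {E : Set (Sym2 W)} {x y z w₁ w₂ : W}
    (hE : (frameworkMatroid W D hD').Indep (insert s(x, y) E))
    (hz : z ∉ endpoints (insert s(x, y) E)) (hxy : s(x, y) ∉ E)
    (hnd : [z, x, y, w₁, w₂].Nodup) :
    (frameworkMatroid W D hD').Indep (E ∪ starOn z {x, y, w₁, w₂}) := by
  rw [frameworkMatroid_indep_iff] at hE ⊢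
  obtain ⟨T', -, p, hp⟩ := hD.exists_isGenericFramework W
  rw [List.nodup_cons] at hnd
  have hmid := hp.mid x y w₁ w₂ hnd.2
  simp only [List.nodup_cons, List.mem_cons, List.not_mem_nil, or_false, not_or,
    List.nodup_nil, not_false_eq_true, and_true] at hnd
  obtain ⟨⟨hzx, hzy, hzw₁, hzw₂⟩, ⟨hxy', hxw₁, hxw₂⟩, ⟨hyw₁, hyw₂⟩, hw⟩ := hnd
  -- Placing z at the midpoint of x and y makes both zx and zy parallel to xy, so the row of xy is a
  -- combination of those of zx and zy. With xy still present, joining z to x, w₁, w₂ is a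
  -- 0-extension; then xy is exchanged for zy.
  let q : W → Fin m → ℝ := Function.update p z (mid (p x) (p y))
  have hq : ∀ w, w ≠ z → q w = p w := fun w hw => Function.update_of_ne hw _ _
  have hqz : q z = mid (p x) (p y) := Function.update_self _ _ _
  have hqE : LinearIndepOn ℝ (edgeRow D q) (insert s(x, y) E) := by
    refine (linearIndependent_equiv' (Equiv.refl _) ?_).1 (hp.linearIndepOn _ hE)
    funext ⟨e, he⟩
    simp only [Function.comp, Equiv.refl_apply]
    have hmem : (Quot.out e).1 ≠ z ∧ (Quot.out e).2 ≠ z := by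
      constructor <;> intro h <;> refine hz ⟨e, he, ?_⟩ <;> rw [← h]
      · exact Sym2.out_fst_mem e
      · exact Sym2.out_snd_mem e
    unfold edgeRow
    rw [hq _ hmem.1, hq _ hmem.2]
  have hstar : LinearIndepOn ℝ (fun t => D (q z) (q t)) (({x, w₁, w₂} : Finset W) : Set W) := by
    have hinj : Function.Injective ![x, w₁, w₂] := by
      intro i j hij
      fin_cases i <;> fin_cases j <;> simp_all
    have hr : (({x, w₁, w₂} : Finset W) : Set W) = ![x, w₁, w₂] '' Set.univ := by
      rw [Set.image_univ, Matrix.range_cons, Matrix.range_cons, Matrix.range_cons,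
        Matrix.range_empty]
      ext w
      simp
      tauto
    rw [hr]
    refine LinearIndepOn.image_of_comp _ _ ?_
    rw [linearIndepOn_univ_iff]
    convert hmid using 1
    funext i
    fin_cases i <;> simp [hqz, hq, Ne.symm hzx, Ne.symm hzw₁, Ne.symm hzw₂]
  have h1 := linearIndepOn_union_star hD hqE hE.1 hz
    (by simp [hzx, hzw₁, hzw₂] : z ∉ ({x, w₁, w₂} : Finset W)) hstar
  let J : Set (Sym2 W) := E ∪ starOn z {x, w₁, w₂}
  have hJ : insert s(x, y) E ∪ starOn z {x, w₁, w₂} = insert s(x, y) J := Set.insert_union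
  rw [hJ] at h1
  have hxyJ : s(x, y) ∉ J := by
    rintro (h | ⟨t, -, h⟩)
    · exact hxy h
    · rcases Sym2.eq_iff.1 h with ⟨h, -⟩ | ⟨-, h⟩
      · exact hzx h.symm
      · exact hzy h.symm
  have hE' : E ∪ starOn z {x, y, w₁, w₂} = insert s(z, y) J := by
    ext e
    simp only [J, Set.mem_union, mem_starOn, Set.mem_insert_iff, Finset.mem_insert,
      Finset.mem_singleton, exists_eq_or_imp, exists_eq_left]
    tauto
  rw [hE']
  have hJli : LinearIndepOn ℝ (edgeRow D q) J := h1.mono (Set.subset_insert _ _)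
  have hnotspan : edgeRow D q s(x, y) ∉ Submodule.span ℝ (edgeRow D q '' J) := by
    have := (linearIndepOn_insert hxyJ).1 h1
    exact this.2
  -- If the other rows spanned zy, then together with zx they would span xy, contrary to the
  -- 0-extension.
  refine ⟨?_, q, hJli.insert fun hspan => hnotspan ?_⟩
  · rintro e (rfl | he | ⟨t, ht, rfl⟩)
    · simpa using hzy
    · exact hE.1 e (Or.inr he)
    · have : z ≠ t := by
        rintro rfl
        simp [hzx, hzw₁, hzw₂] at ht
      simpa using this
  · obtain ⟨c, d, hc, hd, hmp⟩ := hD.midpoint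
    obtain ⟨u, hu⟩ := edgeRow_eq hD q hxy'
    obtain ⟨u₁, hu₁⟩ := edgeRow_eq hD q hzx
    obtain ⟨u₂, hu₂⟩ := edgeRow_eq hD q hzy
    have hb1 : barRow D q z x ∈ Submodule.span ℝ (edgeRow D q '' J) := by
      have : barRow D q z x = ((u₁⁻¹ : ℝˣ) : ℝ) • edgeRow D q s(z, x) := by
        rw [hu₁, ← Units.smul_def, inv_smul_smul]
      rw [this]
      exact Submodule.smul_mem _ _ (Submodule.subset_span ⟨_, Or.inr ⟨x, by simp, rfl⟩, rfl⟩)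
    have hb2 : barRow D q z y ∈ Submodule.span ℝ (edgeRow D q '' J) := by
      have : barRow D q z y = ((u₂⁻¹ : ℝˣ) : ℝ) • edgeRow D q s(z, y) := by
        rw [hu₂, ← Units.smul_def, inv_smul_smul]
      rw [this]
      exact Submodule.smul_mem _ _ hspan
    have hcomb : barRow D q x y = (c⁻¹ * d⁻¹) • (c • barRow D q z y - d • barRow D q z x) := by
      ext ⟨w, k⟩
      have e1 := congrFun (hmp (p x) (p y)).1 k
      have e2 := congrFun (hmp (p x) (p y)).2 k
      simp only [Pi.smul_apply, smul_eq_mul] at e1 e2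
      simp only [barRow, hqz, hq x (Ne.symm hzx), hq y (Ne.symm hzy), Pi.smul_apply, Pi.sub_apply,
        smul_eq_mul, e1, e2]
      split_ifs <;> field_simp <;> ring
    rw [hu, Units.smul_def, hcomb]
    exact Submodule.smul_mem _ _ (Submodule.smul_mem _ _ (Submodule.sub_mem _
      (Submodule.smul_mem _ _ hb2) (Submodule.smul_mem _ _ hb1)))

end Framework

/-! ### Double butterflies -/

section Stars

variable {W : Type*}

theorem endpoints_union (E F : Set (Sym2 W)) : endpoints (E ∪ F) = endpoints E ∪ endpoints F := by
  ext z
  simp only [endpoints, Set.mem_ofPred_eq, Set.mem_union]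
  constructor
  · rintro ⟨e, he | he, hz⟩
    · exact Or.inl ⟨e, he, hz⟩
    · exact Or.inr ⟨e, he, hz⟩
  · rintro (⟨e, he, hz⟩ | ⟨e, he, hz⟩)
    · exact ⟨e, Or.inl he, hz⟩
    · exact ⟨e, Or.inr he, hz⟩

theorem endpoints_empty : endpoints (∅ : Set (Sym2 W)) = ∅ := by
  ext z
  simp [endpoints]

theorem endpoints_starOn_subset (z : W) (T : Finset W) :
    endpoints (starOn z T) ⊆ insert z (T : Set W) := by
  rintro w ⟨_, ⟨t, ht, rfl⟩, hw⟩
  rcases Sym2.mem_iff.1 hw with rfl | rfl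
  · exact Or.inl rfl
  · exact Or.inr ht

theorem notMem_endpoints_union {E F : Set (Sym2 W)} {w : W} (hE : w ∉ endpoints E)
    (hF : w ∉ endpoints F) : w ∉ endpoints (E ∪ F) := by
  rw [endpoints_union]
  exact fun h => h.elim hE hF

theorem notMem_endpoints_sdiff {E F : Set (Sym2 W)} {w : W} (hE : w ∉ endpoints E) :
    w ∉ endpoints (E \ F) :=
  fun ⟨e, he, hw⟩ => hE ⟨e, he.1, hw⟩

theorem notMem_endpoints_starOn {z w : W} {T : Finset W} (h : w ≠ z) (hT : w ∉ T) :
    w ∉ endpoints (starOn z T) :=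
  fun hw => (endpoints_starOn_subset z T hw).elim h hT

theorem pair_mem_starOn {w x y : W} {T : Finset W} :
    s(x, y) ∈ starOn w T ↔ x = w ∧ y ∈ T ∨ y = w ∧ x ∈ T := by
  rw [mem_starOn]
  constructor
  · rintro ⟨t, ht, h⟩
    rcases Sym2.eq_iff.1 h with ⟨rfl, rfl⟩ | ⟨rfl, rfl⟩
    · exact Or.inl ⟨rfl, ht⟩
    · exact Or.inr ⟨rfl, ht⟩
  · rintro (⟨rfl, h⟩ | ⟨rfl, h⟩)
    · exact ⟨y, h, rfl⟩
    · exact ⟨x, h, Sym2.eq_swap⟩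

/-- The edges of the butterfly on `p, q, u, v, c`. -/
def butterflyEdges [DecidableEq W] (p q u v c : W) : Set (Sym2 W) :=
  starOn p {u, v, c} ∪ starOn q {u, v, c} ∪ starOn c {u, v}

theorem butterflyEdges_swap [DecidableEq W] (p q u v c : W) :
    butterflyEdges q p u v c = butterflyEdges p q u v c := by
  unfold butterflyEdges
  rw [Set.union_comm (starOn q _)]

theorem edgeSet_butterfly [DecidableEq W] {p q u v c : W} (h : [p, q, u, v, c].Nodup) :
    (butterfly p q u v c).edgeSet = butterflyEdges p q u v c := by
  simp only [List.nodup_cons, List.mem_cons, List.not_mem_nil, or_false, not_or,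
    List.nodup_nil, not_false_eq_true, and_true] at h
  ext e
  induction e with | _ x y
  rw [SimpleGraph.Subgraph.mem_edgeSet]
  simp only [butterfly, butterflyEdges, Set.mem_insert_iff, Set.mem_singleton_iff, ne_eq,
    Set.mem_union, pair_mem_starOn, Finset.mem_insert, Finset.mem_singleton, Sym2.eq_iff]
  constructor
  · rintro ⟨hne, hx, hy, h1, h2⟩
    rcases hx with rfl | rfl | rfl | rfl | rfl <;> rcases hy with rfl | rfl | rfl | rfl | rfl <;>
      simp_all
  · grind

end Stars

/-! ### Independence of the double butterfly with two additional gluing pairs -/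

section DoubleButterfly

variable {W : Type*} [Fintype W] [DecidableEq W] {m : ℕ}
  {D : (Fin m → ℝ) → (Fin m → ℝ) → Fin 3 → ℝ}

theorem indep_one_extension_sdiff (hD : IsRigidityDirection D) {hD' : IsPolynomialMap D}
    {E : Set (Sym2 W)} {x y z w₁ w₂ : W} (hE : (frameworkMatroid W D hD').Indep E)
    (hxy : s(x, y) ∈ E) (hz : z ∉ endpoints E) (hnd : [z, x, y, w₁, w₂].Nodup) :
    (frameworkMatroid W D hD').Indep (E \ {s(x, y)} ∪ starOn z {x, y, w₁, w₂}) := by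
  have h : insert s(x, y) (E \ {s(x, y)}) = E := by
    rw [Set.insert_sdiff_singleton, Set.insert_eq_of_mem hxy]
  exact indep_one_extension hD (by rwa [h]) (by rwa [h]) (by simp) hnd

/-- The edges of the double butterfly. -/
def doubleButterflyEdges (p₁ q₁ p₂ q₂ u v c₁ c₂ : W) : Set (Sym2 W) :=
  butterflyEdges p₁ q₁ u v c₁ ∪ butterflyEdges p₂ q₂ u v c₂

/-- 0-extensions suffice: starting from the edge p₁q₁, the vertices c₁, u, v complete the first wing
to K₅ minus uv; then p₂ is joined to u, v, p₁, and c₂, q₂ follow. -/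
theorem indep_doubleButterfly_wing {M : Matroid (Sym2 W)} (hM : IsRigidityLike M)
    {p₁ q₁ p₂ q₂ u v c₁ c₂ : W} (hnd : [p₁, q₁, p₂, q₂, u, v, c₁, c₂].Nodup) :
    M.Indep (doubleButterflyEdges p₁ q₁ p₂ q₂ u v c₁ c₂ ∪ {s(p₁, p₂), s(p₁, q₁)}) := by
  simp only [List.nodup_cons, List.mem_cons, List.not_mem_nil, or_false, not_or,
    List.nodup_nil, not_false_eq_true, and_true] at hnd
  have h1 := hM.indep_star ∅ p₁ {q₁} M.empty_indep (by simp [endpoints_empty]) (by grind) (by simp)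
  have h2 := hM.indep_star _ c₁ {p₁, q₁} h1
    (by
      (repeat' first
        | apply notMem_endpoints_union
        | apply notMem_endpoints_sdiff
        | apply notMem_endpoints_starOn) <;> first | grind | simp [endpoints_empty])
    (by grind) (by grind)
  have h3 := hM.indep_star _ u {p₁, q₁, c₁} h2
    (by
      (repeat' first
        | apply notMem_endpoints_union
        | apply notMem_endpoints_sdiff
        | apply notMem_endpoints_starOn) <;> first | grind | simp [endpoints_empty])
    (by grind) (by grind)
  have h4 := hM.indep_star _ v {p₁, q₁, c₁} h3
    (by
      (repeat' first
        | apply notMem_endpoints_union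
        | apply notMem_endpoints_sdiff
        | apply notMem_endpoints_starOn) <;> first | grind | simp [endpoints_empty])
    (by grind) (by grind)
  have h5 := hM.indep_star _ p₂ {u, v, p₁} h4
    (by
      (repeat' first
        | apply notMem_endpoints_union
        | apply notMem_endpoints_sdiff
        | apply notMem_endpoints_starOn) <;> first | grind | simp [endpoints_empty])
    (by grind) (by grind)
  have h6 := hM.indep_star _ c₂ {p₂, u, v} h5
    (by
      (repeat' first
        | apply notMem_endpoints_union
        | apply notMem_endpoints_sdiff
        | apply notMem_endpoints_starOn) <;> first | grind | simp [endpoints_empty])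
    (by grind) (by grind)
  have h7 := hM.indep_star _ q₂ {u, v, c₂} h6
    (by
      (repeat' first
        | apply notMem_endpoints_union
        | apply notMem_endpoints_sdiff
        | apply notMem_endpoints_starOn) <;> first | grind | simp [endpoints_empty])
    (by grind) (by grind)
  refine h7.subset fun e he => ?_
  induction e with | _ x y
  simp only [doubleButterflyEdges, butterflyEdges, Set.mem_union, pair_mem_starOn,
    Finset.mem_insert, Finset.mem_singleton, Set.mem_insert_iff, Set.mem_singleton_iff,
    Sym2.eq_iff] at he ⊢
  grind

/-- Join u and v to the triangle q₁q₂p₂. Then p₁, c₁, c₂ arrive by 1-extensions on the edges q₁p₂,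
p₁q₁, p₂q₂, each of which uses up an edge that must not remain. -/
theorem indep_doubleButterfly_matching (hD : IsRigidityDirection D) {hD' : IsPolynomialMap D}
    {p₁ q₁ p₂ q₂ u v c₁ c₂ : W} (hnd : [p₁, q₁, p₂, q₂, u, v, c₁, c₂].Nodup) :
    (frameworkMatroid W D hD').Indep
      (doubleButterflyEdges p₁ q₁ p₂ q₂ u v c₁ c₂ ∪ {s(p₁, p₂), s(q₁, q₂)}) := by
  have hM := isRigidityLike_frameworkMatroid (W := W) hD hD'
  simp only [List.nodup_cons, List.mem_cons, List.not_mem_nil, or_false, not_or,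
    List.nodup_nil, not_false_eq_true, and_true] at hnd
  have h1 := hM.indep_star ∅ q₁ {p₂} (Matroid.empty_indep _) (by simp [endpoints_empty])
    (by grind) (by simp)
  have h2 := hM.indep_star _ q₂ {q₁, p₂} h1
    (by
      (repeat' first
        | apply notMem_endpoints_union
        | apply notMem_endpoints_sdiff
        | apply notMem_endpoints_starOn) <;> first | grind | simp [endpoints_empty])
    (by grind) (by grind)
  have h3 := hM.indep_star _ u {q₁, q₂, p₂} h2
    (by
      (repeat' first
        | apply notMem_endpoints_union
        | apply notMem_endpoints_sdiff
        | apply notMem_endpoints_starOn) <;> first | grind | simp [endpoints_empty])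
    (by grind) (by grind)
  have h4 := hM.indep_star _ v {q₁, q₂, p₂} h3
    (by
      (repeat' first
        | apply notMem_endpoints_union
        | apply notMem_endpoints_sdiff
        | apply notMem_endpoints_starOn) <;> first | grind | simp [endpoints_empty])
    (by grind) (by grind)
  have h5 := indep_one_extension_sdiff hD (x := q₁) (y := p₂) (z := p₁) (w₁ := u) (w₂ := v) h4
    (by simp [pair_mem_starOn])
    (by
      (repeat' first
        | apply notMem_endpoints_union
        | apply notMem_endpoints_sdiff
        | apply notMem_endpoints_starOn) <;> first | grind | simp [endpoints_empty])
    (by simp; grind)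
  have h6 := indep_one_extension_sdiff hD (x := p₁) (y := q₁) (z := c₁) (w₁ := u) (w₂ := v) h5
    (by simp [pair_mem_starOn])
    (by
      (repeat' first
        | apply notMem_endpoints_union
        | apply notMem_endpoints_sdiff
        | apply notMem_endpoints_starOn) <;> first | grind | simp [endpoints_empty])
    (by simp; grind)
  have h7 := indep_one_extension_sdiff hD (x := p₂) (y := q₂) (z := c₂) (w₁ := u) (w₂ := v) h6
    (by
      simp only [Set.mem_union, Set.mem_sdiff, pair_mem_starOn, Set.mem_singleton_iff,
        Finset.mem_insert, Finset.mem_singleton, Sym2.eq_iff]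
      grind)
    (by
      (repeat' first
        | apply notMem_endpoints_union
        | apply notMem_endpoints_sdiff
        | apply notMem_endpoints_starOn) <;> first | grind | simp [endpoints_empty])
    (by simp; grind)
  refine h7.subset fun e he => ?_
  induction e with | _ x y
  simp only [doubleButterflyEdges, butterflyEdges, Set.mem_union, pair_mem_starOn,
    Finset.mem_insert, Finset.mem_singleton, Set.mem_insert_iff, Set.mem_singleton_iff,
    Sym2.eq_iff, Set.mem_sdiff] at he ⊢
  grind

/-- Join u and v to the triangle p₁p₂q₂. A 1-extension by c₂ removes the unwanted edge p₂q₂, and c₁,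
q₁ are added by 0-extensions. -/
theorem indep_doubleButterfly_path (hD : IsRigidityDirection D) {hD' : IsPolynomialMap D}
    {p₁ q₁ p₂ q₂ u v c₁ c₂ : W} (hnd : [p₁, q₁, p₂, q₂, u, v, c₁, c₂].Nodup) :
    (frameworkMatroid W D hD').Indep
      (doubleButterflyEdges p₁ q₁ p₂ q₂ u v c₁ c₂ ∪ {s(p₁, p₂), s(p₁, q₂)}) := by
  have hM := isRigidityLike_frameworkMatroid (W := W) hD hD'
  simp only [List.nodup_cons, List.mem_cons, List.not_mem_nil, or_false, not_or,
    List.nodup_nil, not_false_eq_true, and_true] at hnd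
  have h1 := hM.indep_star ∅ p₂ {q₂} (Matroid.empty_indep _) (by simp [endpoints_empty])
    (by grind) (by simp)
  have h2 := hM.indep_star _ p₁ {p₂, q₂} h1
    (by
      (repeat' first
        | apply notMem_endpoints_union
        | apply notMem_endpoints_sdiff
        | apply notMem_endpoints_starOn) <;> first | grind | simp [endpoints_empty])
    (by grind) (by grind)
  have h3 := hM.indep_star _ u {p₁, p₂, q₂} h2
    (by
      (repeat' first
        | apply notMem_endpoints_union
        | apply notMem_endpoints_sdiff
        | apply notMem_endpoints_starOn) <;> first | grind | simp [endpoints_empty])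
    (by grind) (by grind)
  have h4 := hM.indep_star _ v {p₁, p₂, q₂} h3
    (by
      (repeat' first
        | apply notMem_endpoints_union
        | apply notMem_endpoints_sdiff
        | apply notMem_endpoints_starOn) <;> first | grind | simp [endpoints_empty])
    (by grind) (by grind)
  have h5 := indep_one_extension_sdiff hD (x := p₂) (y := q₂) (z := c₂) (w₁ := u) (w₂ := v) h4
    (by simp [pair_mem_starOn])
    (by
      (repeat' first
        | apply notMem_endpoints_union
        | apply notMem_endpoints_sdiff
        | apply notMem_endpoints_starOn) <;> first | grind | simp [endpoints_empty])
    (by simp; grind)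
  have h6 := hM.indep_star _ c₁ {p₁, u, v} h5
    (by
      (repeat' first
        | apply notMem_endpoints_union
        | apply notMem_endpoints_sdiff
        | apply notMem_endpoints_starOn) <;> first | grind | simp [endpoints_empty])
    (by grind) (by grind)
  have h7 := hM.indep_star _ q₁ {u, v, c₁} h6
    (by
      (repeat' first
        | apply notMem_endpoints_union
        | apply notMem_endpoints_sdiff
        | apply notMem_endpoints_starOn) <;> first | grind | simp [endpoints_empty])
    (by grind) (by grind)
  refine h7.subset fun e he => ?_
  induction e with | _ x y
  simp only [doubleButterflyEdges, butterflyEdges, Set.mem_union, pair_mem_starOn,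
    Finset.mem_insert, Finset.mem_singleton, Set.mem_insert_iff, Set.mem_singleton_iff,
    Sym2.eq_iff, Set.mem_sdiff] at he ⊢
  grind

theorem doubleButterflyEdges_comm (p₁ q₁ p₂ q₂ u v c₁ c₂ : W) :
    doubleButterflyEdges p₂ q₂ p₁ q₁ u v c₂ c₁ = doubleButterflyEdges p₁ q₁ p₂ q₂ u v c₁ c₂ :=
  Set.union_comm _ _

theorem doubleButterflyEdges_swap_left (p₁ q₁ p₂ q₂ u v c₁ c₂ : W) :
    doubleButterflyEdges q₁ p₁ p₂ q₂ u v c₁ c₂ = doubleButterflyEdges p₁ q₁ p₂ q₂ u v c₁ c₂ := by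
  rw [doubleButterflyEdges, butterflyEdges_swap]
  rfl

theorem doubleButterflyEdges_swap_right (p₁ q₁ p₂ q₂ u v c₁ c₂ : W) :
    doubleButterflyEdges p₁ q₁ q₂ p₂ u v c₁ c₂ = doubleButterflyEdges p₁ q₁ p₂ q₂ u v c₁ c₂ := by
  rw [doubleButterflyEdges, butterflyEdges_swap p₂]
  rfl

/-- Relative to p₁p₂, a second pair completes a wing, shares one endpoint with p₁p₂ across the
wings, or is the disjoint cross pair q₁q₂. Exchanging the wings reduces these five pairs to three
constructions. -/
theorem indep_doubleButterfly_cross (hD : IsRigidityDirection D) {hD' : IsPolynomialMap D}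
    {p₁ q₁ p₂ q₂ u v c₁ c₂ : W} (hnd : [p₁, q₁, p₂, q₂, u, v, c₁, c₂].Nodup) {f : Sym2 W}
    (hf : f ∈ allPairs {p₁, q₁, p₂, q₂}) (hne : f ≠ s(p₁, p₂)) :
    (frameworkMatroid W D hD').Indep
      (doubleButterflyEdges p₁ q₁ p₂ q₂ u v c₁ c₂ ∪ {s(p₁, p₂), f}) := by
  have hM := isRigidityLike_frameworkMatroid (W := W) hD hD'
  have hnd' : [p₂, q₂, p₁, q₁, u, v, c₂, c₁].Nodup := by
    simp only [List.nodup_cons, List.mem_cons, List.not_mem_nil, or_false, not_or,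
      List.nodup_nil, not_false_eq_true, and_true] at hnd ⊢
    grind
  have h1 := indep_doubleButterfly_wing hM hnd
  have h2 := indep_doubleButterfly_wing hM hnd'
  have h3 := indep_doubleButterfly_path hD (hD' := hD') hnd
  have h4 := indep_doubleButterfly_path hD (hD' := hD') hnd'
  have h5 := indep_doubleButterfly_matching hD (hD' := hD') hnd
  rw [doubleButterflyEdges_comm, Sym2.eq_swap (a := p₂) (b := p₁)] at h2 h4
  rw [Sym2.eq_swap (a := p₂) (b := q₁)] at h4
  have hcases : f = s(p₁, q₁) ∨ f = s(p₂, q₂) ∨ f = s(p₁, q₂) ∨ f = s(q₁, p₂) ∨ f = s(q₁, q₂) := by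
    induction f with | _ x y
    simp only [allPairs, Set.mem_ofPred_eq, Sym2.mk_isDiag_iff, Sym2.mem_iff, forall_eq_or_imp,
      forall_eq, Finset.mem_insert, Finset.mem_singleton] at hf
    simp only [ne_eq, Sym2.eq_iff] at hne ⊢
    grind
  rcases hcases with rfl | rfl | rfl | rfl | rfl <;> assumption

/-- Two further edges between the gluing vertices of a double butterfly are independent of it unless
they are the two missing edges of the butterflies. -/
theorem indep_doubleButterfly_union_pair (hD : IsRigidityDirection D) {hD' : IsPolynomialMap D}
    {p₁ q₁ p₂ q₂ u v c₁ c₂ : W} (hnd : [p₁, q₁, p₂, q₂, u, v, c₁, c₂].Nodup) {f g : Sym2 W}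
    (hf : f ∈ allPairs {p₁, q₁, p₂, q₂}) (hg : g ∈ allPairs {p₁, q₁, p₂, q₂}) (hfg : f ≠ g)
    (hex : f ≠ s(p₁, q₁) ∧ f ≠ s(p₂, q₂)) :
    (frameworkMatroid W D hD').Indep
      (doubleButterflyEdges p₁ q₁ p₂ q₂ u v c₁ c₂ ∪ {f, g}) := by
  have hndL : [q₁, p₁, p₂, q₂, u, v, c₁, c₂].Nodup := by
    simp only [List.nodup_cons, List.mem_cons, List.not_mem_nil, or_false, not_or,
      List.nodup_nil, not_false_eq_true, and_true] at hnd ⊢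
    grind
  have hndR : [p₁, q₁, q₂, p₂, u, v, c₁, c₂].Nodup := by
    simp only [List.nodup_cons, List.mem_cons, List.not_mem_nil, or_false, not_or,
      List.nodup_nil, not_false_eq_true, and_true] at hnd ⊢
    grind
  have hndLR : [q₁, p₁, q₂, p₂, u, v, c₁, c₂].Nodup := by
    simp only [List.nodup_cons, List.mem_cons, List.not_mem_nil, or_false, not_or,
      List.nodup_nil, not_false_eq_true, and_true] at hnd ⊢
    grind
  -- A pair other than the missing edges joins the two wings, and swapping pᵢ with qᵢ moves it to
  -- p₁p₂.
  have hcases : f = s(p₁, p₂) ∨ f = s(p₁, q₂) ∨ f = s(q₁, p₂) ∨ f = s(q₁, q₂) := by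
    induction f with | _ x y
    simp only [allPairs, Set.mem_ofPred_eq, Sym2.mk_isDiag_iff, Sym2.mem_iff, forall_eq_or_imp,
      forall_eq, Finset.mem_insert, Finset.mem_singleton] at hf
    simp only [ne_eq, Sym2.eq_iff] at hex ⊢
    grind
  rcases hcases with rfl | rfl | rfl | rfl
  · exact indep_doubleButterfly_cross hD hnd hg hfg.symm
  · have h := indep_doubleButterfly_cross hD (hD' := hD') hndR (f := g)
      (by convert hg using 2; grind) hfg.symm
    rwa [doubleButterflyEdges_swap_right] at h
  · have h := indep_doubleButterfly_cross hD (hD' := hD') hndL (f := g)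
      (by convert hg using 2; grind) hfg.symm
    rwa [doubleButterflyEdges_swap_left] at h
  · have h := indep_doubleButterfly_cross hD (hD' := hD') hndLR (f := g)
      (by convert hg using 2; grind) hfg.symm
    rwa [doubleButterflyEdges_swap_left, doubleButterflyEdges_swap_right] at h

theorem edgeSet_doubleButterfly {p₁ q₁ p₂ q₂ u v c₁ c₂ : W}
    (hnd : [p₁, q₁, p₂, q₂, u, v, c₁, c₂].Nodup) :
    (butterfly p₁ q₁ u v c₁ ⊔ butterfly p₂ q₂ u v c₂).edgeSet =
      doubleButterflyEdges p₁ q₁ p₂ q₂ u v c₁ c₂ := by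
  rw [SimpleGraph.Subgraph.edgeSet_sup, edgeSet_butterfly, edgeSet_butterfly, doubleButterflyEdges]
  all_goals
    simp only [List.nodup_cons, List.mem_cons, List.not_mem_nil, or_false, not_or,
      List.nodup_nil, not_false_eq_true, and_true] at hnd ⊢
    grind

theorem notMem_doubleButterflyEdges {p₁ q₁ p₂ q₂ u v c₁ c₂ : W}
    (hnd : [p₁, q₁, p₂, q₂, u, v, c₁, c₂].Nodup) {f : Sym2 W}
    (hf : f ∈ allPairs {p₁, q₁, p₂, q₂}) :
    f ∉ doubleButterflyEdges p₁ q₁ p₂ q₂ u v c₁ c₂ := by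
  simp only [List.nodup_cons, List.mem_cons, List.not_mem_nil, or_false, not_or,
    List.nodup_nil, not_false_eq_true, and_true] at hnd
  induction f with | _ x y
  simp only [allPairs, Set.mem_ofPred_eq, Sym2.mk_isDiag_iff, Sym2.mem_iff, forall_eq_or_imp,
    forall_eq, Finset.mem_insert, Finset.mem_singleton] at hf
  simp only [doubleButterflyEdges, butterflyEdges, Set.mem_union, pair_mem_starOn,
    Finset.mem_insert, Finset.mem_singleton]
  rcases hf with ⟨-, rfl | rfl | rfl | rfl, rfl | rfl | rfl | rfl⟩ <;> grind

theorem mem_keyPairs {Γ : Finset W} {X : Finset (Finset W)} {e : Sym2 W} :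
    e ∈ keyPairs Γ X ↔ e ∈ allPairs Γ ∧ ∃ A ∈ X, ∀ x ∈ e, x ∈ A := by
  simp [keyPairs]

/-- If a safe ear on a double butterfly has two key gluing pairs, then they are the two missing edges
of the butterflies. -/
theorem keyPairs_doubleButterfly (hD : IsRigidityDirection D) {hD' : IsPolynomialMap D}
    {p₁ q₁ p₂ q₂ u v c₁ c₂ : W} (hnd : [p₁, q₁, p₂, q₂, u, v, c₁, c₂].Nodup)
    {H : VGraph W} (hH : H.edgeSet = doubleButterflyEdges p₁ q₁ p₂ q₂ u v c₁ c₂)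
    {Y : Finset (Finset W)}
    (hY : IsSafeEarCover (frameworkMatroid W D hD') H {p₁, q₁, p₂, q₂} Y) {f g : Sym2 W}
    (hf : f ∈ keyPairs {p₁, q₁, p₂, q₂} Y) (hg : g ∈ keyPairs {p₁, q₁, p₂, q₂} Y) (hfg : f ≠ g) :
    f = s(p₁, q₁) ∨ f = s(p₂, q₂) := by
  by_contra hex
  rw [not_or] at hex
  have hf' := (mem_keyPairs.1 hf).1
  have hg' := (mem_keyPairs.1 hg).1
  have h1 := indep_doubleButterfly_union_pair hD (hD' := hD') hnd hf' hg' hfg hex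
  have hHi : (frameworkMatroid W D hD').Indep H.edgeSet := by
    rw [hH]
    exact h1.subset Set.subset_union_left
  have hP : (frameworkMatroid W D hD').Indep
      ((sharedSet Y ∪ keyPairs {p₁, q₁, p₂, q₂} Y : Finset (Sym2 W)) : Set (Sym2 W)) := by
    refine hY.indep_union.subset ?_
    rw [Finset.coe_union]
    exact Set.union_subset_union_right _ fun e he => (mem_keyPairs.1 he).1
  -- The count with the key pairs bounds the rank of H together with all key pairs. For a safe ear
  -- this bound is |H| + 1, whereas H with f and g is independent of size |H| + 2.
  have h2 := rk_le_ieCountWith H Y _ hP (by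
    rintro e (he | he)
    · induction e with | _ x y
      obtain ⟨A, hA, hx, hy⟩ := hY.twoThin.covers x y he
      exact ⟨A, hA, by simp [hx, hy]⟩
    · rcases Finset.mem_union.1 he with he | he
      · obtain ⟨A, hA, B, hB, -, x, y, hxy, hAB, rfl⟩ := mem_sharedSet.1 he
        have hx : x ∈ A ∩ B := by simp [hAB]
        have hy : y ∈ A ∩ B := by simp [hAB]
        rw [Finset.mem_inter] at hx hy
        exact ⟨A, hA, by simp [hx.1, hy.1]⟩
      · exact (mem_keyPairs.1 he).2) hHi.subset_ground
  have h3 := hY.rank_eq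
  rw [indep_iff_rk.1 hHi] at h3
  have h4 : ((H.edgeSet ∪ {f, g}).ncard : ℤ) ≤ _ := (ncard_le_rk (by rwa [hH]) (by
    refine Set.union_subset_union_right _ (Set.insert_subset ?_ (Set.singleton_subset_iff.2 ?_))
    · exact Finset.mem_union_right _ hf
    · exact Finset.mem_union_right _ hg)).trans h2
  rw [Set.ncard_union_eq, Set.ncard_pair hfg] at h4
  · push_cast at h4
    linarith
  · rw [hH, Set.disjoint_right]
    rintro e (rfl | rfl)
    · exact notMem_doubleButterflyEdges hnd hf'
    · exact notMem_doubleButterflyEdges hnd hg'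

end DoubleButterfly

/-! ### The clusters of a safe split -/

section Split

variable {W : Type*}

/-- The new vertex that replaces `x` on the edge `xy` of `G`. -/
def copyOf [DecidableEq W] (a b : W) (α β : W → Fin 2) (a' b' : Fin 2 → W) (x y : W) : W :=
  if x = a then a' (α y) else if x = b then b' (β y) else x

open Classical in
/-- The map that sends the vertices of the cluster `A` to the vertices replacing them, if the
cluster keeps a single copy of `a` and of `b`. -/
noncomputable def relabel (G : VGraph W) (a b : W) (α β : W → Fin 2) (a' b' : Fin 2 → W)
    (A : Finset W) (w : W) : W :=
  if w = a then a' (if 0 ∈ copies G a α A then 0 else 1)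
  else if w = b then b' (if 0 ∈ copies G b β A then 0 else 1)
  else w

variable [Fintype W] [DecidableEq W]

/-- A safe nonedge-split together with a map `π` sending the new vertices to the vertices they come
from. -/
structure SplitData (G : VGraph W) (X : Finset (Finset W)) (a b : W) (α β : W → Fin 2)
    (a' b' : Fin 2 → W) (π : W → W) : Prop where
  thin : IsTwoThinCover G X
  safe : IsSafeNonedgeSplit G X a b α β
  new : AreNewVertices G a' b'
  map_left : ∀ i, π (a' i) = a
  map_right : ∀ i, π (b' i) = b
  map_old : ∀ w ∈ G.verts, w ≠ a → w ≠ b → π w = w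

namespace SplitData

variable {G : VGraph W} {X : Finset (Finset W)} {a b : W} {α β : W → Fin 2} {a' b' : Fin 2 → W}
  {π : W → W} {A B : Finset W}

theorem ne (h : SplitData G X a b α β a' b' π) : a ≠ b := ne_of_mem_sharedSet h.safe.mem_shared

theorem exists_two (hs : s(a, b) ∈ sharedSet X) :
    ∃ A ∈ X, ∃ B ∈ X, A ≠ B ∧ (a ∈ A ∧ b ∈ A) ∧ a ∈ B ∧ b ∈ B := by
  obtain ⟨A, hA, B, hB, hne, hAB⟩ := (pair_mem_sharedSet (ne_of_mem_sharedSet hs)).1 hs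
  have h1 : a ∈ A ∩ B ∧ b ∈ A ∩ B := by simp [hAB]
  simp only [Finset.mem_inter] at h1
  exact ⟨A, hA, B, hB, hne, ⟨h1.1.1, h1.2.1⟩, h1.1.2, h1.2.2⟩

theorem left_mem (h : SplitData G X a b α β a' b' π) : a ∈ G.verts := by
  obtain ⟨A, hA, -, -, -, h1, -⟩ := exists_two h.safe.mem_shared
  exact h.thin.subset_verts A hA h1.1

theorem right_mem (h : SplitData G X a b α β a' b' π) : b ∈ G.verts := by
  obtain ⟨A, hA, -, -, -, h1, -⟩ := exists_two h.safe.mem_shared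
  exact h.thin.subset_verts A hA h1.2

/-- The partition functions recover an edge of the split graph from its image in G. With
`adj_copyOf` this makes the two edge sets correspond bijectively. -/
theorem adj_map (h : SplitData G X a b α β a' b' π) {x y : W}
    (hxy : (splitGraph G a b α β a' b').Adj x y) :
    G.Adj (π x) (π y) ∧ x = copyOf a b α β a' b' (π x) (π y) ∧
      y = copyOf a b α β a' b' (π y) (π x) := by
  have hcopy : ∀ {x y : W}, IsCopyEdge G a b α β a' b' x y → G.Adj (π x) (π y) ∧
      x = copyOf a b α β a' b' (π x) (π y) ∧ y = copyOf a b α β a' b' (π y) (π x) := by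
    rintro x y ⟨hya, hyb, ⟨hadj, rfl⟩ | ⟨hadj, rfl⟩⟩
    · rw [h.map_left, h.map_old y (G.edge_vert hadj.symm) hya hyb]
      simp [copyOf, hadj, hya, hyb]
    · rw [h.map_right, h.map_old y (G.edge_vert hadj.symm) hya hyb]
      simp [copyOf, hadj, hya, hyb, h.ne.symm]
  obtain ⟨-, ⟨hadj, hxa, hxb, hya, hyb⟩ | hc | hc⟩ := hxy
  · rw [h.map_old x (G.edge_vert hadj) hxa hxb, h.map_old y (G.edge_vert hadj.symm) hya hyb]
    simp [copyOf, hadj, hxa, hxb, hya, hyb]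
  · exact hcopy hc
  · obtain ⟨h1, h2, h3⟩ := hcopy hc
    exact ⟨h1.symm, h3, h2⟩

theorem adj_copyOf (h : SplitData G X a b α β a' b' π) {x y : W} (hxy : G.Adj x y) :
    (splitGraph G a b α β a' b').Adj (copyOf a b α β a' b' x y) (copyOf a b α β a' b' y x) := by
  have hab := h.safe.nonedge
  have hba : ¬ G.Adj b a := fun h' => hab h'.symm
  have hx := G.edge_vert hxy
  have hy := G.edge_vert hxy.symm
  have hne := hxy.ne
  have hL : ∀ i, ∀ w ∈ G.verts, a' i ≠ w := fun i w hw h' => h.new.left_notMem i (h' ▸ hw)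
  have hR : ∀ i, ∀ w ∈ G.verts, b' i ≠ w := fun i w hw h' => h.new.right_notMem i (h' ▸ hw)
  by_cases hxa : x = a
  · subst hxa
    have hyb : y ≠ b := fun h' => hab (h' ▸ hxy)
    simp only [copyOf, if_true, if_neg hne.symm, if_neg hyb]
    exact ⟨hL _ y hy, Or.inr (Or.inl ⟨hne.symm, hyb, Or.inl ⟨hxy, rfl⟩⟩)⟩
  by_cases hxb : x = b
  · subst hxb
    have hya : y ≠ a := fun h' => hba (h' ▸ hxy)
    simp only [copyOf, if_true, if_neg hne.symm, if_neg hya, if_neg hxa]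
    exact ⟨hR _ y hy, Or.inr (Or.inl ⟨hya, hne.symm, Or.inr ⟨hxy, rfl⟩⟩)⟩
  simp only [copyOf, if_neg hxa, if_neg hxb]
  split_ifs with hya hyb
  · subst hya
    exact ⟨(hL _ x hx).symm, Or.inr (Or.inr ⟨hxa, hxb, Or.inl ⟨hxy.symm, rfl⟩⟩)⟩
  · subst hyb
    exact ⟨(hR _ x hx).symm, Or.inr (Or.inr ⟨hxa, hxb, Or.inr ⟨hxy.symm, rfl⟩⟩)⟩
  · exact ⟨hne, Or.inl ⟨hxy, hxa, hxb, hya, hyb⟩⟩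

omit [Fintype W] [DecidableEq W] in
theorem copies_eq_singleton {G : VGraph W} {c : W} {γ : W → Fin 2} {A : Finset W}
    (hne : (copies G c γ A).Nonempty)
    (hnb : ¬ (0 ∈ copies G c γ A ∧ 1 ∈ copies G c γ A)) [Decidable (0 ∈ copies G c γ A)] :
    copies G c γ A = {if 0 ∈ copies G c γ A then 0 else 1} := by
  obtain ⟨i, hi⟩ := hne
  ext j
  rw [Set.mem_singleton_iff]
  split_ifs with h0 <;> fin_cases i <;> fin_cases j <;> simp_all

theorem left_copies (h : SplitData G X a b α β a' b' π) (hA : A ∈ X)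
    (hN : HasSharedNonedge G X A) (ha : a ∈ A) [Decidable (0 ∈ copies G a α A)] :
    copies G a α A = {if 0 ∈ copies G a α A then 0 else 1} :=
  copies_eq_singleton (h.safe.safe_left.nonempty A hA hN ha) (h.safe.safe_left.not_both A hA hN)

theorem right_copies (h : SplitData G X a b α β a' b' π) (hA : A ∈ X)
    (hN : HasSharedNonedge G X A) (hb : b ∈ A) [Decidable (0 ∈ copies G b β A)] :
    copies G b β A = {if 0 ∈ copies G b β A then 0 else 1} :=
  copies_eq_singleton (h.safe.safe_right.nonempty A hA hN hb) (h.safe.safe_right.not_both A hA hN)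

theorem relabel_left (A : Finset W) : ∃ i, relabel G a b α β a' b' A a = a' i := by
  simp [relabel]

theorem relabel_right (h : SplitData G X a b α β a' b' π) (A : Finset W) :
    ∃ i, relabel G a b α β a' b' A b = b' i := by
  simp [relabel, h.ne.symm]

theorem relabel_old {w : W} (ha : w ≠ a) (hb : w ≠ b) : relabel G a b α β a' b' A w = w := by
  simp [relabel, ha, hb]

/-- Condition (i) of safety leaves exactly one copy of each of a, b in such a cluster. So splitting
it is a relabeling with inverse π, along which cardinalities, intersections and adjacencies are
transported. -/
theorem splitCluster_eq (h : SplitData G X a b α β a' b' π) (hA : A ∈ X)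
    (hN : HasSharedNonedge G X A) :
    splitCluster G a b α β a' b' A = A.image (relabel G a b α β a' b' A) := by
  classical
  ext x
  simp only [splitCluster, Finset.mem_union, Finset.mem_sdiff, Finset.mem_insert,
    Finset.mem_singleton, not_or, Finset.mem_image, Finset.mem_filter, Finset.mem_univ, true_and]
  constructor
  · rintro ((⟨hx, hxa, hxb⟩ | ⟨i, hi, rfl⟩) | ⟨i, hi, rfl⟩)
    · exact ⟨x, hx, relabel_old hxa hxb⟩
    · have ha : a ∈ A := hi.1
      rw [h.left_copies hA hN ha, Set.mem_singleton_iff] at hi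
      exact ⟨a, ha, by simp [relabel, hi]⟩
    · have hb : b ∈ A := hi.1
      rw [h.right_copies hA hN hb, Set.mem_singleton_iff] at hi
      exact ⟨b, hb, by simp [relabel, hi, h.ne.symm]⟩
  · rintro ⟨w, hw, rfl⟩
    by_cases hwa : w = a
    · subst hwa
      refine Or.inl (Or.inr ⟨if 0 ∈ copies G w α A then 0 else 1, ?_, by simp [relabel]⟩)
      rw [h.left_copies hA hN hw]
      simp
    by_cases hwb : w = b
    · subst hwb
      refine Or.inr ⟨if 0 ∈ copies G w β A then 0 else 1, ?_, by simp [relabel, hwa]⟩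
      rw [h.right_copies hA hN hw]
      simp
    rw [relabel_old hwa hwb]
    exact Or.inl (Or.inl ⟨hw, hwa, hwb⟩)

theorem map_relabel (h : SplitData G X a b α β a' b' π) (hA : A ∈ X) {w : W} (hw : w ∈ A) :
    π (relabel G a b α β a' b' A w) = w := by
  by_cases hwa : w = a
  · subst hwa
    obtain ⟨i, hi⟩ := relabel_left (G := G) (a := w) (b := b) (α := α) (β := β) (a' := a')
      (b' := b') A
    rw [hi, h.map_left]
  by_cases hwb : w = b
  · subst hwb
    obtain ⟨i, hi⟩ := h.relabel_right A
    rw [hi, h.map_right]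
  rw [relabel_old hwa hwb, h.map_old w (h.thin.subset_verts A hA hw) hwa hwb]

theorem mem_splitCluster (h : SplitData G X a b α β a' b' π) (hA : A ∈ X)
    (hN : HasSharedNonedge G X A) {x : W} (hx : x ∈ splitCluster G a b α β a' b' A) :
    π x ∈ A ∧ relabel G a b α β a' b' A (π x) = x := by
  rw [h.splitCluster_eq hA hN] at hx
  obtain ⟨w, hw, rfl⟩ := Finset.mem_image.1 hx
  rw [h.map_relabel hA hw]
  exact ⟨hw, rfl⟩

theorem relabel_mem (h : SplitData G X a b α β a' b' π) (hA : A ∈ X)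
    (hN : HasSharedNonedge G X A) {w : W} (hw : w ∈ A) :
    relabel G a b α β a' b' A w ∈ splitCluster G a b α β a' b' A := by
  rw [h.splitCluster_eq hA hN]
  exact Finset.mem_image_of_mem _ hw

theorem injOn_splitCluster (h : SplitData G X a b α β a' b' π) (hA : A ∈ X)
    (hN : HasSharedNonedge G X A) :
    Set.InjOn π (splitCluster G a b α β a' b' A : Set W) := by
  intro x hx y hy hxy
  rw [← (h.mem_splitCluster hA hN hx).2, ← (h.mem_splitCluster hA hN hy).2, hxy]

theorem card_splitCluster (h : SplitData G X a b α β a' b' π) (hA : A ∈ X)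
    (hN : HasSharedNonedge G X A) : (splitCluster G a b α β a' b' A).card = A.card := by
  rw [h.splitCluster_eq hA hN]
  refine Finset.card_image_of_injOn fun x hx y hy hxy => ?_
  rw [← h.map_relabel hA hx, ← h.map_relabel hA hy]
  exact congrArg π hxy

theorem splitCluster_subset_verts (h : SplitData G X a b α β a' b' π) (hA : A ∈ X)
    (hN : HasSharedNonedge G X A) :
    (splitCluster G a b α β a' b' A : Set W) ⊆ (splitGraph G a b α β a' b').verts := by
  intro x hx
  obtain ⟨h1, h2⟩ := h.mem_splitCluster hA hN hx
  rw [← h2]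
  by_cases hwa : π x = a
  · rw [hwa]
    obtain ⟨i, hi⟩ := relabel_left (G := G) (a := a) (b := b) (α := α) (β := β) (a' := a')
      (b' := b') A
    exact Or.inl (Or.inr ⟨i, hi.symm⟩)
  by_cases hwb : π x = b
  · rw [hwb]
    obtain ⟨i, hi⟩ := h.relabel_right A
    exact Or.inr ⟨i, hi.symm⟩
  rw [relabel_old hwa hwb]
  exact Or.inl (Or.inl ⟨h.thin.subset_verts A hA h1, by simp [hwa, hwb]⟩)

/-- An edge inside the cluster puts its copy of x among the copies that the cluster keeps, and the
cluster keeps only one. -/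
theorem copyOf_eq_relabel (h : SplitData G X a b α β a' b' π) (hA : A ∈ X)
    (hN : HasSharedNonedge G X A) {x y : W} (hx : x ∈ A) (hy : y ∈ A) (hxy : G.Adj x y) :
    copyOf a b α β a' b' x y = relabel G a b α β a' b' A x := by
  classical
  by_cases hxa : x = a
  · subst hxa
    have h1 : α y ∈ copies G x α A := ⟨hx, y, hy, hxy, rfl⟩
    rw [h.left_copies hA hN hx, Set.mem_singleton_iff] at h1
    simp [copyOf, relabel, h1]
  by_cases hxb : x = b
  · subst hxb
    have h1 : β y ∈ copies G x β A := ⟨hx, y, hy, hxy, rfl⟩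
    rw [h.right_copies hA hN hx, Set.mem_singleton_iff] at h1
    simp [copyOf, relabel, h1, hxa]
  simp [copyOf, relabel, hxa, hxb]

theorem adj_iff (h : SplitData G X a b α β a' b' π) (hA : A ∈ X)
    (hN : HasSharedNonedge G X A) {x y : W} (hx : x ∈ splitCluster G a b α β a' b' A)
    (hy : y ∈ splitCluster G a b α β a' b' A) :
    (splitGraph G a b α β a' b').Adj x y ↔ G.Adj (π x) (π y) := by
  refine ⟨fun h' => (h.adj_map h').1, fun h' => ?_⟩
  obtain ⟨hx1, hx2⟩ := h.mem_splitCluster hA hN hx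
  obtain ⟨hy1, hy2⟩ := h.mem_splitCluster hA hN hy
  have := h.adj_copyOf h'
  rwa [h.copyOf_eq_relabel hA hN hx1 hy1 h', h.copyOf_eq_relabel hA hN hy1 hx1 h'.symm, hx2,
    hy2] at this

/-- Two clusters containing a shared pair other than `ab` replace its vertices in the same way. -/
theorem relabel_eq_relabel (h : SplitData G X a b α β a' b' π) (hA : A ∈ X)
    (hNA : HasSharedNonedge G X A) (hB : B ∈ X) (hNB : HasSharedNonedge G X B) {x y : W}
    (hs : s(x, y) ∈ sharedSet X) (hne : s(x, y) ≠ s(a, b)) (hxA : x ∈ A) (hyA : y ∈ A)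
    (hxB : x ∈ B) (hyB : y ∈ B) :
    relabel G a b α β a' b' A x = relabel G a b α β a' b' B x := by
  by_cases hAB : A = B
  · rw [hAB]
  have hxy := ne_of_mem_sharedSet hs
  -- An edge xy determines the copy in both clusters at once; for a nonedge this is condition (ii)
  -- of safety.
  by_cases hadj : G.Adj x y
  · rw [← h.copyOf_eq_relabel hA hNA hxA hyA hadj, ← h.copyOf_eq_relabel hB hNB hxB hyB hadj]
  have hint := h.thin.isClusterFamily.inter_eq hA hB hAB hxy hxA hyA hxB hyB
  by_cases hxa : x = a
  · subst hxa
    have hyb : y ≠ b := fun h' => hne (by rw [h'])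
    have := h.safe.safe_left.eq_of_inter A hA B hB y hxy.symm hyb hint hs hadj
    have h0 : 0 ∈ copies G x α A ↔ 0 ∈ copies G x α B := by rw [this]
    by_cases hc : 0 ∈ copies G x α B <;> simp [relabel, h0, hc]
  by_cases hxb : x = b
  · subst hxb
    have hya : y ≠ a := fun h' => hne (by rw [h', Sym2.eq_swap])
    have := h.safe.safe_right.eq_of_inter A hA B hB y hxy.symm hya hint hs hadj
    have h0 : 0 ∈ copies G x β A ↔ 0 ∈ copies G x β B := by rw [this]
    by_cases hc : 0 ∈ copies G x β B <;> simp [relabel, hxa, h0, hc]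
  rw [relabel_old hxa hxb, relabel_old hxa hxb]

theorem subset_of_splitCluster_subset (h : SplitData G X a b α β a' b' π) (hA : A ∈ X)
    (hNA : HasSharedNonedge G X A) (hB : B ∈ X) (hNB : HasSharedNonedge G X B)
    (hAB : splitCluster G a b α β a' b' A ⊆ splitCluster G a b α β a' b' B) : A ⊆ B := by
  intro w hw
  have := (h.mem_splitCluster hB hNB (hAB (h.relabel_mem hA hNA hw))).1
  rwa [h.map_relabel hA hw] at this

theorem splitCluster_injOn (h : SplitData G X a b α β a' b' π) (hA : A ∈ X)
    (hNA : HasSharedNonedge G X A) (hB : B ∈ X) (hNB : HasSharedNonedge G X B)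
    (hAB : splitCluster G a b α β a' b' A = splitCluster G a b α β a' b' B) : A = B :=
  Finset.Subset.antisymm (h.subset_of_splitCluster_subset hA hNA hB hNB hAB.subset)
    (h.subset_of_splitCluster_subset hB hNB hA hNA hAB.symm.subset)

theorem card_splitCluster_inter_le (h : SplitData G X a b α β a' b' π) (hA : A ∈ X)
    (hNA : HasSharedNonedge G X A) (hB : B ∈ X) (hNB : HasSharedNonedge G X B) (hne : A ≠ B) :
    (splitCluster G a b α β a' b' A ∩ splitCluster G a b α β a' b' B).card ≤ 2 := by
  refine le_trans ?_ (h.thin.card_inter_le A hA B hB hne)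
  rw [← Finset.card_image_of_injOn ((h.injOn_splitCluster hA hNA).mono
    (by simp : ((splitCluster G a b α β a' b' A ∩ splitCluster G a b α β a' b' B : Finset W) :
      Set W) ⊆ _))]
  refine Finset.card_le_card ?_
  intro w hw
  obtain ⟨x, hx, rfl⟩ := Finset.mem_image.1 hw
  rw [Finset.mem_inter] at hx ⊢
  exact ⟨(h.mem_splitCluster hA hNA hx.1).1, (h.mem_splitCluster hB hNB hx.2).1⟩

theorem eq_map_relabel (h : SplitData G X a b α β a' b' π) (hA : A ∈ X)
    (hN : HasSharedNonedge G X A) {e : Sym2 W}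
    (he : ∀ x ∈ e, x ∈ splitCluster G a b α β a' b' A) :
    e = (e.map π).map (relabel G a b α β a' b' A) ∧ ∀ x ∈ e.map π, x ∈ A := by
  induction e with | _ x y
  simp only [Sym2.mem_iff, forall_eq_or_imp, forall_eq] at he
  obtain ⟨hx1, hx2⟩ := h.mem_splitCluster hA hN he.1
  obtain ⟨hy1, hy2⟩ := h.mem_splitCluster hA hN he.2
  rw [Sym2.map_mk, Sym2.map_mk, hx2, hy2]
  exact ⟨rfl, by simp [hx1, hy1]⟩

theorem hasSharedNonedge (h : SplitData G X a b α β a' b' π) (ha : a ∈ A) (hb : b ∈ A) :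
    HasSharedNonedge G X A :=
  ⟨a, ha, b, hb, h.safe.mem_shared, h.safe.nonedge⟩

/-- Links the clusters on ab to the gluing: their replacements survive in the safe split cover, so
the matching condition turns the pairs of copies in them into key gluing pairs of the ear. -/
theorem relabel_pair_mem_keyPairs (h : SplitData G X a b α β a' b' π) (hA : A ∈ X) (ha : a ∈ A)
    (hb : b ∈ A) :
    s(relabel G a b α β a' b' A a, relabel G a b α β a' b' A b) ∈
      keyPairs {a' 0, a' 1, b' 0, b' 1} (safeSplitCover G X a b α β a' b') := by
  have hN := h.hasSharedNonedge ha hb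
  have hmemL : ∀ i, a' i ∈ ({a' 0, a' 1, b' 0, b' 1} : Finset W) := by
    intro i
    fin_cases i <;> simp
  have hmemR : ∀ i, b' i ∈ ({a' 0, a' 1, b' 0, b' 1} : Finset W) := by
    intro i
    fin_cases i <;> simp
  obtain ⟨i, hi⟩ := relabel_left (G := G) (a := a) (b := b) (α := α) (β := β) (a' := a')
    (b' := b') A
  obtain ⟨j, hj⟩ := h.relabel_right A
  rw [mem_keyPairs]
  refine ⟨⟨?_, ?_⟩, splitCluster G a b α β a' b' A, ?_, ?_⟩
  · rw [hi, hj]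
    simpa using h.new.left_ne_right i j
  · rw [hi, hj]
    simp only [Sym2.mem_iff, forall_eq_or_imp, forall_eq]
    exact ⟨hmemL i, hmemR j⟩
  · classical
    simp only [safeSplitCover, safeSplitBig, Finset.mem_union, Finset.mem_filter, Finset.mem_image]
    refine Or.inl ⟨⟨A, hA, rfl⟩, ?_, ?_, ?_⟩
    · rw [h.card_splitCluster hA hN]
      -- A cluster on ab with at most two elements would be {a, b} and lie inside another cluster on
      -- ab, which exists because ab is shared.
      by_contra hcard
      obtain ⟨B, hB, C, hC, hBC, hB', hC'⟩ := exists_two h.safe.mem_shared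
      have hAeq : A = {a, b} := by
        symm
        refine Finset.eq_of_subset_of_card_le ?_ ?_
        · simp [Finset.insert_subset_iff, ha, hb]
        · rw [Finset.card_pair h.ne]
          omega
      have key : ∀ D ∈ X, a ∈ D → b ∈ D → A = D := by
        intro D hD haD hbD
        by_contra hne
        refine h.thin.not_subset A hA D hD hne ?_
        rw [hAeq]
        simp [Finset.insert_subset_iff, haD, hbD]
      exact hBC ((key B hB hB'.1 hB'.2).symm.trans (key C hC hC'.1 hC'.2))
    · intro hsub
      have h0 := (h.mem_splitCluster hA hN (hsub (by simp : a' 0 ∈ _))).2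
      have h1 := (h.mem_splitCluster hA hN (hsub (by simp : a' 1 ∈ _))).2
      rw [h.map_left] at h0 h1
      exact h.new.left_ne (h0.symm.trans h1)
    · intro hsub
      have h0 := (h.mem_splitCluster hA hN (hsub (by simp : b' 0 ∈ _))).2
      have h1 := (h.mem_splitCluster hA hN (hsub (by simp : b' 1 ∈ _))).2
      rw [h.map_right] at h0 h1
      exact h.new.right_ne (h0.symm.trans h1)
  · simp only [Sym2.mem_iff, forall_eq_or_imp, forall_eq]
    exact ⟨h.relabel_mem hA hN ha, h.relabel_mem hA hN hb⟩

end SplitData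

/-! ### Covers containing the split clusters -/

open Classical in
/-- The clusters containing a shared nonedge. -/
noncomputable def nonedgeClusters (G : VGraph W) (X : Finset (Finset W)) : Finset (Finset W) :=
  X.filter (HasSharedNonedge G X)

open Classical in
/-- The sets replacing the clusters that contain a shared nonedge. -/
noncomputable def splitClusters (G : VGraph W) (X : Finset (Finset W)) (a b : W)
    (α β : W → Fin 2) (a' b' : Fin 2 → W) : Finset (Finset W) :=
  (nonedgeClusters G X).image (splitCluster G a b α β a' b')

theorem mem_nonedgeClusters {G : VGraph W} {X : Finset (Finset W)} {A : Finset W} :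
    A ∈ nonedgeClusters G X ↔ A ∈ X ∧ HasSharedNonedge G X A := by
  simp [nonedgeClusters]

theorem mem_splitClusters {G : VGraph W} {X : Finset (Finset W)} {a b : W}
    {α β : W → Fin 2} {a' b' : Fin 2 → W} {A' : Finset W} :
    A' ∈ splitClusters G X a b α β a' b' ↔
      ∃ A ∈ X, HasSharedNonedge G X A ∧ splitCluster G a b α β a' b' A = A' := by
  simp [splitClusters, mem_nonedgeClusters, and_assoc]

/-- The conditions under which the split clusters, as members of the cluster family `C` of `G'`,
behave like the clusters of `X`. -/
structure SplitFamily (G : VGraph W) (X : Finset (Finset W)) (a b : W) (α β : W → Fin 2)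
    (a' b' : Fin 2 → W) (π : W → W) (G' : VGraph W) (C : Finset (Finset W)) : Prop extends
    SplitData G X a b α β a' b' π where
  family : IsClusterFamily G' C
  subset : splitClusters G X a b α β a' b' ⊆ C
  adj : ∀ A ∈ X, HasSharedNonedge G X A → ∀ x ∈ splitCluster G a b α β a' b' A,
    ∀ y ∈ splitCluster G a b α β a' b' A,
    (G'.Adj x y ↔ (splitGraph G a b α β a' b').Adj x y)
  shared : ∀ A ∈ X, HasSharedNonedge G X A → ∀ x ∈ splitCluster G a b α β a' b' A,
    ∀ y ∈ splitCluster G a b α β a' b' A, s(x, y) ∈ sharedSet C → s(π x, π y) ∈ sharedSet X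
  shared_pair : ∀ A ∈ X, a ∈ A → b ∈ A →
    s(relabel G a b α β a' b' A a, relabel G a b α β a' b' A b) ∈ sharedSet C

/-! ### Nullities and shared nonedges after a safe split -/

namespace SplitFamily

variable {G : VGraph W} {X : Finset (Finset W)} {a b : W} {α β : W → Fin 2} {a' b' : Fin 2 → W}
  {π : W → W} {G' : VGraph W} {C : Finset (Finset W)} {A : Finset W}

/-- Another cluster containing xy keeps the same copies of x and y, so its replacement contains the
relabeled pair too. Only ab may be replaced differently by different clusters; this is why
`shared_pair` is a separate requirement. -/
theorem shared_relabel (h : SplitFamily G X a b α β a' b' π G' C) (hA : A ∈ X)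
    (hN : HasSharedNonedge G X A) {x y : W} (hs : s(x, y) ∈ sharedSet X) (hadj : ¬ G.Adj x y)
    (hx : x ∈ A) (hy : y ∈ A) :
    s(relabel G a b α β a' b' A x, relabel G a b α β a' b' A y) ∈ sharedSet C := by
  by_cases hab : s(x, y) = s(a, b)
  · rcases Sym2.eq_iff.1 hab with ⟨rfl, rfl⟩ | ⟨rfl, rfl⟩
    · exact h.shared_pair A hA hx hy
    · rw [Sym2.eq_swap]
      exact h.shared_pair A hA hy hx
  have hex : ∃ B ∈ X, A ≠ B ∧ x ∈ B ∧ y ∈ B := by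
    obtain ⟨B, hB, B', hB', hne, h1, h2⟩ := SplitData.exists_two hs
    by_cases hAB : A = B
    · exact ⟨B', hB', hAB ▸ hne, h2⟩
    · exact ⟨B, hB, hAB, h1⟩
  obtain ⟨B, hB, hAB, hxB, hyB⟩ := hex
  have hNB : HasSharedNonedge G X B := ⟨x, hxB, y, hyB, hs, hadj⟩
  have hxe := h.relabel_eq_relabel hA hN hB hNB hs hab hx hy hxB hyB
  rw [Sym2.eq_swap] at hs hab
  have hye := h.relabel_eq_relabel hA hN hB hNB hs hab hy hx hyB hxB
  refine h.family.mem_sharedSet_of_mem (h.subset (mem_splitClusters.2 ⟨A, hA, hN, rfl⟩))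
    (h.subset (mem_splitClusters.2 ⟨B, hB, hNB, rfl⟩))
    (fun h' => hAB (h.splitCluster_injOn hA hN hB hNB h')) ?_ (h.relabel_mem hA hN hx)
    (h.relabel_mem hA hN hy) ?_ ?_
  · intro h'
    have := congrArg π h'
    rw [h.map_relabel hA hx, h.map_relabel hA hy] at this
    exact (ne_of_mem_sharedSet hs) this.symm
  · rw [hxe]
    exact h.relabel_mem hB hNB hxB
  · rw [hye]
    exact h.relabel_mem hB hNB hyB

theorem inducedEdges_eq (h : SplitFamily G X a b α β a' b' π G' C) (hA : A ∈ X)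
    (hN : HasSharedNonedge G X A) :
    inducedEdges (G'.edgeSet ∪ sharedSet C) (splitCluster G a b α β a' b' A) =
      Sym2.map (relabel G a b α β a' b' A) '' inducedEdges (G.edgeSet ∪ sharedSet X) A := by
  ext e
  induction e with | _ x y
  constructor
  · rintro ⟨he, hxy⟩
    simp only [Sym2.mem_iff, forall_eq_or_imp, forall_eq] at hxy
    obtain ⟨hx1, hx2⟩ := h.mem_splitCluster hA hN hxy.1
    obtain ⟨hy1, hy2⟩ := h.mem_splitCluster hA hN hxy.2
    refine ⟨s(π x, π y), ⟨?_, by simp [hx1, hy1]⟩, by rw [Sym2.map_mk, hx2, hy2]⟩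
    rcases he with he | he
    · left
      exact (h.adj_iff hA hN hxy.1 hxy.2).1 ((h.adj A hA hN x hxy.1 y hxy.2).1 he)
    · right
      exact h.shared A hA hN x hxy.1 y hxy.2 he
  · rintro ⟨f, ⟨hf, hfA⟩, hef⟩
    rw [← hef]
    induction f with | _ z w
    simp only [Sym2.mem_iff, forall_eq_or_imp, forall_eq] at hfA
    have hz := h.relabel_mem hA hN hfA.1
    have hw := h.relabel_mem hA hN hfA.2
    have hadj : G'.Adj (relabel G a b α β a' b' A z) (relabel G a b α β a' b' A w) ↔ G.Adj z w := by
      rw [h.adj A hA hN _ hz _ hw, h.adj_iff hA hN hz hw, h.map_relabel hA hfA.1,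
        h.map_relabel hA hfA.2]
    refine ⟨?_, by simp [hz, hw]⟩
    by_cases hzw : G.Adj z w
    · exact Or.inl (hadj.2 hzw)
    · exact Or.inr (h.shared_relabel hA hN (hf.resolve_left hzw) hzw hfA.1 hfA.2)

variable {m : ℕ} {D : (Fin m → ℝ) → (Fin m → ℝ) → Fin 3 → ℝ}

theorem nul_splitCluster (h : SplitFamily G X a b α β a' b' π G' C) (hD : IsRigidityDirection D)
    {hD' : IsPolynomialMap D} (hA : A ∈ X) (hN : HasSharedNonedge G X A) :
    nul (frameworkMatroid W D hD')
      (inducedEdges (G'.edgeSet ∪ sharedSet C) (splitCluster G a b α β a' b' A)) =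
    nul (frameworkMatroid W D hD') (inducedEdges (G.edgeSet ∪ sharedSet X) A) := by
  have hmap : ∀ e ∈ inducedEdges (G.edgeSet ∪ sharedSet X) A, ∀ x ∈ e,
      π (relabel G a b α β a' b' A x) = x := fun e he x hx => h.map_relabel hA (he.2 x hx)
  rw [h.inducedEdges_eq hA hN, nul, nul, rk_image hD hmap, Set.InjOn.ncard_image]
  intro e he f hf hef
  have hback : ∀ e ∈ inducedEdges (G.edgeSet ∪ sharedSet X) A,
      (e.map (relabel G a b α β a' b' A)).map π = e := by
    intro e he
    have := hmap e he
    induction e with | _ x y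
    rw [Sym2.map_mk, Sym2.map_mk, this x (by simp), this y (by simp)]
  rw [← hback e he, ← hback f hf, hef]

theorem sum_nul (h : SplitFamily G X a b α β a' b' π G' C) (hD : IsRigidityDirection D)
    {hD' : IsPolynomialMap D} (hG : IsIndependent (frameworkMatroid W D hD') G)
    (hrk : rk (frameworkMatroid W D hD') G.edgeSet = ieCount (frameworkMatroid W D hD') G X) :
    ∑ A ∈ splitClusters G X a b α β a' b', nul (frameworkMatroid W D hD')
      (inducedEdges (G'.edgeSet ∪ sharedSet C) A) =
        ((sharedSet X : Set (Sym2 W)) \ G.edgeSet).ncard := by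
  classical
  rw [← (h.thin.rk_eq_ieCount_iff hG).1 hrk, splitClusters]
  -- A cluster without shared nonedges induces only edges of the independent graph G, so it has
  -- nullity zero and can be dropped.
  have hsum : ∑ A ∈ nonedgeClusters G X, nul (frameworkMatroid W D hD')
      (inducedEdges (G.edgeSet ∪ sharedSet X) A) = ∑ A ∈ X, nul (frameworkMatroid W D hD')
      (inducedEdges (G.edgeSet ∪ sharedSet X) A) := by
    refine Finset.sum_subset (fun A hA => (mem_nonedgeClusters.1 hA).1) fun A hA hAn => ?_
    refine nul_eq_zero (hG.subset ?_)
    rintro e ⟨he, heA⟩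
    refine he.elim id fun he => ?_
    induction e with | _ x y
    by_contra hcon
    exact hAn (mem_nonedgeClusters.2 ⟨hA, x, heA x (by simp), y, heA y (by simp), he, hcon⟩)
  rw [← hsum]
  have himg := Finset.sum_image (s := nonedgeClusters G X) (g := splitCluster G a b α β a' b')
    (f := fun A => nul (frameworkMatroid W D hD')
      (inducedEdges (G'.edgeSet ∪ sharedSet C) A)) (by
      intro A hA B hB hAB
      rw [Finset.mem_coe, mem_nonedgeClusters] at hA hB
      exact h.splitCluster_injOn hA.1 hA.2 hB.1 hB.2 hAB)
  refine Eq.trans ?_ (himg.trans (Finset.sum_congr rfl fun A hA => ?_))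
  · congr!
  · rw [mem_nonedgeClusters] at hA
    exact h.nul_splitCluster hD hA.1 hA.2

/-- The pairs in the split clusters with the same image are equal, apart from copies of `ab`. -/
theorem eq_of_map_eq (h : SplitFamily G X a b α β a' b' π G' C) {B : Finset W} (hA : A ∈ X)
    (hNA : HasSharedNonedge G X A) (hB : B ∈ X) (hNB : HasSharedNonedge G X B) {e f : Sym2 W}
    (heA : ∀ x ∈ e, x ∈ splitCluster G a b α β a' b' A)
    (hfB : ∀ x ∈ f, x ∈ splitCluster G a b α β a' b' B) (hef : e.map π = f.map π)
    (hs : e.map π ∈ sharedSet X) (hab : e.map π ≠ s(a, b)) : e = f := by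
  obtain ⟨h1, h2⟩ := h.eq_map_relabel hA hNA heA
  obtain ⟨h3, h4⟩ := h.eq_map_relabel hB hNB hfB
  rw [h1, h3, ← hef]
  rw [← hef] at h4
  generalize e.map π = g at hs hab h2 h4 ⊢
  induction g with | _ x y
  simp only [Sym2.mem_iff, forall_eq_or_imp, forall_eq] at h2 h4
  have hxe := h.relabel_eq_relabel hA hNA hB hNB hs hab h2.1 h2.2 h4.1 h4.2
  rw [Sym2.eq_swap] at hs hab
  have hye := h.relabel_eq_relabel hA hNA hB hNB hs hab h2.2 h2.1 h4.2 h4.1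
  rw [Sym2.map_mk, Sym2.map_mk, hxe, hye]

/-- The shared nonedges of `C` coming from shared nonedges of `X` other than `ab`. -/
def oldNonedges (_ : SplitFamily G X a b α β a' b' π G' C) : Set (Sym2 W) :=
  {e | e ∈ sharedSet C ∧ e ∉ G'.edgeSet ∧ e.map π ≠ s(a, b) ∧
    ∃ A ∈ X, HasSharedNonedge G X A ∧ ∀ x ∈ e, x ∈ splitCluster G a b α β a' b' A}

/-- π is a bijection from these pairs to the shared nonedges of X other than ab. Copies of ab are
left out since their number depends on the split. -/
theorem ncard_oldNonedges (h : SplitFamily G X a b α β a' b' π G' C) :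
    h.oldNonedges.ncard + 1 = ((sharedSet X : Set (Sym2 W)) \ G.edgeSet).ncard := by
  have habm : s(a, b) ∈ (sharedSet X : Set (Sym2 W)) \ G.edgeSet :=
    ⟨h.safe.mem_shared, h.safe.nonedge⟩
  have hshared : ∀ e ∈ h.oldNonedges, e.map π ∈ sharedSet X ∧ e.map π ∉ G.edgeSet := by
    rintro e ⟨he, heG, -, A, hA, hN, heA⟩
    induction e with | _ x y
    simp only [Sym2.mem_iff, forall_eq_or_imp, forall_eq] at heA
    refine ⟨h.shared A hA hN x heA.1 y heA.2 he, fun hcon => heG ?_⟩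
    exact (h.adj A hA hN x heA.1 y heA.2).2 ((h.adj_iff hA hN heA.1 heA.2).2 hcon)
  have himg : Sym2.map π '' h.oldNonedges =
      ((sharedSet X : Set (Sym2 W)) \ G.edgeSet) \ {s(a, b)} := by
    ext f
    constructor
    · rintro ⟨e, he, rfl⟩
      exact ⟨hshared e he, he.2.2.1⟩
    · rintro ⟨⟨hf, hfG⟩, hfab⟩
      induction f with | _ x y
      obtain ⟨A, hA, -, -, -, ⟨hx, hy⟩, -⟩ := SplitData.exists_two hf
      have hN : HasSharedNonedge G X A := ⟨x, hx, y, hy, hf, hfG⟩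
      have hmx := h.relabel_mem hA hN hx
      have hmy := h.relabel_mem hA hN hy
      refine ⟨s(relabel G a b α β a' b' A x, relabel G a b α β a' b' A y),
        ⟨h.shared_relabel hA hN hf hfG hx hy, fun hcon => hfG ?_, ?_, A, hA, hN, ?_⟩, ?_⟩
      · have := (h.adj_iff hA hN hmx hmy).1 ((h.adj A hA hN _ hmx _ hmy).1 hcon)
        rwa [h.map_relabel hA hx, h.map_relabel hA hy] at this
      · rw [Sym2.map_mk, h.map_relabel hA hx, h.map_relabel hA hy]
        exact hfab
      · simp [hmx, hmy]
      · rw [Sym2.map_mk, h.map_relabel hA hx, h.map_relabel hA hy]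
  have hinj : Set.InjOn (Sym2.map π) h.oldNonedges := by
    intro e he f hf hef
    obtain ⟨-, -, hab, A, hA, hNA, heA⟩ := id he
    obtain ⟨-, -, -, B, hB, hNB, hfB⟩ := hf
    exact h.eq_of_map_eq hA hNA hB hNB heA hfB hef (hshared e he).1 hab
  rw [← hinj.ncard_image, himg, Set.ncard_sdiff_singleton_add_one habm (Set.toFinite _)]

end SplitFamily

/-- Splitting off nothing: all neighbors go to the same copy. -/
theorem isSafeAt_zero {G : VGraph W} {C : Finset (Finset W)} {x y : W}
    (h : ∀ A ∈ C, HasSharedNonedge G C A → x ∈ A → ∃ w ∈ A, G.Adj x w) :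
    IsSafeAt G C x y fun _ => 0 := by
  refine ⟨?_, ?_, ?_⟩
  · rintro A - - ⟨-, -, w, -, -, h1⟩
    simp at h1
  · intro A hA hN hx
    obtain ⟨w, hw, hxw⟩ := h A hA hN hx
    exact ⟨0, hx, w, hw, hxw, rfl⟩
  · intro A hA B hB u _ _ hAB hs hadj
    have hmem : x ∈ A ∩ B ∧ u ∈ A ∩ B := by simp [hAB]
    simp only [Finset.mem_inter] at hmem
    obtain ⟨⟨hxA, hxB⟩, huA, huB⟩ := hmem
    obtain ⟨w, hw, hxw⟩ := h A hA ⟨x, hxA, u, huA, hs, hadj⟩ hxA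
    obtain ⟨z, hz, hxz⟩ := h B hB ⟨x, hxB, u, huB, hs, hadj⟩ hxB
    ext i
    constructor
    · rintro ⟨-, v, -, -, hi⟩
      exact ⟨hxB, z, hz, hxz, hi⟩
    · rintro ⟨-, v, -, -, hi⟩
      exact ⟨hxA, w, hw, hxw, hi⟩

end Split

/-! ### Enlarging a split graph: cluster families and folded positions -/

section Glue

variable {W : Type*} [Fintype W] [DecidableEq W]

theorem SplitData.adj_eq_of_map_eq {G : VGraph W} {X : Finset (Finset W)} {a b : W}
    {α β : W → Fin 2} {a' b' : Fin 2 → W} {π : W → W} (h : SplitData G X a b α β a' b' π) :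
    Set.InjOn (Sym2.map π) (splitGraph G a b α β a' b').edgeSet := by
  intro e he f hf hef
  induction e with | _ x y
  induction f with | _ z w
  obtain ⟨-, hx, hy⟩ := h.adj_map (x := x) (y := y) he
  obtain ⟨-, hz, hw⟩ := h.adj_map (x := z) (y := w) hf
  rw [Sym2.map_mk, Sym2.map_mk] at hef
  rw [Sym2.eq_iff]
  rcases Sym2.eq_iff.1 hef with ⟨h1, h2⟩ | ⟨h1, h2⟩ <;> rw [h1, h2] at hx hy
  · exact Or.inl ⟨hx.trans hz.symm, hy.trans hw.symm⟩
  · exact Or.inr ⟨hx.trans hw.symm, hy.trans hz.symm⟩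

theorem SplitData.exists_adj_left {G : VGraph W} {X : Finset (Finset W)} {a b : W}
    {α β : W → Fin 2} {a' b' : Fin 2 → W} {π : W → W} (h : SplitData G X a b α β a' b' π)
    {A : Finset W} (hA : A ∈ X) (hN : HasSharedNonedge G X A) (ha : a ∈ A) :
    ∃ w ∈ splitCluster G a b α β a' b' A,
      (splitGraph G a b α β a' b').Adj (relabel G a b α β a' b' A a) w := by
  obtain ⟨-, -, w, hw, haw, -⟩ := h.safe.safe_left.nonempty A hA hN ha
  have h1 := h.adj_copyOf haw
  rw [h.copyOf_eq_relabel hA hN ha hw haw, h.copyOf_eq_relabel hA hN hw ha haw.symm] at h1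
  exact ⟨_, h.relabel_mem hA hN hw, h1⟩

theorem SplitData.exists_adj_right {G : VGraph W} {X : Finset (Finset W)} {a b : W}
    {α β : W → Fin 2} {a' b' : Fin 2 → W} {π : W → W} (h : SplitData G X a b α β a' b' π)
    {A : Finset W} (hA : A ∈ X) (hN : HasSharedNonedge G X A) (hb : b ∈ A) :
    ∃ w ∈ splitCluster G a b α β a' b' A,
      (splitGraph G a b α β a' b').Adj (relabel G a b α β a' b' A b) w := by
  obtain ⟨-, -, w, hw, hbw, -⟩ := h.safe.safe_right.nonempty A hA hN hb
  have h1 := h.adj_copyOf hbw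
  rw [h.copyOf_eq_relabel hA hN hb hw hbw, h.copyOf_eq_relabel hA hN hw hb hbw.symm] at h1
  exact ⟨_, h.relabel_mem hA hN hw, h1⟩

theorem SplitData.eq_relabel_pair {G : VGraph W} {X : Finset (Finset W)} {a b : W}
    {α β : W → Fin 2} {a' b' : Fin 2 → W} {π : W → W} (h : SplitData G X a b α β a' b' π)
    {A : Finset W} (hA : A ∈ X) (hN : HasSharedNonedge G X A) {e : Sym2 W}
    (he : ∀ x ∈ e, x ∈ splitCluster G a b α β a' b' A) (hab : e.map π = s(a, b)) :
    (a ∈ A ∧ b ∈ A) ∧ e = s(relabel G a b α β a' b' A a, relabel G a b α β a' b' A b) := by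
  obtain ⟨h1, h2⟩ := h.eq_map_relabel hA hN he
  rw [hab] at h1 h2
  exact ⟨⟨h2 a (by simp), h2 b (by simp)⟩, h1⟩

/-- Adding to the split clusters a family `𝓑` of clusters meeting the split graph only in copies of
`a` and `b`. -/
theorem SplitData.splitFamily {G : VGraph W} {X : Finset (Finset W)} {a b : W}
    {α β : W → Fin 2} {a' b' : Fin 2 → W} {π : W → W} (h : SplitData G X a b α β a' b' π)
    {G' : VGraph W} {𝓑 : Finset (Finset W)}
    (hverts : (splitGraph G a b α β a' b').verts ⊆ G'.verts)
    (hadj : ∀ x ∈ (splitGraph G a b α β a' b').verts, ∀ y ∈ (splitGraph G a b α β a' b').verts,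
      (G'.Adj x y ↔ (splitGraph G a b α β a' b').Adj x y))
    (hfam : IsClusterFamily G' 𝓑)
    (hmap : ∀ B ∈ 𝓑, ∀ x ∈ B, x ∈ (splitGraph G a b α β a' b').verts → π x = a ∨ π x = b)
    (hnew : ∀ B ∈ 𝓑, ∃ x ∈ B, x ∉ (splitGraph G a b α β a' b').verts)
    (hpair : ∀ A ∈ X, a ∈ A → b ∈ A → ∃ B ∈ splitClusters G X a b α β a' b' ∪ 𝓑,
      B ≠ splitCluster G a b α β a' b' A ∧ relabel G a b α β a' b' A a ∈ B ∧
        relabel G a b α β a' b' A b ∈ B) :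
    SplitFamily G X a b α β a' b' π G' (splitClusters G X a b α β a' b' ∪ 𝓑) := by
  -- A split cluster and a member of 𝓑 share only copies of a and b. As π is injective on the split
  -- cluster, there is at most one of each.
  have hcard : ∀ A ∈ X, HasSharedNonedge G X A → ∀ B ∈ 𝓑,
      (splitCluster G a b α β a' b' A ∩ B).image π ⊆ {a, b} := by
    intro A hA hN B hB w hw
    obtain ⟨x, hx, rfl⟩ := Finset.mem_image.1 hw
    rw [Finset.mem_inter] at hx
    simpa using hmap B hB x hx.2 (h.splitCluster_subset_verts hA hN hx.1)
  have hle : ∀ A ∈ X, HasSharedNonedge G X A → ∀ B ∈ 𝓑,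
      (splitCluster G a b α β a' b' A ∩ B).card ≤ 2 := by
    intro A hA hN B hB
    rw [← Finset.card_image_of_injOn ((h.injOn_splitCluster hA hN).mono
      (by simp : ((splitCluster G a b α β a' b' A ∩ B : Finset W) : Set W) ⊆ _))]
    exact (Finset.card_le_card (hcard A hA hN B hB)).trans Finset.card_le_two
  have hsub : ∀ A ∈ X, HasSharedNonedge G X A → ∀ B ∈ 𝓑,
      ¬ splitCluster G a b α β a' b' A ⊆ B ∧ ¬ B ⊆ splitCluster G a b α β a' b' A := by
    intro A hA hN B hB
    refine ⟨fun hsub => ?_, fun hsub => ?_⟩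
    · have hAab : A ⊆ {a, b} := by
        intro w hw
        have hw' := h.relabel_mem hA hN hw
        refine hcard A hA hN B hB (Finset.mem_image.2 ⟨_, Finset.mem_inter.2 ⟨hw', hsub hw'⟩, ?_⟩)
        exact h.map_relabel hA hw
      obtain ⟨E, hE, F, hF, hEF, hE', hF'⟩ := exists_two h.safe.mem_shared
      have key : ∀ E ∈ X, a ∈ E → b ∈ E → A = E := by
        intro E hE ha hb
        by_contra hne
        refine h.thin.not_subset A hA E hE hne (hAab.trans ?_)
        simp [Finset.insert_subset_iff, ha, hb]
      exact hEF ((key E hE hE'.1 hE'.2).symm.trans (key F hF hF'.1 hF'.2))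
    · obtain ⟨x, hx, hxG⟩ := hnew B hB
      exact hxG (h.splitCluster_subset_verts hA hN (hsub hx))
  have hfamily : IsClusterFamily G' (splitClusters G X a b α β a' b' ∪ 𝓑) := by
    refine ⟨?_, ?_, ?_, ?_⟩
    · intro E hE
      rcases Finset.mem_union.1 hE with hE | hE
      · obtain ⟨A, hA, hN, rfl⟩ := mem_splitClusters.1 hE
        exact (h.splitCluster_subset_verts hA hN).trans hverts
      · exact hfam.subset_verts E hE
    · intro E hE
      rcases Finset.mem_union.1 hE with hE | hE
      · obtain ⟨A, hA, hN, rfl⟩ := mem_splitClusters.1 hE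
        rw [h.card_splitCluster hA hN]
        exact h.thin.two_le_card A hA
      · exact hfam.two_le_card E hE
    · intro E hE F hF hEF
      rcases Finset.mem_union.1 hE with hE | hE <;> rcases Finset.mem_union.1 hF with hF | hF
      · obtain ⟨A, hA, hN, rfl⟩ := mem_splitClusters.1 hE
        obtain ⟨B, hB, hN', rfl⟩ := mem_splitClusters.1 hF
        exact h.card_splitCluster_inter_le hA hN hB hN' fun hAB => hEF (by rw [hAB])
      · obtain ⟨A, hA, hN, rfl⟩ := mem_splitClusters.1 hE
        exact hle A hA hN F hF
      · obtain ⟨A, hA, hN, rfl⟩ := mem_splitClusters.1 hF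
        rw [Finset.inter_comm]
        exact hle A hA hN E hE
      · exact hfam.card_inter_le E hE F hF hEF
    · intro E hE F hF hEF
      rcases Finset.mem_union.1 hE with hE | hE <;> rcases Finset.mem_union.1 hF with hF | hF
      · obtain ⟨A, hA, hN, rfl⟩ := mem_splitClusters.1 hE
        obtain ⟨B, hB, hN', rfl⟩ := mem_splitClusters.1 hF
        intro hAB
        exact h.thin.not_subset A hA B hB (fun hAB => hEF (by rw [hAB]))
          (h.subset_of_splitCluster_subset hA hN hB hN' hAB)
      · obtain ⟨A, hA, hN, rfl⟩ := mem_splitClusters.1 hE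
        exact (hsub A hA hN F hF).1
      · obtain ⟨A, hA, hN, rfl⟩ := mem_splitClusters.1 hF
        exact (hsub A hA hN E hE).2
      · exact hfam.not_subset E hE F hF hEF
  refine { h with
    family := hfamily
    subset := Finset.subset_union_left
    adj := ?_
    shared := ?_
    shared_pair := ?_ }
  · intro A hA hN x hx y hy
    exact hadj x (h.splitCluster_subset_verts hA hN hx) y (h.splitCluster_subset_verts hA hN hy)
  · intro A hA hN x hx y hy hxy
    have hne : π x ≠ π y := fun h' => ne_of_mem_sharedSet hxy (h.injOn_splitCluster hA hN hx hy h')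
    have hnewcase : ∀ B ∈ 𝓑, x ∈ B → y ∈ B → s(π x, π y) ∈ sharedSet X := by
      intro B hB hxB hyB
      have h1 := hmap B hB x hxB (h.splitCluster_subset_verts hA hN hx)
      have h2 := hmap B hB y hyB (h.splitCluster_subset_verts hA hN hy)
      have : s(π x, π y) = s(a, b) := by
        rw [Sym2.eq_iff]
        rcases h1 with h1 | h1 <;> rcases h2 with h2 | h2 <;> simp_all
      rw [this]
      exact h.safe.mem_shared
    obtain ⟨E, hE, F, hF, hEF, hxyE, hxyF⟩ := exists_two hxy
    rcases Finset.mem_union.1 hE with hE | hE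
    · rcases Finset.mem_union.1 hF with hF | hF
      · obtain ⟨B, hB, hNB, rfl⟩ := mem_splitClusters.1 hE
        obtain ⟨B', hB', hNB', rfl⟩ := mem_splitClusters.1 hF
        exact h.thin.isClusterFamily.mem_sharedSet_of_mem hB hB' (fun h' => hEF (by rw [h'])) hne
          (h.mem_splitCluster hB hNB hxyE.1).1 (h.mem_splitCluster hB hNB hxyE.2).1
          (h.mem_splitCluster hB' hNB' hxyF.1).1 (h.mem_splitCluster hB' hNB' hxyF.2).1
      · exact hnewcase F hF hxyF.1 hxyF.2
    · exact hnewcase E hE hxyE.1 hxyE.2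
  · intro A hA ha hb
    have hN := h.hasSharedNonedge ha hb
    obtain ⟨B, hB, hne, haB, hbB⟩ := hpair A hA ha hb
    refine hfamily.mem_sharedSet_of_mem hB
      (Finset.mem_union_left _ (mem_splitClusters.2 ⟨A, hA, hN, rfl⟩)) hne ?_ haB hbB
      (h.relabel_mem hA hN ha) (h.relabel_mem hA hN hb)
    intro h'
    have := congrArg π h'
    rw [h.map_relabel hA ha, h.map_relabel hA hb] at this
    exact h.ne this

variable {m : ℕ} {D : (Fin m → ℝ) → (Fin m → ℝ) → Fin 3 → ℝ}

omit [Fintype W] in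
theorem IsGenericFramework.star_comp {T : Fin 6 → (Fin m → ℝ) → Fin 3 → ℝ} {p : W → Fin m → ℝ}
    (hp : IsGenericFramework D T p) {π : W → W} {z : W} {S : Finset W} (hinj : Set.InjOn π S)
    (hz : ∀ t ∈ S, π t ≠ π z) (hS : S.card ≤ 3) :
    LinearIndepOn ℝ (fun t => D ((p ∘ π) z) ((p ∘ π) t)) (S : Set W) := by
  have h := hp.star (π z) (S.image π) (by simpa using fun t ht => hz t ht)
    (Finset.card_image_le.trans hS)
  rw [Finset.coe_image] at h
  exact h.comp_of_image hinj

omit [Fintype W] in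
/-- Adding a butterfly whose vertices are mapped to generic points. -/
theorem linearIndepOn_union_butterfly (hD : IsRigidityDirection D)
    {T : Fin 6 → (Fin m → ℝ) → Fin 3 → ℝ} {p : W → Fin m → ℝ} (hp : IsGenericFramework D T p)
    {π : W → W} {E : Set (Sym2 W)} {x y u v c : W} (hnd : [x, y, u, v, c].Nodup)
    (hE : LinearIndepOn ℝ (edgeRow D (p ∘ π)) E ∧ ∀ e ∈ E, ¬ e.IsDiag) (hx : x ∉ endpoints E)
    (hy : y ∉ endpoints E) (hc : c ∉ endpoints E) (hπ : [π u, π v, π c].Nodup)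
    (hπx : π x ∉ [π u, π v, π c]) (hπy : π y ∉ [π u, π v, π c]) :
    LinearIndepOn ℝ (edgeRow D (p ∘ π)) (E ∪ butterflyEdges x y u v c) ∧
      ∀ e ∈ E ∪ butterflyEdges x y u v c, ¬ e.IsDiag := by
  simp only [List.nodup_cons, List.mem_cons, List.not_mem_nil, or_false, not_or,
    List.nodup_nil, not_false_eq_true, and_true] at hnd hπ hπx hπy
  obtain ⟨⟨hxy, hxu, hxv, hxc⟩, ⟨hyu, hyv, hyc⟩, ⟨huv, huc⟩, hvc⟩ := hnd
  obtain ⟨⟨huv', huc'⟩, hvc'⟩ := hπ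
  obtain ⟨hxu', hxv', hxc'⟩ := hπx
  obtain ⟨hyu', hyv', hyc'⟩ := hπy
  have step : ∀ {E : Set (Sym2 W)} (w : W) (S : Finset W),
      LinearIndepOn ℝ (edgeRow D (p ∘ π)) E ∧ (∀ e ∈ E, ¬ e.IsDiag) → w ∉ endpoints E → w ∉ S →
      S.card ≤ 3 → Set.InjOn π S → (∀ t ∈ S, π t ≠ π w) →
      LinearIndepOn ℝ (edgeRow D (p ∘ π)) (E ∪ starOn w S) ∧
        ∀ e ∈ E ∪ starOn w S, ¬ e.IsDiag := by
    intro E w S hE hw hwS hS hinj hne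
    refine ⟨linearIndepOn_union_star hD hE.1 hE.2 hw hwS (hp.star_comp hinj hne hS), ?_⟩
    rintro e (he | ⟨t, ht, rfl⟩)
    · exact hE.2 e he
    · rw [Sym2.mk_isDiag_iff]
      rintro rfl
      exact hwS ht
  have hinj : Set.InjOn π (({u, v, c} : Finset W) : Set W) := by
    simp only [Finset.coe_insert, Finset.coe_singleton]
    rintro i (rfl | rfl | rfl) j (rfl | rfl | rfl) hij <;> simp_all
  -- In the order c, x, y each vertex is joined to at most three vertices with distinct images. The
  -- vertices x and y are not adjacent, so they may have the same image.
  have s1 := step c {u, v} hE hc (by simp [Ne.symm huc, Ne.symm hvc]) (Finset.card_le_two.trans (by simp))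
    (hinj.mono (by
      intro i
      simp only [Finset.coe_insert, Finset.coe_singleton, Set.mem_insert_iff,
        Set.mem_singleton_iff]
      tauto)) (by simp [huc', hvc'])
  have s2 := step x {u, v, c} s1
    (notMem_endpoints_union hx (notMem_endpoints_starOn hxc (by simp [hxu, hxv])))
    (by simp [hxu, hxv, hxc]) Finset.card_le_three hinj
    (by simp [Ne.symm hxu', Ne.symm hxv', Ne.symm hxc'])
  have s3 := step y {u, v, c} s2
    (notMem_endpoints_union (notMem_endpoints_union hy
      (notMem_endpoints_starOn hyc (by simp [hyu, hyv])))
      (notMem_endpoints_starOn (Ne.symm hxy) (by simp [hyu, hyv, hyc])))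
    (by simp [hyu, hyv, hyc]) Finset.card_le_three hinj
    (by simp [Ne.symm hyu', Ne.symm hyv', Ne.symm hyc'])
  have heq : E ∪ butterflyEdges x y u v c =
      E ∪ starOn c {u, v} ∪ starOn x {u, v, c} ∪ starOn y {u, v, c} := by
    ext e
    simp only [butterflyEdges, Set.mem_union]
    tauto
  rw [heq]
  exact s3

end Glue

/-! ### Gluing a double butterfly to a split graph -/

/-- The double butterfly on `p₁, q₁, p₂, q₂, u, v, c₁, c₂` is glued to a safe split of `G`. -/
structure IsDoubleButterflyGlue {W : Type*} [Fintype W] [DecidableEq W] (G : VGraph W)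
    (X : Finset (Finset W)) (a b : W) (α β : W → Fin 2) (a' b' : Fin 2 → W)
    (p₁ q₁ p₂ q₂ u v c₁ c₂ : W) : Prop where
  thin : IsTwoThinCover G X
  safe : IsSafeNonedgeSplit G X a b α β
  new : AreNewVertices G a' b'
  nodup : [p₁, q₁, p₂, q₂, u, v, c₁, c₂].Nodup
  gluing : ({p₁, q₁, p₂, q₂} : Finset W) = {a' 0, a' 1, b' 0, b' 1}
  notMem : ∀ x, x = u ∨ x = v ∨ x = c₁ ∨ x = c₂ → x ∉ (splitGraph G a b α β a' b').verts

/-- The map identifying the copies of `a` and of `b`, and sending `u, v` to the copies of `a` and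
`c₁, c₂` to a copy of `b`. -/
def foldMap {W : Type*} [DecidableEq W] (a b : W) (a' b' : Fin 2 → W) (u v c₁ c₂ w : W) : W :=
  if w = a' 0 ∨ w = a' 1 then a else if w = b' 0 ∨ w = b' 1 then b
  else if w = u then a' 0 else if w = v then a' 1 else if w = c₁ ∨ w = c₂ then b' 0 else w

namespace IsDoubleButterflyGlue

variable {W : Type*} [Fintype W] [DecidableEq W] {G : VGraph W} {X : Finset (Finset W)} {a b : W}
  {α β : W → Fin 2} {a' b' : Fin 2 → W} {p₁ q₁ p₂ q₂ u v c₁ c₂ : W}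

theorem mem_gluing (h : IsDoubleButterflyGlue G X a b α β a' b' p₁ q₁ p₂ q₂ u v c₁ c₂) (x : W) :
    (x = p₁ ∨ x = q₁ ∨ x = p₂ ∨ x = q₂) ↔ (x = a' 0 ∨ x = a' 1 ∨ x = b' 0 ∨ x = b' 1) := by
  simpa using Finset.ext_iff.1 h.gluing x

theorem mem_verts_of_gluing (h : IsDoubleButterflyGlue G X a b α β a' b' p₁ q₁ p₂ q₂ u v c₁ c₂)
    {x : W} (hx : x = p₁ ∨ x = q₁ ∨ x = p₂ ∨ x = q₂) : x ∈ (splitGraph G a b α β a' b').verts := by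
  rcases (h.mem_gluing x).1 hx with rfl | rfl | rfl | rfl
  · exact Or.inl (Or.inr ⟨0, rfl⟩)
  · exact Or.inl (Or.inr ⟨1, rfl⟩)
  · exact Or.inr ⟨0, rfl⟩
  · exact Or.inr ⟨1, rfl⟩

theorem fold_left (i : Fin 2) : foldMap a b a' b' u v c₁ c₂ (a' i) = a := by
  fin_cases i <;> simp [foldMap]

theorem fold_right (h : IsDoubleButterflyGlue G X a b α β a' b' p₁ q₁ p₂ q₂ u v c₁ c₂)
    (i : Fin 2) : foldMap a b a' b' u v c₁ c₂ (b' i) = b := by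
  have h1 := fun i j => (h.new.left_ne_right i j).symm
  fin_cases i <;> simp [foldMap, h1]

theorem splitData (h : IsDoubleButterflyGlue G X a b α β a' b' p₁ q₁ p₂ q₂ u v c₁ c₂) :
    SplitData G X a b α β a' b' (foldMap a b a' b' u v c₁ c₂) where
  thin := h.thin
  safe := h.safe
  new := h.new
  map_left := fold_left
  map_right := h.fold_right
  map_old w hw hwa hwb := by
    have hv : w ∈ (splitGraph G a b α β a' b').verts :=
      Or.inl (Or.inl ⟨hw, by simp [hwa, hwb]⟩)
    have h1 : ∀ i, w ≠ a' i := fun i h' => h.new.left_notMem i (h' ▸ hw)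
    have h2 : ∀ i, w ≠ b' i := fun i h' => h.new.right_notMem i (h' ▸ hw)
    have h3 := mt (h.notMem w) (not_not_intro hv)
    simp only [not_or] at h3
    simp [foldMap, h1, h2, h3]

/-- The vertices of the double butterfly outside the split graph are mapped to new vertices. -/
theorem fold_new (h : IsDoubleButterflyGlue G X a b α β a' b' p₁ q₁ p₂ q₂ u v c₁ c₂) :
    foldMap a b a' b' u v c₁ c₂ u = a' 0 ∧ foldMap a b a' b' u v c₁ c₂ v = a' 1 ∧
      foldMap a b a' b' u v c₁ c₂ c₁ = b' 0 ∧ foldMap a b a' b' u v c₁ c₂ c₂ = b' 0 := by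
  have hnd := h.nodup
  simp only [List.nodup_cons, List.mem_cons, List.not_mem_nil, or_false, not_or,
    List.nodup_nil, not_false_eq_true, and_true] at hnd
  have key : ∀ x, x = u ∨ x = v ∨ x = c₁ ∨ x = c₂ →
      ¬ (x = a' 0 ∨ x = a' 1 ∨ x = b' 0 ∨ x = b' 1) := by
    intro x hx hcon
    exact h.notMem x hx (h.mem_verts_of_gluing ((h.mem_gluing x).2 hcon))
  have hu := key u (by simp)
  have hv := key v (by simp)
  have h1 := key c₁ (by simp)
  have h2 := key c₂ (by simp)
  simp only [not_or] at hu hv h1 h2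
  refine ⟨by simp [foldMap, hu], ?_, ?_, ?_⟩
  · have : v ≠ u := by grind
    simp [foldMap, hv, this]
  · have : c₁ ≠ u ∧ c₁ ≠ v := by grind
    simp [foldMap, h1, this]
  · have : c₂ ≠ u ∧ c₂ ≠ v := by grind
    simp [foldMap, h2, this]

theorem fold_gluing (h : IsDoubleButterflyGlue G X a b α β a' b' p₁ q₁ p₂ q₂ u v c₁ c₂) {x : W}
    (hx : x = p₁ ∨ x = q₁ ∨ x = p₂ ∨ x = q₂) :
    foldMap a b a' b' u v c₁ c₂ x = a ∨ foldMap a b a' b' u v c₁ c₂ x = b := by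
  rcases (h.mem_gluing x).1 hx with rfl | rfl | rfl | rfl
  · exact Or.inl (fold_left 0)
  · exact Or.inl (fold_left 1)
  · exact Or.inr (h.fold_right 0)
  · exact Or.inr (h.fold_right 1)

theorem new_ne (h : IsDoubleButterflyGlue G X a b α β a' b' p₁ q₁ p₂ q₂ u v c₁ c₂) :
    [a, b, a' 0, a' 1, b' 0].Nodup := by
  have ha : ∀ i, a ≠ a' i := fun i h' => h.new.left_notMem i (h' ▸ h.splitData.left_mem)
  have hb : ∀ i, b ≠ a' i := fun i h' => h.new.left_notMem i (h' ▸ h.splitData.right_mem)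
  have ha' : ∀ i, a ≠ b' i := fun i h' => h.new.right_notMem i (h' ▸ h.splitData.left_mem)
  have hb' : ∀ i, b ≠ b' i := fun i h' => h.new.right_notMem i (h' ▸ h.splitData.right_mem)
  simp [h.splitData.ne, ha, hb, ha', hb', h.new.left_ne, h.new.left_ne_right]

/-- The edges onto which the double butterfly is folded. -/
def foldEdges (a b x y z : W) : Set (Sym2 W) :=
  starOn a {x, y, z} ∪ starOn b {x, y, z} ∪ starOn z {x, y}

/-- The folded ear is a butterfly attached to G at ab. Adding ab to it gives K₅ minus an edge, which
is built by 0-extensions, so `indep_union_of_edge` applies. -/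
theorem indep_union_foldEdges {M : Matroid (Sym2 W)} (hM : IsRigidityLike M)
    (h : IsDoubleButterflyGlue G X a b α β a' b' p₁ q₁ p₂ q₂ u v c₁ c₂)
    (hG : IsIndependent M G) :
    M.Indep (G.edgeSet ∪ foldEdges a b (a' 0) (a' 1) (b' 0)) := by
  have hnd := h.new_ne
  have ha := h.splitData.left_mem
  have hb := h.splitData.right_mem
  have hV : G.verts.toFinite.toFinset ∩ {a, b, a' 0, a' 1, b' 0} = {a, b} := by
    ext w
    simp only [Finset.mem_inter, Set.Finite.mem_toFinset, Finset.mem_insert, Finset.mem_singleton]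
    constructor
    · rintro ⟨hw, rfl | rfl | rfl | rfl | rfl⟩
      · simp
      · simp
      · exact absurd hw (h.new.left_notMem 0)
      · exact absurd hw (h.new.left_notMem 1)
      · exact absurd hw (h.new.right_notMem 0)
    · rintro (rfl | rfl)
      · simp [ha]
      · simp [hb]
  generalize a' 0 = x at *
  generalize a' 1 = y at *
  generalize b' 0 = z at *
  simp only [List.nodup_cons, List.mem_cons, List.not_mem_nil, or_false, not_or,
    List.nodup_nil, not_false_eq_true, and_true] at hnd
  refine hM.indep_union_of_edge h.splitData.ne hV hG ?_ ?_ ?_ ?_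
  · have h1 := hM.indep_star ∅ a {b} M.empty_indep (by simp [endpoints_empty]) (by grind) (by simp)
    have h2 := hM.indep_star _ z {a, b} h1
      (by
        (repeat' first
          | apply notMem_endpoints_union
          | apply notMem_endpoints_starOn) <;> first | grind | simp [endpoints_empty])
      (by grind) (by grind)
    have h3 := hM.indep_star _ x {a, b, z} h2
      (by
        (repeat' first
          | apply notMem_endpoints_union
          | apply notMem_endpoints_starOn) <;> first | grind | simp [endpoints_empty])
      (by grind) (by grind)
    have h4 := hM.indep_star _ y {a, b, z} h3
      (by
        (repeat' first
          | apply notMem_endpoints_union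
          | apply notMem_endpoints_starOn) <;> first | grind | simp [endpoints_empty])
      (by grind) (by grind)
    refine h4.subset ?_
    intro e
    induction e with | _ i j
    simp only [foldEdges, Set.mem_insert_iff, Set.mem_union, pair_mem_starOn, Finset.mem_insert,
      Finset.mem_singleton, Sym2.eq_iff]
    grind
  · simpa using edgeSet_subset_completeOn G
  · unfold foldEdges
    refine Set.union_subset (Set.union_subset ?_ ?_) ?_ <;>
      refine starOn_subset_completeOn (by simp) ?_ (by grind) <;>
      · intro w
        simp only [Finset.coe_insert, Finset.coe_singleton, Set.mem_insert_iff,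
          Set.mem_singleton_iff]
        grind
  · simp only [foldEdges, Set.mem_union, pair_mem_starOn, Finset.mem_insert, Finset.mem_singleton]
    grind

theorem map_fold_subset (h : IsDoubleButterflyGlue G X a b α β a' b' p₁ q₁ p₂ q₂ u v c₁ c₂) :
    Sym2.map (foldMap a b a' b' u v c₁ c₂) '' doubleButterflyEdges p₁ q₁ p₂ q₂ u v c₁ c₂ ⊆
      foldEdges a b (a' 0) (a' 1) (b' 0) := by
  obtain ⟨hu, hv, h1, h2⟩ := h.fold_new
  have hp₁ := h.fold_gluing (x := p₁) (by simp)
  have hq₁ := h.fold_gluing (x := q₁) (by simp)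
  have hp₂ := h.fold_gluing (x := p₂) (by simp)
  have hq₂ := h.fold_gluing (x := q₂) (by simp)
  rintro _ ⟨e, he, rfl⟩
  simp only [doubleButterflyEdges, butterflyEdges, Set.mem_union, mem_starOn, Finset.mem_insert,
    Finset.mem_singleton, exists_eq_or_imp, exists_eq_left] at he
  simp only [foldEdges, Set.mem_union, mem_starOn, Finset.mem_insert, Finset.mem_singleton,
    exists_eq_or_imp, exists_eq_left]
  rcases he with (((rfl | rfl | rfl) | rfl | rfl | rfl) | rfl | rfl) |
    ((rfl | rfl | rfl) | rfl | rfl | rfl) | rfl | rfl <;>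
    simp only [Sym2.map_mk, hu, hv, h1, h2] <;> grind

theorem foldEdges_disjoint (h : IsDoubleButterflyGlue G X a b α β a' b' p₁ q₁ p₂ q₂ u v c₁ c₂)
    {e : Sym2 W} (he : e ∈ foldEdges a b (a' 0) (a' 1) (b' 0)) : e ∉ G.edgeSet := by
  intro hG
  have hv : ∀ x ∈ e, x ∈ G.verts := (edgeSet_subset_completeOn G hG).2
  have h0 := h.new.left_notMem 0
  have h1 := h.new.left_notMem 1
  have h2 := h.new.right_notMem 0
  simp only [foldEdges, Set.mem_union, mem_starOn, Finset.mem_insert, Finset.mem_singleton,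
    exists_eq_or_imp, exists_eq_left] at he
  rcases he with ((rfl | rfl | rfl) | rfl | rfl | rfl) | rfl | rfl <;>
    simp only [Sym2.mem_iff, forall_eq_or_imp, forall_eq] at hv <;> tauto

variable {m : ℕ} {D : (Fin m → ℝ) → (Fin m → ℝ) → Fin 3 → ℝ}

/-- Folding identifies edges of the ear with each other, so collapse alone cannot separate them. Yet
the ear is built by 0-extensions whose stars lead to points in generic position even after folding.
-/
theorem linearIndepOn_doubleButterfly (hD : IsRigidityDirection D)
    (h : IsDoubleButterflyGlue G X a b α β a' b' p₁ q₁ p₂ q₂ u v c₁ c₂)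
    {T : Fin 6 → (Fin m → ℝ) → Fin 3 → ℝ} {p : W → Fin m → ℝ} (hp : IsGenericFramework D T p) :
    LinearIndepOn ℝ (edgeRow D (p ∘ foldMap a b a' b' u v c₁ c₂))
      (doubleButterflyEdges p₁ q₁ p₂ q₂ u v c₁ c₂) := by
  obtain ⟨hu, hv, h1, h2⟩ := h.fold_new
  have hnew := h.new_ne
  have hmap : ∀ x, x = p₁ ∨ x = q₁ ∨ x = p₂ ∨ x = q₂ →
      foldMap a b a' b' u v c₁ c₂ x ∉ [a' 0, a' 1, b' 0] := by
    intro x hx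
    rcases h.fold_gluing hx with h' | h' <;> rw [h'] <;>
      simp only [List.nodup_cons, List.mem_cons, not_or] at hnew ⊢ <;> tauto
  have hnd := h.nodup
  simp only [List.nodup_cons, List.mem_cons, List.not_mem_nil, or_false, not_or,
    List.nodup_nil, not_false_eq_true, and_true] at hnd
  have hπ : [a' 0, a' 1, b' 0].Nodup := by
    simp only [List.nodup_cons] at hnew ⊢
    tauto
  have s1 := linearIndepOn_union_butterfly hD hp (E := ∅)
    (π := foldMap a b a' b' u v c₁ c₂) (x := p₁) (y := q₁) (u := u) (v := v)
    (c := c₁) (by simp; grind) ⟨linearIndepOn_empty ℝ _, by simp⟩ (by simp [endpoints_empty])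
    (by simp [endpoints_empty]) (by simp [endpoints_empty]) (by rw [hu, hv, h1]; exact hπ)
    (by rw [hu, hv, h1]; exact hmap _ (by simp)) (by rw [hu, hv, h1]; exact hmap _ (by simp))
  have hends : ∀ x, x ≠ p₁ → x ≠ q₁ → x ≠ u → x ≠ v → x ≠ c₁ →
      x ∉ endpoints (∅ ∪ butterflyEdges p₁ q₁ u v c₁) := by
    intro x hx₁ hx₂ hx₃ hx₄ hx₅
    rw [Set.empty_union, butterflyEdges]
    refine notMem_endpoints_union (notMem_endpoints_union ?_ ?_) ?_ <;>
      exact notMem_endpoints_starOn (by assumption) (by simp [*])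
  have s2 := linearIndepOn_union_butterfly hD hp (x := p₂) (y := q₂) (u := u) (v := v)
    (c := c₂) (by simp; grind) s1 (hends _ (by grind) (by grind) (by grind) (by grind) (by grind))
    (hends _ (by grind) (by grind) (by grind) (by grind) (by grind))
    (hends _ (by grind) (by grind) (by grind) (by grind) (by grind))
    (by rw [hu, hv, h2]; exact hπ)
    (by rw [hu, hv, h2]; exact hmap _ (by simp)) (by rw [hu, hv, h2]; exact hmap _ (by simp))
  simpa only [Set.empty_union, doubleButterflyEdges] using s2.1

/-- The glued graph is independent. -/
theorem indep_edgeSet (hD : IsRigidityDirection D) {hD' : IsPolynomialMap D}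
    (h : IsDoubleButterflyGlue G X a b α β a' b' p₁ q₁ p₂ q₂ u v c₁ c₂)
    (hG : IsIndependent (frameworkMatroid W D hD') G) :
    (frameworkMatroid W D hD').Indep ((splitGraph G a b α β a' b').edgeSet ∪
      doubleButterflyEdges p₁ q₁ p₂ q₂ u v c₁ c₂) := by
  have hM := isRigidityLike_frameworkMatroid (W := W) hD hD'
  have hbase := h.indep_union_foldEdges hM hG
  have hQ := h.map_fold_subset
  have hsplit : ∀ e ∈ (splitGraph G a b α β a' b').edgeSet,
      e.map (foldMap a b a' b' u v c₁ c₂) ∈ G.edgeSet := by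
    intro e he
    induction e with | _ x y
    exact (h.splitData.adj_map (x := x) (y := y) he).1
  have himg : Sym2.map (foldMap a b a' b' u v c₁ c₂) '' ((splitGraph G a b α β a' b').edgeSet ∪
      doubleButterflyEdges p₁ q₁ p₂ q₂ u v c₁ c₂) ⊆
      G.edgeSet ∪ foldEdges a b (a' 0) (a' 1) (b' 0) := by
    rw [Set.image_union]
    refine Set.union_subset_union ?_ hQ
    rintro _ ⟨e, he, rfl⟩
    exact hsplit e he
  obtain ⟨T, -, p, hp⟩ := hD.exists_isGenericFramework W
  rw [frameworkMatroid_indep_iff] at hbase ⊢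
  have hdiag : ∀ e ∈ (splitGraph G a b α β a' b').edgeSet ∪
      doubleButterflyEdges p₁ q₁ p₂ q₂ u v c₁ c₂,
      ¬ (e.map (foldMap a b a' b' u v c₁ c₂)).IsDiag := fun e he => hbase.1 _ (himg ⟨e, he, rfl⟩)
  -- The ear is the set of edges that may be identified. Edges of the split graph map injectively
  -- into G, and no folded ear edge belongs to G, since each has an endpoint outside V(G).
  refine ⟨fun e he hcon => hdiag e he ?_, p ∘ foldMap a b a' b' u v c₁ c₂,
    linearIndepOn_of_collapse hD Set.subset_union_right hdiag
      ((hp.linearIndepOn _ hbase).mono himg) ?_ (h.linearIndepOn_doubleButterfly hD hp)⟩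
  · induction e with | _ x y
    rw [Sym2.mk_isDiag_iff] at hcon
    simp [hcon]
  · rintro e (he | he) f hf hef hne
    · rcases hf with hf | hf
      · exact absurd (h.splitData.adj_eq_of_map_eq he hf hef) hne
      · refine absurd (hsplit e he) (h.foldEdges_disjoint ?_)
        rw [hef]
        exact hQ ⟨f, hf, rfl⟩
    · exact he

end IsDoubleButterflyGlue

theorem SplitFamily.map_mem_sharedSet {W : Type*} [Fintype W] [DecidableEq W] {G : VGraph W}
    {X : Finset (Finset W)} {a b : W} {α β : W → Fin 2} {a' b' : Fin 2 → W} {π : W → W}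
    {G' : VGraph W} {C : Finset (Finset W)} (h : SplitFamily G X a b α β a' b' π G' C)
    {A : Finset W} (hA : A ∈ X) (hN : HasSharedNonedge G X A) {e : Sym2 W} (he : e ∈ sharedSet C)
    (heA : ∀ x ∈ e, x ∈ splitCluster G a b α β a' b' A) : e.map π ∈ sharedSet X := by
  induction e with | _ x y
  exact h.shared A hA hN x (heA x (by simp)) y (heA y (by simp)) he

theorem exists_two_of_mem_sharedSet {W : Type*} [Fintype W] [DecidableEq W]
    {C : Finset (Finset W)} {e : Sym2 W} (he : e ∈ sharedSet C) :
    ∃ E ∈ C, ∃ F ∈ C, E ≠ F ∧ (∀ x ∈ e, x ∈ E) ∧ ∀ x ∈ e, x ∈ F := by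
  induction e with | _ x y
  obtain ⟨E, hE, F, hF, hne, h1, h2⟩ := SplitData.exists_two he
  exact ⟨E, hE, F, hF, hne, by simpa using h1, by simpa using h2⟩

theorem nul_completeOn_five {W : Type*} [Fintype W] [DecidableEq W] {M : Matroid (Sym2 W)}
    (hM : IsRigidityLike M) {B : Finset W} (hB : B.card = 5) :
    nul M (completeOn (B : Set W)) = 1 := by
  rw [nul, hM.rk_completeOn B (by omega), ncard_completeOn, hB]
  norm_num [Nat.choose]

/-! ### First case: all clusters on ab keep the same pair of copies -/

namespace IsDoubleButterflyGlue

variable {W : Type*} [Fintype W] [DecidableEq W] {G : VGraph W} {X : Finset (Finset W)} {a b : W}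
  {α β : W → Fin 2} {a' b' : Fin 2 → W} {p₁ q₁ p₂ q₂ u v c₁ c₂ : W}

/-- The glued graph. -/
def glued (_ : IsDoubleButterflyGlue G X a b α β a' b' p₁ q₁ p₂ q₂ u v c₁ c₂) : VGraph W :=
  splitGraph G a b α β a' b' ⊔ (butterfly p₁ q₁ u v c₁ ⊔ butterfly p₂ q₂ u v c₂)

/-- The ear meets the split graph only in gluing vertices, and no two of these are adjacent in a
double butterfly. -/
theorem glued_adj_iff (h : IsDoubleButterflyGlue G X a b α β a' b' p₁ q₁ p₂ q₂ u v c₁ c₂) :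
    ∀ x ∈ (splitGraph G a b α β a' b').verts, ∀ y ∈ (splitGraph G a b α β a' b').verts,
      (h.glued.Adj x y ↔ (splitGraph G a b α β a' b').Adj x y) := by
  intro x hx y hy
  refine ⟨fun hxy => hxy.elim id fun hxy => ?_, Or.inl⟩
  have hΓ : ∀ z ∈ (splitGraph G a b α β a' b').verts,
      z ∈ (butterfly p₁ q₁ u v c₁ ⊔ butterfly p₂ q₂ u v c₂).verts →
      z ∈ ({p₁, q₁, p₂, q₂} : Finset W) := by
    intro z hz hzH
    have := mt (h.notMem z) (not_not_intro hz)
    simp only [butterfly, SimpleGraph.Subgraph.verts_sup, Set.mem_union, Set.mem_insert_iff,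
      Set.mem_singleton_iff, Finset.mem_insert, Finset.mem_singleton] at hzH ⊢
    tauto
  have h1 := hΓ x hx (SimpleGraph.Subgraph.edge_vert _ hxy)
  have h2 := hΓ y hy (SimpleGraph.Subgraph.edge_vert _ hxy.symm)
  refine absurd ?_ (notMem_doubleButterflyEdges h.nodup (f := s(x, y)) ⟨?_, ?_⟩)
  · rw [← edgeSet_doubleButterfly h.nodup]
    exact hxy
  · simpa using hxy.ne
  · simp only [Sym2.mem_iff, forall_eq_or_imp, forall_eq]
    exact ⟨h1, h2⟩

variable {m : ℕ} {D : (Fin m → ℝ) → (Fin m → ℝ) → Fin 3 → ℝ}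

theorem isIndependent_glued (hD : IsRigidityDirection D) {hD' : IsPolynomialMap D}
    (h : IsDoubleButterflyGlue G X a b α β a' b' p₁ q₁ p₂ q₂ u v c₁ c₂)
    (hG : IsIndependent (frameworkMatroid W D hD') G) :
    IsIndependent (frameworkMatroid W D hD') h.glued := by
  rw [IsIndependent, glued, SimpleGraph.Subgraph.edgeSet_sup, edgeSet_doubleButterfly h.nodup]
  exact h.indep_edgeSet hD hG

/-- If the clusters containing `ab` keep the same copies of `a` and `b`, then these two copies can be
split in the glued graph. -/
theorem isSafeBaseGraph_of_relabel_eq (hD : IsRigidityDirection D) {hD' : IsPolynomialMap D}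
    (h : IsDoubleButterflyGlue G X a b α β a' b' p₁ q₁ p₂ q₂ u v c₁ c₂)
    (hw : IsSafeBaseWitness (frameworkMatroid W D hD') G X a b α β)
    (hsame : ∀ A ∈ X, a ∈ A → b ∈ A → ∀ B ∈ X, a ∈ B → b ∈ B →
      s(relabel G a b α β a' b' A a, relabel G a b α β a' b' A b) =
        s(relabel G a b α β a' b' B a, relabel G a b α β a' b' B b)) :
    IsSafeBaseGraph (frameworkMatroid W D hD') h.glued := by
  have hS := h.splitData
  have hind := h.isIndependent_glued hD hw.independent
  have hadj := h.glued_adj_iff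
  have hverts : (splitGraph G a b α β a' b').verts ⊆ h.glued.verts := Set.subset_union_left
  generalize h.glued = G' at *
  generalize foldMap a b a' b' u v c₁ c₂ = π at *
  obtain ⟨A₀, hA₀, B₀, hB₀, hAB₀, ⟨ha, hb⟩, ha', hb'⟩ :=
    SplitData.exists_two hw.safeSplit.mem_shared
  have hN₀ := hS.hasSharedNonedge ha hb
  have hsame' : ∀ A ∈ X, a ∈ A → b ∈ A → ∀ B ∈ X, a ∈ B → b ∈ B →
      relabel G a b α β a' b' A a = relabel G a b α β a' b' B a ∧
        relabel G a b α β a' b' A b = relabel G a b α β a' b' B b := by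
    intro A hA haA hbA B hB haB hbB
    refine (Sym2.eq_iff.1 (hsame A hA haA hbA B hB haB hbB)).resolve_right fun hcon => hS.ne ?_
    have := congrArg π hcon.1
    rwa [hS.map_relabel hA haA, hS.map_relabel hB hbB] at this
  -- No butterfly cluster is needed: the pair of copies remains shared because the replacements of
  -- all clusters on ab contain it.
  have hF : SplitFamily G X a b α β a' b' π G' (splitClusters G X a b α β a' b') := by
    rw [← Finset.union_empty (splitClusters G X a b α β a' b')]
    refine hS.splitFamily hverts hadj ⟨by simp, by simp, by simp, by simp⟩ (by simp) (by simp) ?_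
    intro A hA haA hbA
    obtain ⟨B, hB, hAB, haB, hbB⟩ : ∃ B ∈ X, A ≠ B ∧ a ∈ B ∧ b ∈ B := by
      by_cases hA' : A = A₀
      · exact ⟨B₀, hB₀, hA' ▸ hAB₀, ha', hb'⟩
      · exact ⟨A₀, hA₀, hA', ha, hb⟩
    have hNA := hS.hasSharedNonedge haA hbA
    have hNB := hS.hasSharedNonedge haB hbB
    refine ⟨_, Finset.mem_union_left _ (mem_splitClusters.2 ⟨B, hB, hNB, rfl⟩),
      fun h' => hAB (hS.splitCluster_injOn hA hNA hB hNB h'.symm), ?_, ?_⟩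
    · rw [(hsame' A hA haA hbA B hB haB hbB).1]
      exact hS.relabel_mem hB hNB haB
    · rw [(hsame' A hA haA hbA B hB haB hbB).2]
      exact hS.relabel_mem hB hNB hbB
  have hcl : ∀ e ∈ sharedSet (splitClusters G X a b α β a' b'), ∃ A ∈ X, HasSharedNonedge G X A ∧
      ∀ x ∈ e, x ∈ splitCluster G a b α β a' b' A := by
    intro e he
    obtain ⟨E, hE, -, -, -, heE, -⟩ := exists_two_of_mem_sharedSet he
    obtain ⟨A, hA, hN, rfl⟩ := mem_splitClusters.1 hE
    exact ⟨A, hA, hN, heE⟩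
  have hpair : ∀ e ∈ sharedSet (splitClusters G X a b α β a' b'), e.map π = s(a, b) →
      e = s(relabel G a b α β a' b' A₀ a, relabel G a b α β a' b' A₀ b) := by
    intro e he hab
    obtain ⟨A, hA, hN, heA⟩ := hcl e he
    obtain ⟨⟨haA, hbA⟩, h1⟩ := hS.eq_relabel_pair hA hN heA hab
    rw [h1]
    exact hsame A hA haA hbA A₀ hA₀ ha hb
  have hmapπ : Sym2.map π s(relabel G a b α β a' b' A₀ a, relabel G a b α β a' b' A₀ b) =
      s(a, b) := by
    rw [Sym2.map_mk, hS.map_relabel hA₀ ha, hS.map_relabel hA₀ hb]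
  have hnon : ¬ G'.Adj (relabel G a b α β a' b' A₀ a) (relabel G a b α β a' b' A₀ b) := by
    rw [hF.adj A₀ hA₀ hN₀ _ (hS.relabel_mem hA₀ hN₀ ha) _ (hS.relabel_mem hA₀ hN₀ hb),
      hS.adj_iff hA₀ hN₀ (hS.relabel_mem hA₀ hN₀ ha) (hS.relabel_mem hA₀ hN₀ hb),
      hS.map_relabel hA₀ ha, hS.map_relabel hA₀ hb]
    exact hw.safeSplit.nonedge
  -- The single pair of copies takes the place of ab, so the number of shared nonedges is that of X.
  have hdiff : (sharedSet (splitClusters G X a b α β a' b') : Set (Sym2 W)) \ G'.edgeSet =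
      insert s(relabel G a b α β a' b' A₀ a, relabel G a b α β a' b' A₀ b) hF.oldNonedges := by
    ext e
    constructor
    · rintro ⟨he, heG⟩
      by_cases hab : e.map π = s(a, b)
      · exact Or.inl (hpair e he hab)
      · exact Or.inr ⟨he, heG, hab, hcl e he⟩
    · rintro (rfl | ⟨he, heG, -⟩)
      · exact ⟨hF.shared_pair A₀ hA₀ ha hb, hnon⟩
      · exact ⟨he, heG⟩
  have hnbr : ∀ c, (c = a ∨ c = b) → ∀ A' ∈ splitClusters G X a b α β a' b',
      HasSharedNonedge G' (splitClusters G X a b α β a' b') A' →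
      relabel G a b α β a' b' A₀ c ∈ A' → ∃ w ∈ A', G'.Adj (relabel G a b α β a' b' A₀ c) w := by
    intro c hc A' hA' _ hcA'
    obtain ⟨A, hA, hN, rfl⟩ := mem_splitClusters.1 hA'
    have hcA₀ : c ∈ A₀ := by rcases hc with rfl | rfl <;> assumption
    obtain ⟨h1, h2⟩ := hS.mem_splitCluster hA hN hcA'
    rw [hS.map_relabel hA₀ hcA₀] at h1 h2
    obtain ⟨w, hw, hcw⟩ : ∃ w ∈ splitCluster G a b α β a' b' A,
        (splitGraph G a b α β a' b').Adj (relabel G a b α β a' b' A c) w := by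
      rcases hc with rfl | rfl
      · exact hS.exists_adj_left hA hN h1
      · exact hS.exists_adj_right hA hN h1
    rw [h2] at hcw
    exact ⟨w, hw, (hF.adj A hA hN _ hcA' w hw).2 hcw⟩
  refine isSafeBaseGraph_of_clusterFamily hind hF.family ?_ ?_
    (a := relabel G a b α β a' b' A₀ a) (b := relabel G a b α β a' b' A₀ b)
    ⟨hF.shared_pair A₀ hA₀ ha hb, hnon, isSafeAt_zero (hnbr a (Or.inl rfl)),
      isSafeAt_zero (hnbr b (Or.inr rfl))⟩
  -- π is injective on the shared set: ab has a single preimage there, and other pairs are replaced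
  -- uniformly.
  · refine indep_of_collapse hD (π := π) ?_ (hw.independentCover.subset ?_)
    · intro e he f hf hef
      obtain ⟨A, hA, hNA, heA⟩ := hcl e he
      obtain ⟨B, hB, hNB, hfB⟩ := hcl f hf
      by_cases hab : e.map π = s(a, b)
      · rw [hpair e he hab, hpair f hf (hef ▸ hab)]
      · exact hF.eq_of_map_eq hA hNA hB hNB heA hfB hef (hF.map_mem_sharedSet hA hNA he heA) hab
    · rintro _ ⟨e, he, rfl⟩
      obtain ⟨A, hA, hNA, heA⟩ := hcl e he
      exact hF.map_mem_sharedSet hA hNA he heA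
  · rw [hF.sum_nul hD hw.independent hw.rank_eq, hdiff, Set.ncard_insert_of_notMem,
      hF.ncard_oldNonedges]
    exact fun hcon => hcon.2.2.1 hmapπ

end IsDoubleButterflyGlue

/-- A glued double butterfly such that the clusters containing `ab` are replaced by clusters
containing `p₁q₁` or `p₂q₂`, with both pairs occurring. -/
structure IsTwoWingedGlue {W : Type*} [Fintype W] [DecidableEq W] (G : VGraph W)
    (X : Finset (Finset W)) (a b : W) (α β : W → Fin 2) (a' b' : Fin 2 → W)
    (p₁ q₁ p₂ q₂ u v c₁ c₂ : W) : Prop extends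
    IsDoubleButterflyGlue G X a b α β a' b' p₁ q₁ p₂ q₂ u v c₁ c₂ where
  relabel_or : ∀ A ∈ X, a ∈ A → b ∈ A →
    s(relabel G a b α β a' b' A a, relabel G a b α β a' b' A b) = s(p₁, q₁) ∨
      s(relabel G a b α β a' b' A a, relabel G a b α β a' b' A b) = s(p₂, q₂)
  fst : ∃ A ∈ X, a ∈ A ∧ b ∈ A ∧
    s(relabel G a b α β a' b' A a, relabel G a b α β a' b' A b) = s(p₁, q₁)
  snd : ∃ A ∈ X, a ∈ A ∧ b ∈ A ∧
    s(relabel G a b α β a' b' A a, relabel G a b α β a' b' A b) = s(p₂, q₂)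

/-! ### Second case: the clusters on ab yield both missing edges of the butterflies -/

namespace IsTwoWingedGlue

variable {W : Type*} [Fintype W] [DecidableEq W] {G : VGraph W} {X : Finset (Finset W)} {a b : W}
  {α β : W → Fin 2} {a' b' : Fin 2 → W} {p₁ q₁ p₂ q₂ u v c₁ c₂ : W}

theorem card_wing {p q u v c : W} (h : [p, q, u, v, c].Nodup) :
    ({p, q, u, v, c} : Finset W).card = 5 := by
  simpa using List.toFinset_card_of_nodup h

theorem swap (h : IsTwoWingedGlue G X a b α β a' b' p₁ q₁ p₂ q₂ u v c₁ c₂) :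
    IsTwoWingedGlue G X a b α β a' b' p₂ q₂ p₁ q₁ u v c₂ c₁ where
  thin := h.thin
  safe := h.safe
  new := h.new
  nodup := by
    have := h.nodup
    simp only [List.nodup_cons, List.mem_cons, List.not_mem_nil, or_false, not_or,
      List.nodup_nil, not_false_eq_true, and_true] at this ⊢
    grind
  gluing := by
    rw [← h.gluing]
    ext x
    simp only [Finset.mem_insert, Finset.mem_singleton]
    tauto
  notMem x hx := h.notMem x (by tauto)
  relabel_or A hA ha hb := (h.relabel_or A hA ha hb).symm
  fst := h.snd
  snd := h.fst

theorem glued_swap (h : IsTwoWingedGlue G X a b α β a' b' p₁ q₁ p₂ q₂ u v c₁ c₂) :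
    h.swap.glued = h.glued := by
  rw [IsDoubleButterflyGlue.glued, IsDoubleButterflyGlue.glued, sup_comm (butterfly p₂ q₂ u v c₂)]

theorem nodup_fst (h : IsTwoWingedGlue G X a b α β a' b' p₁ q₁ p₂ q₂ u v c₁ c₂) :
    [p₁, q₁, u, v, c₁].Nodup := by
  have := h.nodup
  simp only [List.nodup_cons, List.mem_cons, List.not_mem_nil, or_false, not_or,
    List.nodup_nil, not_false_eq_true, and_true] at this ⊢
  tauto

theorem card_fst (h : IsTwoWingedGlue G X a b α β a' b' p₁ q₁ p₂ q₂ u v c₁ c₂) :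
    ({p₁, q₁, u, v, c₁} : Finset W).card = 5 := card_wing h.nodup_fst

theorem wing_inter (h : IsTwoWingedGlue G X a b α β a' b' p₁ q₁ p₂ q₂ u v c₁ c₂) :
    ({p₁, q₁, u, v, c₁} : Finset W) ∩ {p₂, q₂, u, v, c₂} = {u, v} := by
  have hnd := h.nodup
  simp only [List.nodup_cons, List.mem_cons, List.not_mem_nil, or_false, not_or,
    List.nodup_nil, not_false_eq_true, and_true] at hnd
  ext x
  simp only [Finset.mem_inter, Finset.mem_insert, Finset.mem_singleton]
  constructor
  · rintro ⟨rfl | rfl | rfl | rfl | rfl, hx⟩ <;> tauto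
  · tauto

theorem wing_not_subset (h : IsTwoWingedGlue G X a b α β a' b' p₁ q₁ p₂ q₂ u v c₁ c₂) :
    ¬ ({p₁, q₁, u, v, c₁} : Finset W) ⊆ {p₂, q₂, u, v, c₂} := by
  intro hsub
  have h1 := h.wing_inter
  rw [Finset.inter_eq_left.2 hsub] at h1
  have h2 := h.card_fst
  rw [h1] at h2
  have := Finset.card_le_two (a := u) (b := v)
  omega

theorem wing_ne (h : IsTwoWingedGlue G X a b α β a' b' p₁ q₁ p₂ q₂ u v c₁ c₂) :
    ({p₁, q₁, u, v, c₁} : Finset W) ≠ {p₂, q₂, u, v, c₂} :=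
  fun h' => h.wing_not_subset h'.subset

theorem glued_adj_fst (h : IsTwoWingedGlue G X a b α β a' b' p₁ q₁ p₂ q₂ u v c₁ c₂) {x y : W}
    (hx : x ∈ ({p₁, q₁, u, v, c₁} : Finset W)) (hy : y ∈ ({p₁, q₁, u, v, c₁} : Finset W))
    (hne : x ≠ y) (hpq : s(x, y) ≠ s(p₁, q₁)) (huv : s(x, y) ≠ s(u, v)) : h.glued.Adj x y :=
  Or.inr (Or.inl ⟨hne, by simpa using hx, by simpa using hy, hpq, huv⟩)

theorem glued_not_adj (h : IsTwoWingedGlue G X a b α β a' b' p₁ q₁ p₂ q₂ u v c₁ c₂) :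
    ¬ h.glued.Adj u v := by
  rintro (hcon | hcon | hcon)
  · exact h.notMem u (by simp) (SimpleGraph.Subgraph.edge_vert _ hcon)
  · exact hcon.2.2.2.2 rfl
  · exact hcon.2.2.2.2 rfl

theorem map_fst (h : IsTwoWingedGlue G X a b α β a' b' p₁ q₁ p₂ q₂ u v c₁ c₂) :
    ∀ x ∈ ({p₁, q₁, u, v, c₁} : Finset W), x ∈ (splitGraph G a b α β a' b').verts →
      foldMap a b a' b' u v c₁ c₂ x = a ∨ foldMap a b a' b' u v c₁ c₂ x = b := by
  intro x hx hxv
  refine h.fold_gluing ?_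
  have h1 := mt (h.notMem x) (not_not_intro hxv)
  simp only [Finset.mem_insert, Finset.mem_singleton] at hx
  tauto

theorem map_snd (h : IsTwoWingedGlue G X a b α β a' b' p₁ q₁ p₂ q₂ u v c₁ c₂) :
    ∀ x ∈ ({p₂, q₂, u, v, c₂} : Finset W), x ∈ (splitGraph G a b α β a' b').verts →
      foldMap a b a' b' u v c₁ c₂ x = a ∨ foldMap a b a' b' u v c₁ c₂ x = b := by
  intro x hx hxv
  refine h.fold_gluing ?_
  have h1 := mt (h.notMem x) (not_not_intro hxv)
  simp only [Finset.mem_insert, Finset.mem_singleton] at hx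
  tauto

theorem notMem_splitCluster (h : IsTwoWingedGlue G X a b α β a' b' p₁ q₁ p₂ q₂ u v c₁ c₂)
    {A : Finset W} (hA : A ∈ X) (hN : HasSharedNonedge G X A) :
    u ∉ splitCluster G a b α β a' b' A ∧ v ∉ splitCluster G a b α β a' b' A :=
  ⟨fun hu => h.notMem u (by simp) (h.splitData.splitCluster_subset_verts hA hN hu),
    fun hv => h.notMem v (by simp) (h.splitData.splitCluster_subset_verts hA hN hv)⟩

/-- The clusters of the glued graph: the split clusters and the vertex sets of the butterflies. -/
noncomputable def clusters (_ : IsTwoWingedGlue G X a b α β a' b' p₁ q₁ p₂ q₂ u v c₁ c₂) :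
    Finset (Finset W) :=
  splitClusters G X a b α β a' b' ∪ {{p₁, q₁, u, v, c₁}, {p₂, q₂, u, v, c₂}}

theorem clusters_swap (h : IsTwoWingedGlue G X a b α β a' b' p₁ q₁ p₂ q₂ u v c₁ c₂) :
    h.swap.clusters = h.clusters := by
  rw [clusters, clusters, Finset.pair_comm]

theorem splitFamily (h : IsTwoWingedGlue G X a b α β a' b' p₁ q₁ p₂ q₂ u v c₁ c₂) :
    SplitFamily G X a b α β a' b' (foldMap a b a' b' u v c₁ c₂) h.glued h.clusters := by
  refine h.splitData.splitFamily Set.subset_union_left h.glued_adj_iff ⟨?_, ?_, ?_, ?_⟩ ?_ ?_ ?_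
  · simp only [Finset.mem_insert, Finset.mem_singleton, forall_eq_or_imp, forall_eq]
    exact ⟨fun x hx => Or.inr (Or.inl (by simpa [butterfly] using hx)),
      fun x hx => Or.inr (Or.inr (by simpa [butterfly] using hx))⟩
  · simp [h.card_fst, h.swap.card_fst]
  · simp only [Finset.mem_insert, Finset.mem_singleton, forall_eq_or_imp, forall_eq, ne_eq,
      not_true_eq_false, false_imp_iff, true_and, and_true, h.wing_inter, h.swap.wing_inter]
    exact ⟨fun _ => Finset.card_le_two, fun _ => Finset.card_le_two⟩
  · simp only [Finset.mem_insert, Finset.mem_singleton, forall_eq_or_imp, forall_eq, ne_eq,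
      not_true_eq_false, false_imp_iff, true_and, and_true]
    exact ⟨fun _ => h.wing_not_subset, fun _ => h.swap.wing_not_subset⟩
  · simp only [Finset.mem_insert (a := (_ : Finset W)), Finset.mem_singleton (a := (_ : Finset W)),
      forall_eq_or_imp (a' := (_ : Finset W)), forall_eq (a' := (_ : Finset W))]
    exact ⟨h.map_fst, h.map_snd⟩
  · intro B hB
    refine ⟨u, ?_, h.notMem u (by simp)⟩
    rcases Finset.mem_insert.1 hB with rfl | hB
    · simp
    · rw [Finset.mem_singleton.1 hB]
      simp
  · intro A hA ha hb
    have hN := h.splitData.hasSharedNonedge ha hb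
    have key : ∀ {B : Finset W} {p q : W},
        B ∈ ({{p₁, q₁, u, v, c₁}, {p₂, q₂, u, v, c₂}} : Finset (Finset W)) → u ∈ B → p ∈ B → q ∈ B →
        s(relabel G a b α β a' b' A a, relabel G a b α β a' b' A b) = s(p, q) →
        ∃ B ∈ splitClusters G X a b α β a' b' ∪ {{p₁, q₁, u, v, c₁}, {p₂, q₂, u, v, c₂}},
          B ≠ splitCluster G a b α β a' b' A ∧
            relabel G a b α β a' b' A a ∈ B ∧ relabel G a b α β a' b' A b ∈ B := by
      intro B p q hB hu hp hq hpq
      refine ⟨B, Finset.mem_union_right _ hB,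
        fun h' => (h.notMem_splitCluster hA hN).1 (h' ▸ hu), ?_⟩
      rcases Sym2.eq_iff.1 hpq with ⟨h1, h2⟩ | ⟨h1, h2⟩ <;> rw [h1, h2]
      · exact ⟨hp, hq⟩
      · exact ⟨hq, hp⟩
    rcases h.relabel_or A hA ha hb with h' | h'
    · exact key (Finset.mem_insert_self _ _) (by simp) (by simp) (by simp) h'
    · exact key (Finset.mem_insert_of_mem (Finset.mem_singleton_self _)) (by simp) (by simp)
        (by simp) h'

theorem fst_mem_clusters (h : IsTwoWingedGlue G X a b α β a' b' p₁ q₁ p₂ q₂ u v c₁ c₂) :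
    {p₁, q₁, u, v, c₁} ∈ h.clusters :=
  Finset.mem_union_right _ (Finset.mem_insert_self _ _)

theorem mem_clusters (h : IsTwoWingedGlue G X a b α β a' b' p₁ q₁ p₂ q₂ u v c₁ c₂) {B : Finset W} :
    B ∈ h.clusters ↔ (∃ A ∈ X, HasSharedNonedge G X A ∧ splitCluster G a b α β a' b' A = B) ∨
      B = {p₁, q₁, u, v, c₁} ∨ B = {p₂, q₂, u, v, c₂} := by
  rw [clusters, Finset.mem_union, mem_splitClusters, Finset.mem_insert, Finset.mem_singleton]

theorem mem_sharedSet (h : IsTwoWingedGlue G X a b α β a' b' p₁ q₁ p₂ q₂ u v c₁ c₂) :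
    s(u, v) ∈ sharedSet h.clusters := by
  refine (pair_mem_sharedSet fun h' => ?_).2 ⟨_, h.fst_mem_clusters, {p₂, q₂, u, v, c₂}, ?_,
    h.wing_ne, h.wing_inter⟩
  · have := h.nodup_fst
    simp [h'] at this
  · exact h.mem_clusters.2 (Or.inr (Or.inr rfl))

theorem relabel_pair (h : IsTwoWingedGlue G X a b α β a' b' p₁ q₁ p₂ q₂ u v c₁ c₂) {A : Finset W}
    (hA : A ∈ X) (ha : a ∈ A) (hb : b ∈ A) :
    s(relabel G a b α β a' b' A a, relabel G a b α β a' b' A b) ∈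
        (sharedSet h.clusters : Set (Sym2 W)) \ h.glued.edgeSet ∧
      Sym2.map (foldMap a b a' b' u v c₁ c₂)
        s(relabel G a b α β a' b' A a, relabel G a b α β a' b' A b) = s(a, b) := by
  have hS := h.splitData
  have hN := hS.hasSharedNonedge ha hb
  refine ⟨⟨h.splitFamily.shared_pair A hA ha hb, fun hcon => h.safe.nonedge ?_⟩, ?_⟩
  · have h1 := (h.splitFamily.adj A hA hN _ (hS.relabel_mem hA hN ha) _
      (hS.relabel_mem hA hN hb)).1 hcon
    rwa [hS.adj_iff hA hN (hS.relabel_mem hA hN ha) (hS.relabel_mem hA hN hb),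
      hS.map_relabel hA ha, hS.map_relabel hA hb] at h1
  · rw [Sym2.map_mk, hS.map_relabel hA ha, hS.map_relabel hA hb]

theorem pair_fst (h : IsTwoWingedGlue G X a b α β a' b' p₁ q₁ p₂ q₂ u v c₁ c₂) :
    s(p₁, q₁) ∈ (sharedSet h.clusters : Set (Sym2 W)) \ h.glued.edgeSet ∧
      Sym2.map (foldMap a b a' b' u v c₁ c₂) s(p₁, q₁) = s(a, b) := by
  obtain ⟨A, hA, ha, hb, hpq⟩ := h.fst
  rw [← hpq]
  exact h.relabel_pair hA ha hb

theorem pair_snd (h : IsTwoWingedGlue G X a b α β a' b' p₁ q₁ p₂ q₂ u v c₁ c₂) :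
    s(p₂, q₂) ∈ (sharedSet h.clusters : Set (Sym2 W)) \ h.glued.edgeSet ∧
      Sym2.map (foldMap a b a' b' u v c₁ c₂) s(p₂, q₂) = s(a, b) := by
  obtain ⟨A, hA, ha, hb, hpq⟩ := h.snd
  rw [← hpq]
  exact h.relabel_pair hA ha hb

theorem sharedSet_cases (h : IsTwoWingedGlue G X a b α β a' b' p₁ q₁ p₂ q₂ u v c₁ c₂)
    {e : Sym2 W} (he : e ∈ sharedSet h.clusters) :
    (∃ A ∈ X, HasSharedNonedge G X A ∧ ∀ x ∈ e, x ∈ splitCluster G a b α β a' b' A) ∨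
      e = s(u, v) := by
  obtain ⟨E, hE, F, hF, hEF, heE, heF⟩ := exists_two_of_mem_sharedSet he
  rcases h.mem_clusters.1 hE with ⟨A, hA, hN, rfl⟩ | hE
  · exact Or.inl ⟨A, hA, hN, heE⟩
  rcases h.mem_clusters.1 hF with ⟨A, hA, hN, rfl⟩ | hF
  · exact Or.inl ⟨A, hA, hN, heF⟩
  right
  have hinter : E ∩ F = {u, v} := by
    rcases hE with rfl | rfl <;> rcases hF with rfl | rfl
    · exact absurd rfl hEF
    · exact h.wing_inter
    · exact h.swap.wing_inter
    · exact absurd rfl hEF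
  have huv : ∀ x ∈ e, x = u ∨ x = v := by
    intro x hx
    have : x ∈ E ∩ F := Finset.mem_inter.2 ⟨heE x hx, heF x hx⟩
    simpa [hinter] using this
  induction e with | _ x y
  have hne := ne_of_mem_sharedSet he
  rw [Sym2.eq_iff]
  rcases huv x (by simp) with rfl | rfl <;> rcases huv y (by simp) with rfl | rfl <;> tauto

theorem eq_pair (h : IsTwoWingedGlue G X a b α β a' b' p₁ q₁ p₂ q₂ u v c₁ c₂) {A : Finset W}
    {e : Sym2 W} (hA : A ∈ X) (hN : HasSharedNonedge G X A)
    (heA : ∀ x ∈ e, x ∈ splitCluster G a b α β a' b' A)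
    (heab : e.map (foldMap a b a' b' u v c₁ c₂) = s(a, b)) : e = s(p₁, q₁) ∨ e = s(p₂, q₂) := by
  obtain ⟨⟨ha, hb⟩, h1⟩ := h.splitData.eq_relabel_pair hA hN heA heab
  rw [h1]
  exact h.relabel_or A hA ha hb

theorem sharedSet_sdiff (h : IsTwoWingedGlue G X a b α β a' b' p₁ q₁ p₂ q₂ u v c₁ c₂) :
    (sharedSet h.clusters : Set (Sym2 W)) \ h.glued.edgeSet =
      insert s(u, v) (insert s(p₁, q₁) (insert s(p₂, q₂) h.splitFamily.oldNonedges)) := by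
  ext e
  constructor
  · rintro ⟨he, heG⟩
    rcases h.sharedSet_cases he with ⟨A, hA, hN, heA⟩ | h1
    · by_cases heab : e.map (foldMap a b a' b' u v c₁ c₂) = s(a, b)
      · rcases h.eq_pair hA hN heA heab with h1 | h1
        · exact Or.inr (Or.inl h1)
        · exact Or.inr (Or.inr (Or.inl h1))
      · exact Or.inr (Or.inr (Or.inr ⟨he, heG, heab, A, hA, hN, heA⟩))
    · exact Or.inl h1
  · rintro (rfl | rfl | rfl | ⟨he, heG, -⟩)
    · exact ⟨h.mem_sharedSet, h.glued_not_adj⟩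
    · exact h.pair_fst.1
    · exact h.pair_snd.1
    · exact ⟨he, heG⟩

theorem ne_pair (h : IsTwoWingedGlue G X a b α β a' b' p₁ q₁ p₂ q₂ u v c₁ c₂) :
    s(u, v) ≠ s(p₁, q₁) ∧ s(p₁, q₁) ≠ s(p₂, q₂) := by
  have hnd := h.nodup
  simp only [List.nodup_cons, List.mem_cons, List.not_mem_nil, or_false, not_or,
    List.nodup_nil, not_false_eq_true, and_true] at hnd
  rw [ne_eq, Sym2.eq_iff, ne_eq, Sym2.eq_iff]
  refine ⟨?_, ?_⟩
  · rintro (⟨h1, -⟩ | ⟨h1, -⟩) <;> rw [h1] at hnd <;> tauto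
  · rintro (⟨h1, -⟩ | ⟨h1, -⟩) <;> rw [h1] at hnd <;> tauto

/-- The pair ab is lost, and p₁q₁, p₂q₂, uv are gained. -/
theorem ncard_sharedSet_sdiff (h : IsTwoWingedGlue G X a b α β a' b' p₁ q₁ p₂ q₂ u v c₁ c₂) :
    ((sharedSet h.clusters : Set (Sym2 W)) \ h.glued.edgeSet).ncard =
      ((sharedSet X : Set (Sym2 W)) \ G.edgeSet).ncard + 2 := by
  have huv : s(u, v) ∉ h.splitFamily.oldNonedges := by
    rintro ⟨-, -, -, A, hA, hN, huA⟩
    exact (h.notMem_splitCluster hA hN).1 (huA u (by simp))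
  have hold : ∀ {e : Sym2 W}, e.map (foldMap a b a' b' u v c₁ c₂) = s(a, b) →
      e ∉ h.splitFamily.oldNonedges := fun he hcon => hcon.2.2.1 he
  have h1 := h.ne_pair
  have h2 := h.swap.ne_pair
  rw [h.sharedSet_sdiff, Set.ncard_insert_of_notMem, Set.ncard_insert_of_notMem,
    Set.ncard_insert_of_notMem, ← h.splitFamily.ncard_oldNonedges]
  · exact hold h.pair_snd.2
  · rw [Set.mem_insert_iff, not_or]
    exact ⟨h1.2, hold h.pair_fst.2⟩
  · rw [Set.mem_insert_iff, Set.mem_insert_iff, not_or, not_or]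
    exact ⟨h1.1, h2.1, huv⟩

/-- Both edges missing from the butterfly are shared: p₁q₁ with a split cluster and uv with the
other butterfly. This is where a new cluster gets nullity one. -/
theorem inducedEdges_fst (h : IsTwoWingedGlue G X a b α β a' b' p₁ q₁ p₂ q₂ u v c₁ c₂) :
    inducedEdges (h.glued.edgeSet ∪ sharedSet h.clusters) {p₁, q₁, u, v, c₁} =
      completeOn (({p₁, q₁, u, v, c₁} : Finset W) : Set W) := by
  ext e
  induction e with | _ x y
  constructor
  · rintro ⟨he, hxy⟩
    refine mem_completeOn.2 ⟨?_, hxy x (by simp), hxy y (by simp)⟩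
    exact he.elim (fun he => (show h.glued.Adj x y from he).ne) ne_of_mem_sharedSet
  · intro he
    obtain ⟨hne, hx, hy⟩ := mem_completeOn.1 he
    refine ⟨?_, he.2⟩
    by_cases h1 : s(x, y) = s(p₁, q₁)
    · exact Or.inr (h1 ▸ h.pair_fst.1.1)
    by_cases h2 : s(x, y) = s(u, v)
    · exact Or.inr (h2 ▸ h.mem_sharedSet)
    exact Or.inl (h.glued_adj_fst hx hy hne h1 h2)

theorem exists_adj_fst (h : IsTwoWingedGlue G X a b α β a' b' p₁ q₁ p₂ q₂ u v c₁ c₂) {z : W}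
    (hz : z = u ∨ z = v) : ∃ w ∈ ({p₁, q₁, u, v, c₁} : Finset W), h.glued.Adj z w := by
  have hnd := h.nodup_fst
  simp only [List.nodup_cons, List.mem_cons, List.not_mem_nil, or_false, not_or,
    List.nodup_nil, not_false_eq_true, and_true] at hnd
  refine ⟨c₁, by simp, h.glued_adj_fst ?_ (by simp) ?_ ?_ ?_⟩
  · rcases hz with rfl | rfl <;> simp
  · rcases hz with rfl | rfl <;> tauto
  · rw [ne_eq, Sym2.eq_iff]
    rcases hz with rfl | rfl <;> rintro (⟨h1, h2⟩ | ⟨h1, h2⟩) <;> rw [h1] at hnd <;> tauto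
  · rw [ne_eq, Sym2.eq_iff]
    rintro (⟨h1, h2⟩ | ⟨h1, h2⟩) <;> rw [h2] at hnd <;> tauto

theorem exists_adj (h : IsTwoWingedGlue G X a b α β a' b' p₁ q₁ p₂ q₂ u v c₁ c₂) {z : W}
    (hz : z = u ∨ z = v) : ∀ B ∈ h.clusters, HasSharedNonedge h.glued h.clusters B → z ∈ B →
      ∃ w ∈ B, h.glued.Adj z w := by
  intro B hB _ hzB
  rcases h.mem_clusters.1 hB with ⟨A, hA, hN, rfl⟩ | rfl | rfl
  · exact absurd (h.splitData.splitCluster_subset_verts hA hN hzB) (h.notMem z (by tauto))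
  · exact h.exists_adj_fst hz
  · rw [← h.glued_swap]
    exact h.swap.exists_adj_fst hz

variable {m : ℕ} {D : (Fin m → ℝ) → (Fin m → ℝ) → Fin 3 → ℝ}

/-- The split clusters carry the nullities of X, and each of the two K₅'s adds one, matching the two
additional shared nonedges. -/
theorem sum_nul (hD : IsRigidityDirection D) {hD' : IsPolynomialMap D}
    (h : IsTwoWingedGlue G X a b α β a' b' p₁ q₁ p₂ q₂ u v c₁ c₂)
    (hw : IsSafeBaseWitness (frameworkMatroid W D hD') G X a b α β) :
    ∑ A ∈ h.clusters, nul (frameworkMatroid W D hD')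
      (inducedEdges (h.glued.edgeSet ∪ sharedSet h.clusters) A) =
        ((sharedSet h.clusters : Set (Sym2 W)) \ h.glued.edgeSet).ncard := by
  have hM := isRigidityLike_frameworkMatroid (W := W) hD hD'
  have hdisj : Disjoint (splitClusters G X a b α β a' b')
      {{p₁, q₁, u, v, c₁}, {p₂, q₂, u, v, c₂}} := by
    rw [Finset.disjoint_left]
    intro B hB hB'
    obtain ⟨A, hA, hN, rfl⟩ := mem_splitClusters.1 hB
    refine (h.notMem_splitCluster hA hN).1 ?_
    rcases Finset.mem_insert.1 hB' with h1 | h1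
    · simp [h1]
    · simp [Finset.mem_singleton.1 h1]
  have hsnd := h.swap.inducedEdges_fst
  rw [h.glued_swap, h.clusters_swap] at hsnd
  rw [h.ncard_sharedSet_sdiff, Nat.cast_add, ← h.splitFamily.sum_nul hD hw.independent hw.rank_eq]
  conv_lhs => rw [show h.clusters = splitClusters G X a b α β a' b' ∪
    {{p₁, q₁, u, v, c₁}, {p₂, q₂, u, v, c₂}} from rfl]
  rw [Finset.sum_union hdisj, Finset.sum_pair h.wing_ne]
  change _ + (nul _ (inducedEdges (h.glued.edgeSet ∪ sharedSet h.clusters) _) +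
    nul _ (inducedEdges (h.glued.edgeSet ∪ sharedSet h.clusters) _)) = _
  rw [h.inducedEdges_fst, hsnd, nul_completeOn_five hM h.card_fst,
    nul_completeOn_five hM h.swap.card_fst]
  rfl

/-- Folding sends the shared pairs other than uv into the shared set of X, and only p₁q₁ and p₂q₂
are identified, both with ab. These two disjoint edges are independent in the folded position, so
collapse applies. -/
theorem isIndependentCover (hD : IsRigidityDirection D) {hD' : IsPolynomialMap D}
    (h : IsTwoWingedGlue G X a b α β a' b' p₁ q₁ p₂ q₂ u v c₁ c₂)
    (hX : IsIndependentCover (frameworkMatroid W D hD') X) :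
    IsIndependentCover (frameworkMatroid W D hD') h.clusters := by
  have hM := isRigidityLike_frameworkMatroid (W := W) hD hD'
  have hXv : ∀ e ∈ sharedSet X, a' 0 ∉ e := by
    intro e he h0
    obtain ⟨A, hA, -, -, -, heA, -⟩ := exists_two_of_mem_sharedSet he
    exact h.new.left_notMem 0 (h.thin.subset_verts A hA (heA _ h0))
  -- The pair uv is folded onto an edge at a vertex outside G, which is a 0-extension of the shared
  -- set of X.
  have hbase := hM.indep_star _ (a' 0) {a' 1} hX (fun ⟨e, he, h0⟩ => hXv e he h0)
    (by simpa using h.new.left_ne) (by simp)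
  obtain ⟨hu, hv, -, -⟩ := h.fold_new
  have huv : Sym2.map (foldMap a b a' b' u v c₁ c₂) s(u, v) = s(a' 0, a' 1) := by
    rw [Sym2.map_mk, hu, hv]
  have hmap : ∀ e ∈ sharedSet h.clusters, e ≠ s(u, v) → ∃ A ∈ X, HasSharedNonedge G X A ∧
      (∀ x ∈ e, x ∈ splitCluster G a b α β a' b' A) ∧
        e.map (foldMap a b a' b' u v c₁ c₂) ∈ sharedSet X := by
    intro e he hne
    obtain ⟨A, hA, hN, heA⟩ := (h.sharedSet_cases he).resolve_right hne
    exact ⟨A, hA, hN, heA, h.splitFamily.map_mem_sharedSet hA hN he heA⟩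
  have himg : Sym2.map (foldMap a b a' b' u v c₁ c₂) '' (sharedSet h.clusters : Set (Sym2 W)) ⊆
      (sharedSet X : Set (Sym2 W)) ∪ starOn (a' 0) {a' 1} := by
    rintro _ ⟨e, he, rfl⟩
    by_cases hne : e = s(u, v)
    · rw [hne, huv]
      exact Or.inr (mem_starOn.2 ⟨_, Finset.mem_singleton_self _, rfl⟩)
    · obtain ⟨-, -, -, -, h1⟩ := hmap e he hne
      exact Or.inl h1
  obtain ⟨T, -, p, hp⟩ := hD.exists_isGenericFramework W
  rw [frameworkMatroid_indep_iff] at hbase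
  rw [IsIndependentCover, frameworkMatroid_indep_iff]
  refine ⟨fun e he => not_isDiag_of_mem_sharedSet he, p ∘ foldMap a b a' b' u v c₁ c₂,
    linearIndepOn_of_collapse hD (E₀ := {s(p₁, q₁), s(p₂, q₂)}) ?_
      (fun e he => hbase.1 _ (himg ⟨e, he, rfl⟩)) ((hp.linearIndepOn _ hbase).mono himg) ?_ ?_⟩
  · rintro e (rfl | rfl)
    · exact h.pair_fst.1.1
    · exact h.pair_snd.1.1
  · intro e he f hf hef hne
    have hcase : ∀ {e f : Sym2 W}, e = s(u, v) → f ∈ sharedSet h.clusters → e ≠ f →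
        e.map (foldMap a b a' b' u v c₁ c₂) ≠ f.map (foldMap a b a' b' u v c₁ c₂) := by
      intro e f he hf hne hef
      obtain ⟨-, -, -, -, h1⟩ := hmap f hf (fun h' => hne (he.trans h'.symm))
      rw [← hef, he, huv] at h1
      exact hXv _ h1 (by simp)
    by_cases heuv : e = s(u, v)
    · exact absurd hef (hcase heuv hf hne)
    by_cases hfuv : f = s(u, v)
    · exact absurd hef.symm (hcase hfuv he hne.symm)
    obtain ⟨A, hA, hNA, heA, hes⟩ := hmap e he heuv
    obtain ⟨B, hB, hNB, hfB, -⟩ := hmap f hf hfuv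
    by_cases heab : e.map (foldMap a b a' b' u v c₁ c₂) = s(a, b)
    · exact h.eq_pair hA hNA heA heab
    · exact absurd (h.splitFamily.eq_of_map_eq hA hNA hB hNB heA hfB hef hes heab) hne
  · have hstar : ∀ {x y : W}, Sym2.map (foldMap a b a' b' u v c₁ c₂) s(x, y) = s(a, b) →
        foldMap a b a' b' u v c₁ c₂ y ≠ foldMap a b a' b' u v c₁ c₂ x := by
      intro x y hxy hcon
      rw [Sym2.map_mk, hcon] at hxy
      have hdiag : Sym2.IsDiag s(a, b) := by
        rw [← hxy]
        simp
      exact h.splitData.ne (by simpa using hdiag)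
    have hnd := h.nodup
    simp only [List.nodup_cons, List.mem_cons, List.not_mem_nil, or_false, not_or,
      List.nodup_nil, not_false_eq_true, and_true] at hnd
    have s1 := linearIndepOn_union_star hD (p := p ∘ foldMap a b a' b' u v c₁ c₂)
      (E := ∅) (z := p₁) (T := {q₁}) (linearIndepOn_empty ℝ _) (by simp) (by simp [endpoints_empty])
      (by simp only [Finset.mem_singleton]; tauto)
      (hp.star_comp (by simp) (by simpa using hstar h.pair_fst.2) (by simp))
    have s2 := linearIndepOn_union_star hD (p := p ∘ foldMap a b a' b' u v c₁ c₂)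
      (z := p₂) (T := {q₂}) s1
      (by
        rintro e (he | ⟨t, ht, rfl⟩)
        · exact absurd he (Set.notMem_empty e)
        · rw [Finset.mem_singleton.1 ht, Sym2.mk_isDiag_iff]
          tauto)
      (notMem_endpoints_union (by simp [endpoints_empty])
        (notMem_endpoints_starOn (by tauto) (by rw [Finset.mem_singleton]; tauto)))
      (by rw [Finset.mem_singleton]; tauto)
      (hp.star_comp (by simp) (by simpa using hstar h.pair_snd.2) (by simp))
    refine s2.mono ?_
    rintro e (rfl | rfl)
    · exact Or.inl (Or.inr (mem_starOn.2 ⟨_, Finset.mem_singleton_self _, rfl⟩))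
    · exact Or.inr (mem_starOn.2 ⟨_, Finset.mem_singleton_self _, rfl⟩)

/-- The pair `uv` can be split in the glued graph. -/
theorem isSafeBaseGraph (hD : IsRigidityDirection D) {hD' : IsPolynomialMap D}
    (h : IsTwoWingedGlue G X a b α β a' b' p₁ q₁ p₂ q₂ u v c₁ c₂)
    (hw : IsSafeBaseWitness (frameworkMatroid W D hD') G X a b α β) :
    IsSafeBaseGraph (frameworkMatroid W D hD') h.glued :=
  isSafeBaseGraph_of_clusterFamily (h.isIndependent_glued hD hw.independent) h.splitFamily.family
    (h.isIndependentCover hD hw.independentCover) (h.sum_nul hD hw)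
    ⟨h.mem_sharedSet, h.glued_not_adj, isSafeAt_zero (h.exists_adj (Or.inl rfl)),
      isSafeAt_zero (h.exists_adj (Or.inr rfl))⟩

end IsTwoWingedGlue

/-- The four gluing vertices exhaust the four copies of a and b. If two clusters on ab keep
different pairs, each pair kept by a cluster on ab differs from another key gluing pair, so it is
p₁q₁ or p₂q₂, and both occur. -/
theorem isSafeBaseGraph_of_isSafeSplitAndGlue {W : Type*} [Fintype W] [DecidableEq W] {m : ℕ}
    {D : (Fin m → ℝ) → (Fin m → ℝ) → Fin 3 → ℝ} (hD : IsRigidityDirection D)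
    (hD' : IsPolynomialMap D) {G H G' : VGraph W} {Γ : Finset W} (hH : IsDoubleButterfly H Γ)
    (hG' : IsSafeSplitAndGlue (frameworkMatroid W D hD') G H Γ G') :
    IsSafeBaseGraph (frameworkMatroid W D hD') G' := by
  obtain ⟨p₁, q₁, p₂, q₂, u, v, c₁, c₂, hnd, rfl, rfl⟩ := hH
  obtain ⟨X, a, b, α, β, hw, a', b', hnew, Y, hY, hsub, hinter, hkey, rfl⟩ := hG'
  have hcard : ({p₁, q₁, p₂, q₂} : Finset W).card = 4 := by
    have hnd' : [p₁, q₁, p₂, q₂].Nodup :=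
      hnd.sublist (List.take_sublist 4 [p₁, q₁, p₂, q₂, u, v, c₁, c₂])
    simpa using List.toFinset_card_of_nodup hnd'
  have hΓ : ({p₁, q₁, p₂, q₂} : Finset W) = {a' 0, a' 1, b' 0, b' 1} :=
    Finset.eq_of_subset_of_card_le hsub (by rw [hcard]; exact Finset.card_le_four)
  have hnot : ∀ x, x = u ∨ x = v ∨ x = c₁ ∨ x = c₂ →
      x ∉ (splitGraph G a b α β a' b').verts := by
    intro x hx hxv
    have hxH : x ∈ (butterfly p₁ q₁ u v c₁ ⊔ butterfly p₂ q₂ u v c₂).verts := by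
      simp only [butterfly, SimpleGraph.Subgraph.verts_sup, Set.mem_union, Set.mem_insert_iff,
        Set.mem_singleton_iff]
      tauto
    have hxΓ : x ∈ (({p₁, q₁, p₂, q₂} : Finset W) : Set W) := hinter ▸ ⟨hxv, hxH⟩
    simp only [Finset.coe_insert, Finset.coe_singleton, Set.mem_insert_iff,
      Set.mem_singleton_iff] at hxΓ
    simp only [List.nodup_cons, List.mem_cons, List.not_mem_nil, or_false, not_or,
      List.nodup_nil, not_false_eq_true, and_true] at hnd
    rcases hx with rfl | rfl | rfl | rfl <;> rcases hxΓ with h1 | h1 | h1 | h1 <;>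
      simp [h1] at hnd
  have h : IsDoubleButterflyGlue G X a b α β a' b' p₁ q₁ p₂ q₂ u v c₁ c₂ :=
    ⟨hw.twoThin, hw.safeSplit, hnew, hnd, hΓ, hnot⟩
  have hmem : ∀ A ∈ X, a ∈ A → b ∈ A →
      s(relabel G a b α β a' b' A a, relabel G a b α β a' b' A b) ∈
        keyPairs {p₁, q₁, p₂, q₂} Y := by
    intro A hA ha hb
    rw [← hkey]
    exact h.splitData.relabel_pair_mem_keyPairs hA ha hb
  by_cases hsame : ∀ A ∈ X, a ∈ A → b ∈ A → ∀ B ∈ X, a ∈ B → b ∈ B →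
      s(relabel G a b α β a' b' A a, relabel G a b α β a' b' A b) =
        s(relabel G a b α β a' b' B a, relabel G a b α β a' b' B b)
  · exact h.isSafeBaseGraph_of_relabel_eq hD hw hsame
  push Not at hsame
  obtain ⟨A, hA, haA, hbA, B, hB, haB, hbB, hne⟩ := hsame
  have hcases : ∀ {f g : Sym2 W}, f ∈ keyPairs {p₁, q₁, p₂, q₂} Y →
      g ∈ keyPairs {p₁, q₁, p₂, q₂} Y → f ≠ g → f = s(p₁, q₁) ∨ f = s(p₂, q₂) :=
    fun hf hg hfg => keyPairs_doubleButterfly hD hnd (edgeSet_doubleButterfly hnd) hY hf hg hfg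
  have hor : ∀ C ∈ X, a ∈ C → b ∈ C →
      s(relabel G a b α β a' b' C a, relabel G a b α β a' b' C b) = s(p₁, q₁) ∨
        s(relabel G a b α β a' b' C a, relabel G a b α β a' b' C b) = s(p₂, q₂) := by
    intro C hC haC hbC
    by_cases hCA : s(relabel G a b α β a' b' C a, relabel G a b α β a' b' C b) =
        s(relabel G a b α β a' b' A a, relabel G a b α β a' b' A b)
    · rw [hCA]
      exact hcases (hmem A hA haA hbA) (hmem B hB haB hbB) hne
    · exact hcases (hmem C hC haC hbC) (hmem A hA haA hbA) hCA
  have hboth : IsTwoWingedGlue G X a b α β a' b' p₁ q₁ p₂ q₂ u v c₁ c₂ := by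
    rcases hor A hA haA hbA with h1 | h1 <;> rcases hor B hB haB hbB with h2 | h2
    · exact absurd (h1.trans h2.symm) hne
    · exact ⟨h, hor, ⟨A, hA, haA, hbA, h1⟩, ⟨B, hB, haB, hbB, h2⟩⟩
    · exact ⟨h, hor, ⟨B, hB, haB, hbB, h2⟩, ⟨A, hA, haA, hbA, h1⟩⟩
    · exact absurd (h1.trans h2.symm) hne
  exact hboth.isSafeBaseGraph hD hw

end SplitAndGlue

/-- Constructing safe base graphs. Part (i) concerns the generic 3-dimensional rigidity matroid and
the cofactor matroid; parts (ii) and (iii) also hold in every 3-dimensional abstract rigidity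
matroid. -/
theorem theorem3p10 {W : Type*} [Fintype W] [DecidableEq W] (M : Matroid (Sym2 W)) :
    ((M = RigidityMatroids.genericRigidityMatroid W ∨ M = RigidityMatroids.cofactorMatroid W) →
      ∀ (G H G' : VGraph W) (Γ : Finset W), SplitAndGlue.IsDoubleButterfly H Γ →
        SplitAndGlue.IsSafeSplitAndGlue M G H Γ G' → SplitAndGlue.IsSafeBaseGraph M G') ∧
    ((M = RigidityMatroids.genericRigidityMatroid W ∨ M = RigidityMatroids.cofactorMatroid W ∨
        RigidityMatroids.IsAbstractRigidityMatroid M) →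
      (∀ (k : ℕ) (G H G' : VGraph W), SplitAndGlue.IsSafeBaseGraph M G →
        SplitAndGlue.IsIndependent M H → SplitAndGlue.IsKSum k G H G' →
        SplitAndGlue.IsSafeBaseGraph M G') ∧
      (∀ G G' : VGraph W, SplitAndGlue.IsSafeBaseGraph M G → SplitAndGlue.IsHennebergI G G' →
        SplitAndGlue.IsSafeBaseGraph M G')) := by
  refine ⟨?_, fun hM => ?_⟩
  · rintro (rfl | rfl) G H G' Γ hH hG'
    · exact SplitAndGlue.isSafeBaseGraph_of_isSafeSplitAndGlue
        SplitAndGlue.isRigidityDirection_bar _ hH hG'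
    · exact SplitAndGlue.isSafeBaseGraph_of_isSafeSplitAndGlue
        SplitAndGlue.isRigidityDirection_cofactor _ hH hG'
  · have hM' : SplitAndGlue.IsRigidityLike M := by
      rcases hM with rfl | rfl | hM
      · exact SplitAndGlue.isRigidityLike_frameworkMatroid SplitAndGlue.isRigidityDirection_bar _
      · exact SplitAndGlue.isRigidityLike_frameworkMatroid
          SplitAndGlue.isRigidityDirection_cofactor _
      · exact SplitAndGlue.isRigidityLike_of_isAbstractRigidityMatroid hM
    exact ⟨fun k G H G' hG hH hk => SplitAndGlue.isSafeBaseGraph_of_isKSum hM' hG hH hk,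
      fun G G' hG h => SplitAndGlue.isSafeBaseGraph_of_isHennebergI hM' hG h⟩
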